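/- Let $N\ge 2$, let $\Omega\subset\mathbb R^N$ be a bounded domain with $\partial\Omega\in C^2$, and let $\lambda\in(0,1)$, $\underline s^+\in\mathbb R$, $\underline s^->\frac{2N}{N+2}$, $L\ge 0$, $\alpha>0$, $a^+,b^+\in\mathbb R$ and $M\in[0,\infty)$. There is a constant $C$, depending only on $\lambda,\underline s^-,\underline s^+,N,L,\alpha,a^+,b^+,\Omega$ and $M$, with the following property. Let $p,q,a,b:\overline\Omega\to\mathbb R$ be Lipschitz continuous with Lipschitz constant $L$ and such that for all $x\in\overline\Omega$ $$\underline s^-\le\min\{p(x),q(x)\}\le\underline s^+,\qquad |p(x)-q(x)|<\frac{2}{N+2},$$ $$0\le a(x)\le a^+,\qquad 0\le b(x)\le b^+,\qquad a(x)+b(x)\ge\alpha .$$ For $\epsilon\in(0,1)$ put $$\mathcal F_\epsilon(x,\xi)=a(x)\,(\epsilon^2+|\xi|^2)^{\frac{p(x)-2}{2}}+b(x)\,(\epsilon^2+|\xi|^2)^{\frac{q(x)-2}{2}} .$$ Then for every $\epsilon\in(0,1)$ and every $u\in C^1(\overline\Omega)\cap H^2(\Omega)\cap H^1_0(\Omega)$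 with $\|u\|_{L^2(\Omega)}\le M$ the two integrals below are finite and $$\int_{\partial\Omega}\mathcal F_\epsilon(x,\nabla u)\,|\nabla u|^2\,dS\le\lambda\int_\Omega\mathcal F_\epsilon(x,\nabla u)\,|u_{xx}|^2\,dx+C,\qquad |u_{xx}|^2=\sum_{i,j=1}^N\bigl|D^2_{x_ix_j}u\bigr|^2 .$$ -/

import Mathlib

open MeasureTheory Filter Topology
open scoped NNReal ENNReal ContDiff InnerProductSpace

namespace DoublePhase

/-- `∂Ω ∈ C²`: near every boundary point, for some unit vector `ν`, the set `Ω` is the part of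
a ball lying strictly above the graph of a `C²` function defined on the hyperplane `ν^⊥`. -/
def HasC2Boundary {N : ℕ} (Ω : Set (EuclideanSpace ℝ (Fin N))) : Prop :=
  ∀ x₀ ∈ frontier Ω, ∃ ν : EuclideanSpace ℝ (Fin N), ‖ν‖ = 1 ∧
    ∃ γ : ((Submodule.span ℝ {ν})ᗮ : Submodule ℝ (EuclideanSpace ℝ (Fin N))) → ℝ,
      ContDiff ℝ 2 γ ∧ ∃ r : ℝ, 0 < r ∧
        Ω ∩ Metric.ball x₀ r =
          {x ∈ Metric.ball x₀ r |
            γ (((Submodule.span ℝ {ν})ᗮ).orthogonalProjectionOnto x) < ⟪ν, x⟫_ℝ}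

/-- `φ ∈ C_c^∞(Ω)`. -/
structure IsTestFunction {N : ℕ} (Ω : Set (EuclideanSpace ℝ (Fin N)))
    (φ : EuclideanSpace ℝ (Fin N) → ℝ) : Prop where
  smooth : ContDiff ℝ ∞ φ
  compact : HasCompactSupport φ
  support_subset : tsupport φ ⊆ Ω

/-- `g` is the weak derivative `D_{x_j} f` in `Ω` (used for `f, g ∈ L²(Ω)`). -/
def IsWeakPartial {N : ℕ} (Ω : Set (EuclideanSpace ℝ (Fin N))) (j : Fin N)
    (f g : EuclideanSpace ℝ (Fin N) → ℝ) : Prop :=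
  ∀ φ : EuclideanSpace ℝ (Fin N) → ℝ, IsTestFunction Ω φ →
    ∫ x in Ω, f x * fderiv ℝ φ x (EuclideanSpace.single j 1) = - ∫ x in Ω, g x * φ x

/-- `u ∈ C¹(Ω̄)`, where `Du` denotes the gradient of `u` in `Ω` together with its continuous
extension to `Ω̄`. -/
structure IsC1Closure {N : ℕ} (Ω : Set (EuclideanSpace ℝ (Fin N)))
    (u : EuclideanSpace ℝ (Fin N) → ℝ)
    (Du : EuclideanSpace ℝ (Fin N) → EuclideanSpace ℝ (Fin N)) : Prop where
  continuousOn : ContinuousOn u (closure Ω)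
  continuousOn_grad : ContinuousOn Du (closure Ω)
  hasGradientAt : ∀ x ∈ Ω, HasGradientAt u (Du x) x

/-- `u ∈ H²(Ω) = W^{2,2}(Ω)`, with weak gradient `Du` and weak second derivatives
`D2u i j = D²_{x_i x_j} u`. -/
structure IsH2 {N : ℕ} (Ω : Set (EuclideanSpace ℝ (Fin N)))
    (u : EuclideanSpace ℝ (Fin N) → ℝ)
    (Du : EuclideanSpace ℝ (Fin N) → EuclideanSpace ℝ (Fin N))
    (D2u : Fin N → Fin N → EuclideanSpace ℝ (Fin N) → ℝ) : Prop where
  memLp : MemLp u 2 (volume.restrict Ω)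
  memLp_grad : ∀ i, MemLp (fun x => Du x i) 2 (volume.restrict Ω)
  memLp_hess : ∀ i j, MemLp (D2u i j) 2 (volume.restrict Ω)
  weak_grad : ∀ i, IsWeakPartial Ω i u (fun x => Du x i)
  weak_hess : ∀ i j, IsWeakPartial Ω j (fun x => Du x i) (D2u i j)

/-- `u`, with weak gradient `Du`, belongs to `H¹₀(Ω)`, the closure of `C_c^∞(Ω)` in the norm of
`H¹(Ω)`. -/
def IsH10 {N : ℕ} (Ω : Set (EuclideanSpace ℝ (Fin N)))
    (u : EuclideanSpace ℝ (Fin N) → ℝ)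
    (Du : EuclideanSpace ℝ (Fin N) → EuclideanSpace ℝ (Fin N)) : Prop :=
  ∃ φ : ℕ → EuclideanSpace ℝ (Fin N) → ℝ, (∀ n, IsTestFunction Ω (φ n)) ∧
    Tendsto (fun n => eLpNorm (fun x => φ n x - u x) 2 (volume.restrict Ω)) atTop (𝓝 0) ∧
    Tendsto (fun n => eLpNorm (fun x => gradient (φ n) x - Du x) 2 (volume.restrict Ω))
      atTop (𝓝 0)

/-- The conditions on the exponents `p, q` and the coefficients `a, b` in `Ω̄`: bounds
`sm ≤ min{p,q} ≤ sp`, the gap condition `|p - q| < 2/(N+2)`, Lipschitz continuity with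
constant `L`, nonnegativity, upper bounds `ap, bp` for `a, b`, and `a + b ≥ α`. -/
structure Data {N : ℕ} (Ω : Set (EuclideanSpace ℝ (Fin N))) (sm sp : ℝ) (L : ℝ≥0) (α ap bp : ℝ)
    (p q a b : EuclideanSpace ℝ (Fin N) → ℝ) : Prop where
  lower : ∀ x ∈ closure Ω, sm ≤ min (p x) (q x)
  upper : ∀ x ∈ closure Ω, min (p x) (q x) ≤ sp
  gap : ∀ x ∈ closure Ω, |p x - q x| < 2 / ((N : ℝ) + 2)
  lipschitz_p : LipschitzOnWith L p (closure Ω)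
  lipschitz_q : LipschitzOnWith L q (closure Ω)
  lipschitz_a : LipschitzOnWith L a (closure Ω)
  lipschitz_b : LipschitzOnWith L b (closure Ω)
  a_nonneg : ∀ x ∈ closure Ω, 0 ≤ a x
  b_nonneg : ∀ x ∈ closure Ω, 0 ≤ b x
  a_le : ∀ x ∈ closure Ω, a x ≤ ap
  b_le : ∀ x ∈ closure Ω, b x ≤ bp
  nondegenerate : ∀ x ∈ closure Ω, α ≤ a x + b x

/-- `F_ε(x,ξ) = a(x)(ε² + |ξ|²)^{(p(x)-2)/2} + b(x)(ε² + |ξ|²)^{(q(x)-2)/2}`. -/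
noncomputable def F {N : ℕ} (p q a b : EuclideanSpace ℝ (Fin N) → ℝ) (ε : ℝ)
    (x ξ : EuclideanSpace ℝ (Fin N)) : ℝ :=
  a x * (ε ^ 2 + ‖ξ‖ ^ 2) ^ ((p x - 2) / 2) + b x * (ε ^ 2 + ‖ξ‖ ^ 2) ^ ((q x - 2) / 2)

/-- `|u_xx|² = ∑_{i,j} |D²_{x_i x_j} u|²`. -/
def hessSq {N : ℕ} (D2u : Fin N → Fin N → EuclideanSpace ℝ (Fin N) → ℝ)
    (x : EuclideanSpace ℝ (Fin N)) : ℝ :=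
  ∑ i, ∑ j, (D2u i j x) ^ 2

/-- The surface measure `dS` on `∂Ω`: the `(N-1)`-dimensional Hausdorff measure, normalized to
agree with Lebesgue measure on hyperplanes, restricted to `∂Ω`. -/
noncomputable def surfaceMeasure {N : ℕ} (Ω : Set (EuclideanSpace ℝ (Fin N))) :
    Measure (EuclideanSpace ℝ (Fin N)) :=
  (Measure.euclideanHausdorffMeasure (N - 1)).restrict (frontier Ω)

end DoublePhase

/-!
# A boundary estimate for double phase operators with variable exponents

Write `s = min p q`, `e = s + 3/(N+2)`, `t = |∇u|²` and `H = |u_xx|²`. All estimates take place in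
the region `t ≥ 1`; to stay inside the class of bounded weakly differentiable functions, the powers
`t^σ` are replaced by the `C¹` truncations `truncPow t σ = (t-1)₊² t^(σ-2)`, which vanish for `t ≤ 1`.
For `t ≥ 1` the regularized density is comparable with its value at `ε = 0`, so that
`F_ε ≥ (α/2) t^((s-2)/2)`, uniformly in `ε`.

*Trace inequality* (`exists_trace`). The boundary is locally a graph, and integrating the derivative
along vertical segments bounds `∫_∂Ω |v|` by the `W^{1,1}(Ω)` norm of `v`. It is applied to
`v = a truncPow t (p/2) + b truncPow t (q/2)`, which controls `F_ε |∇u|²` on the boundary up to a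
constant. The derivatives of `v` contain `a t^((p-1)/2) H^(1/2)`, absorbed by Young's inequality into
`δ a t^((p-2)/2) H + C t^(p/2)`, and logarithmic terms `t^(p/2) log t` from the derivative of the
exponent. The gap condition gives `p, q ≤ e - 1/(N+2)`, hence the remainders are bounded by
`t^(e/2) = |∇u|^e` (`exists_weakDiff_truncation`). It remains to estimate `∫_Ω |∇u|^e`.

*Interpolation* (`exists_interpolation`). As `u ∈ H¹₀(Ω)`, integration by parts gives
`∫ |∇u|^e ≈ ∫ W · ∇u = -∫ u div W` with `W = truncPow t (e/2-1) ∇u`, and `|div W|` is bounded by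
`t^((e-2)/2) H^(1/2)` and a logarithmic term. By Young's inequality the right-hand side is at most
`δ ∫ t^((s-2)/2) H + δ ∫ (|∇u|^e + |u|^(e(N+2)/N)) + C`; all powers are strictly subcritical because
`e - s = 3/(N+2)` is smaller than `4/(N+2)` (`exists_interpolation_pointwise`).

*Embedding* (`exists_embedding`). The power of `u` is absorbed with the inequality
`∫ |u|^(e(N+2)/N) ≤ C ∫ |∇u|^e + C` for functions bounded in `L²`. It comes from the
Gagliardo–Nirenberg inequality for a truncation of `|u|^k`, `k = ((N+2)e-2)/N`, and Hölder's
inequality; since the inequality with exponent one is linear in the integrals, the variable exponent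
causes only another logarithmic term. The condition `sm > 2N/(N+2)`
gives `e > 1`, and also the positivity of the exponents in the interpolation.

The calculus of weak derivatives rests on mollification: `WeakDiff.comp₂` is the chain rule for `C¹`
functions of two variables, which covers powers with variable exponents; the Lipschitz data are
weakly differentiable by Rademacher's theorem.
-/

open scoped Convolution

namespace DoublePhase

/-! ### Mollification of integrable functions -/

/-- A standard sequence of bump functions at the origin, supported in balls of radius
`2 / (n + 1)`. -/
noncomputable def bump (N n : ℕ) : ContDiffBump (0 : EuclideanSpace ℝ (Fin N)) where
  rIn := 1 / ((n : ℝ) + 1)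
  rOut := 2 / ((n : ℝ) + 1)
  rIn_pos := by positivity
  rIn_lt_rOut := by
    have : (0 : ℝ) < (n : ℝ) + 1 := by positivity
    gcongr
    norm_num

/-- The `n`-th mollification of `f`: its convolution with the normalized `n`-th bump function. -/
noncomputable def mollify {N : ℕ} (n : ℕ) (f : EuclideanSpace ℝ (Fin N) → ℝ) :
    EuclideanSpace ℝ (Fin N) → ℝ :=
  (bump N n).normed volume ⋆[ContinuousLinearMap.lsmul ℝ ℝ, volume] f

section

variable {N : ℕ} {f g : EuclideanSpace ℝ (Fin N) → ℝ}

lemma tendsto_rOut_bump (N : ℕ) : Tendsto (fun n => (bump N n).rOut) atTop (𝓝 0) := by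
  have h := (tendsto_one_div_add_atTop_nhds_zero_nat (𝕜 := ℝ)).const_mul 2
  simpa [bump, mul_one_div, div_eq_mul_inv] using h

lemma mollify_apply (n : ℕ) (f : EuclideanSpace ℝ (Fin N) → ℝ) (x : EuclideanSpace ℝ (Fin N)) :
    mollify n f x = ∫ y, (bump N n).normed volume (x - y) * f y := by
  simp only [mollify, convolution_lsmul_swap, smul_eq_mul]

lemma contDiff_mollify (hf : Integrable f) (n : ℕ) : ContDiff ℝ ∞ (mollify n f) :=
  (bump N n).hasCompactSupport_normed.contDiff_convolution_left _
    (bump N n).contDiff_normed hf.locallyIntegrable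

lemma ae_tendsto_mollify (hf : Integrable f) :
    ∀ᵐ x, Tendsto (fun n => mollify n f x) atTop (𝓝 (f x)) := by
  refine ContDiffBump.ae_convolution_tendsto_right_of_locallyIntegrable (K := 2)
    (tendsto_rOut_bump N) (Eventually.of_forall fun n => ?_) hf.locallyIntegrable
  simp only [bump]
  rw [mul_one_div]

lemma tendsto_mollify_of_continuousAt (hf : Integrable f) {x : EuclideanSpace ℝ (Fin N)}
    (hx : ContinuousAt f x) : Tendsto (fun n => mollify n f x) atTop (𝓝 (f x)) :=
  ContDiffBump.convolution_tendsto_right (tendsto_rOut_bump N)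
    (Eventually.of_forall fun _ => hf.aestronglyMeasurable) (hx.tendsto.comp tendsto_snd)
    tendsto_const_nhds

lemma integrable_mollify (hf : Integrable f) (n : ℕ) : Integrable (mollify n f) :=
  (bump N n).integrable_normed.integrable_convolution _ hf

lemma integrable_bump_mul (hf : Integrable f) (n : ℕ) (x : EuclideanSpace ℝ (Fin N)) :
    Integrable fun y => (bump N n).normed volume (x - y) * f y :=
  ((bump N n).hasCompactSupport_normed.convolutionExists_left
    (ContinuousLinearMap.lsmul ℝ ℝ) (bump N n).continuous_normed hf.locallyIntegrable
      x).integrable_swap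

lemma mollify_sub (hf : Integrable f) (hg : Integrable g) (n : ℕ)
    (x : EuclideanSpace ℝ (Fin N)) :
    mollify n (fun y => f y - g y) x = mollify n f x - mollify n g x := by
  simp only [mollify_apply, mul_sub]
  exact integral_sub (integrable_bump_mul hf n x) (integrable_bump_mul hg n x)

lemma mollify_nonneg (hf : ∀ x, 0 ≤ f x) (n : ℕ) (x : EuclideanSpace ℝ (Fin N)) :
    0 ≤ mollify n f x := by
  rw [mollify_apply]
  exact integral_nonneg fun y => mul_nonneg ((bump N n).nonneg_normed _) (hf y)

lemma abs_mollify_le {C : ℝ} (hC : ∀ x, |f x| ≤ C) (n : ℕ)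
    (x : EuclideanSpace ℝ (Fin N)) : |mollify n f x| ≤ C := by
  have hi : Integrable fun y => (bump N n).normed volume (x - y) :=
    (bump N n).integrable_normed.comp_sub_left x
  rw [mollify_apply]
  calc |∫ y, (bump N n).normed volume (x - y) * f y|
      ≤ ∫ y, (bump N n).normed volume (x - y) * C := by
        rw [← Real.norm_eq_abs]
        refine norm_integral_le_of_norm_le (hi.mul_const C) (Eventually.of_forall fun y => ?_)
        rw [Real.norm_eq_abs, abs_mul, abs_of_nonneg ((bump N n).nonneg_normed _)]
        exact mul_le_mul_of_nonneg_left (hC y) ((bump N n).nonneg_normed _)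
    _ = C := by
        rw [integral_mul_const, integral_sub_left_eq_self (fun y => (bump N n).normed volume y),
          (bump N n).integral_normed, one_mul]

lemma mollify_eq_zero {n : ℕ} {x : EuclideanSpace ℝ (Fin N)}
    (h : ∀ y ∈ Metric.closedBall x (bump N n).rOut, f y = 0) : mollify n f x = 0 := by
  rw [mollify_apply]
  refine integral_eq_zero_of_ae (Eventually.of_forall fun y => ?_)
  by_cases hy : y ∈ Metric.closedBall x (bump N n).rOut
  · simp [h y hy]
  · have : x - y ∉ Function.support ((bump N n).normed volume) := by
      rw [(bump N n).support_normed_eq, mem_ball_zero_iff]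
      rw [Metric.mem_closedBall, dist_comm, dist_eq_norm] at hy
      intro h'
      exact hy h'.le
    simp [Function.notMem_support.1 this]

/-- For a nonnegative integrable `f` the mollifications have the same integral as `f` and converge
almost everywhere, hence in `L¹`. -/
lemma tendsto_integral_abs_mollify_sub_of_nonneg (hf : Integrable f) (h0 : ∀ x, 0 ≤ f x) :
    Tendsto (fun n => ∫ x, |mollify n f x - f x|) atTop (𝓝 0) := by
  have hint : ∀ n, ∫ x, mollify n f x = ∫ x, f x := fun n => by
    have := integral_convolution (μ := volume) (ContinuousLinearMap.lsmul ℝ ℝ)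
      ((bump N n).integrable_normed (μ := volume)) hf
    rw [(bump N n).integral_normed] at this
    simpa [mollify] using this
  have hmin : Tendsto (fun n => ∫ x, min (mollify n f x) (f x)) atTop (𝓝 (∫ x, f x)) := by
    refine tendsto_integral_of_dominated_convergence f
      (fun n => ((integrable_mollify hf n).inf hf).aestronglyMeasurable) hf
      (fun n => Eventually.of_forall fun x => ?_) ?_
    · rw [Real.norm_eq_abs, abs_of_nonneg (le_min (mollify_nonneg h0 n x) (h0 x))]
      exact min_le_right _ _
    · filter_upwards [ae_tendsto_mollify hf] with x hx
      simpa using hx.min (tendsto_const_nhds (x := f x))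
  have heq : ∀ n, ∫ x, |mollify n f x - f x|
      = 2 * (∫ x, f x) - 2 * ∫ x, min (mollify n f x) (f x) := fun n => by
    have h1 : ∀ x, |mollify n f x - f x|
        = (mollify n f x + f x) - 2 * min (mollify n f x) (f x) := fun x => by
      rcases le_total (mollify n f x) (f x) with h | h
      · rw [min_eq_left h, abs_of_nonpos (by linarith)]; ring
      · rw [min_eq_right h, abs_of_nonneg (by linarith)]; ring
    simp only [h1]
    have i1 : Integrable fun x => mollify n f x + f x := (integrable_mollify hf n).add hf
    have i2 : Integrable fun x => min (mollify n f x) (f x) := (integrable_mollify hf n).inf hf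
    rw [integral_sub i1 (i2.const_mul 2), integral_const_mul,
      integral_add (integrable_mollify hf n) hf, hint]
    ring
  simp only [heq]
  simpa using (hmin.const_mul 2).const_sub (2 * ∫ x, f x)

lemma tendsto_integral_abs_mollify_sub (hf : Integrable f) :
    Tendsto (fun n => ∫ x, |mollify n f x - f x|) atTop (𝓝 0) := by
  have hp : Integrable fun x => max (f x) 0 := hf.pos_part
  have hm : Integrable fun x => max (-f x) 0 := hf.neg_part
  have key := (tendsto_integral_abs_mollify_sub_of_nonneg hp fun x => le_max_right _ _).add
    (tendsto_integral_abs_mollify_sub_of_nonneg hm fun x => le_max_right _ _)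
  rw [add_zero] at key
  have hdec : f = fun x => max (f x) 0 - max (-f x) 0 := by
    ext x
    rcases le_total (f x) 0 with h | h
    · rw [max_eq_right h, max_eq_left (by linarith)]; ring
    · rw [max_eq_left h, max_eq_right (by linarith)]; ring
  refine tendsto_of_tendsto_of_tendsto_of_le_of_le tendsto_const_nhds key
    (fun n => integral_nonneg fun x => abs_nonneg _) (fun n => ?_)
  have i1 : Integrable fun x => |mollify n (fun x => max (f x) 0) x - max (f x) 0| :=
    ((integrable_mollify hp n).sub hp).abs
  have i2 : Integrable fun x => |mollify n (fun x => max (-f x) 0) x - max (-f x) 0| :=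
    ((integrable_mollify hm n).sub hm).abs
  have i0 : Integrable fun x => |mollify n f x - f x| :=
    ((integrable_mollify hf n).sub hf).abs
  refine (integral_mono i0 (i1.add i2) fun x => ?_).trans_eq
    (integral_add i1 i2)
  have h1 : mollify n f x
      = mollify n (fun x => max (f x) 0) x - mollify n (fun x => max (-f x) 0) x := by
    conv_lhs => rw [hdec]
    exact mollify_sub hp hm n x
  have h2 := congrFun hdec x
  simp only [Pi.add_apply] at h2 ⊢
  rw [h1]
  conv_lhs => rw [h2]
  rw [sub_sub_sub_comm]
  exact abs_sub _ _

lemma fderiv_comp_sub_left {ρ : EuclideanSpace ℝ (Fin N) → ℝ} (hρ : Differentiable ℝ ρ)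
    (x y v : EuclideanSpace ℝ (Fin N)) :
    fderiv ℝ (fun y => ρ (x - y)) y v = - fderiv ℝ ρ (x - y) v := by
  have h1 : HasFDerivAt ρ (fderiv ℝ ρ (x - y)) (x - y) := (hρ _).hasFDerivAt
  have h2 : HasFDerivAt (fun y => x - y)
      (-ContinuousLinearMap.id ℝ (EuclideanSpace ℝ (Fin N))) y :=
    (hasFDerivAt_id (𝕜 := ℝ) y).const_sub x
  have h3 : HasFDerivAt (fun y => ρ (x - y)) _ y := h1.comp y h2
  rw [h3.fderiv]
  simp

lemma fderiv_convolution_apply {ρ : EuclideanSpace ℝ (Fin N) → ℝ} (hρ : ContDiff ℝ ∞ ρ)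
    (hc : HasCompactSupport ρ) (hf : Integrable f) (x v : EuclideanSpace ℝ (Fin N)) :
    fderiv ℝ (ρ ⋆[ContinuousLinearMap.lsmul ℝ ℝ, volume] f) x v
      = ∫ y, fderiv ℝ ρ (x - y) v * f y := by
  have hd := hc.hasFDerivAt_convolution_left (μ := volume)
    (ContinuousLinearMap.lsmul ℝ ℝ) (hρ.of_le (by norm_cast))
    hf.locallyIntegrable x
  have hex := ((hc.fderiv ℝ).convolutionExists_left (μ := volume)
      (ContinuousLinearMap.precompL (EuclideanSpace ℝ (Fin N)) (ContinuousLinearMap.lsmul ℝ ℝ))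
      (hρ.continuous_fderiv (by simp)) hf.locallyIntegrable x).integrable_swap
  rw [hd.fderiv, convolution_eq_swap, ContinuousLinearMap.integral_apply hex]
  refine integral_congr_ae (Eventually.of_forall fun y => ?_)
  rfl

/-- Mollification commutes with the weak derivative at points whose mollification ball lies
in `Ω`. -/
lemma fderiv_mollify_indicator {Ω : Set (EuclideanSpace ℝ (Fin N))} (hΩ : MeasurableSet Ω)
    (hf : IntegrableOn f Ω) {j : Fin N}
    (hw : IsWeakPartial Ω j f g) {n : ℕ} {x : EuclideanSpace ℝ (Fin N)}
    (hx : Metric.closedBall x (bump N n).rOut ⊆ Ω) :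
    fderiv ℝ (mollify n (Ω.indicator f)) x (EuclideanSpace.single j 1)
      = mollify n (Ω.indicator g) x := by
  have hρs : ContDiff ℝ ∞ ((bump N n).normed volume) := (bump N n).contDiff_normed
  have hρc : HasCompactSupport ((bump N n).normed volume) := (bump N n).hasCompactSupport_normed
  have hsupp := (bump N n).support_normed_eq (μ := volume)
  have e1 := fderiv_convolution_apply hρs hρc (hf.integrable_indicator hΩ) x
    (EuclideanSpace.single j 1)
  rw [← mollify] at e1
  rw [e1, mollify_apply]
  generalize (bump N n).normed volume = ρ at *
  have hφ : IsTestFunction Ω fun y => ρ (x - y) := by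
    refine ⟨hρs.comp (contDiff_const.sub contDiff_id), ?_, ?_⟩
    · exact hρc.comp_homeomorph (Homeomorph.subLeft x)
    · refine subset_trans ?_ hx
      refine closure_minimal (fun y hy => ?_) Metric.isClosed_closedBall
      have : x - y ∈ Function.support ρ := hy
      rw [hsupp, mem_ball_zero_iff] at this
      rw [Metric.mem_closedBall, dist_comm, dist_eq_norm]
      exact this.le
  have e2 : (∫ y, fderiv ℝ ρ (x - y) (EuclideanSpace.single j 1) * Ω.indicator f y)
      = ∫ y in Ω, fderiv ℝ ρ (x - y) (EuclideanSpace.single j 1) * f y := by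
    rw [← integral_indicator hΩ]
    congr 1; ext y
    by_cases hy : y ∈ Ω <;> simp [hy]
  have e3 : (∫ y, ρ (x - y) * Ω.indicator g y) = ∫ y in Ω, ρ (x - y) * g y := by
    rw [← integral_indicator hΩ]
    congr 1; ext y
    by_cases hy : y ∈ Ω <;> simp [hy]
  rw [e2, e3]
  have := hw _ hφ
  simp only [fderiv_comp_sub_left (hρs.differentiable (by simp)), mul_neg, integral_neg,
    neg_inj] at this
  simpa [mul_comm] using this

/-- If `Aₙ → A` almost everywhere boundedly and `Gₙ → G` in `L¹`, then `∫ Aₙ Gₙ → ∫ A G`. -/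
lemma tendsto_integral_mul_of_bounded_of_L1 {α : Type*} [MeasurableSpace α] {μ : Measure α}
    {A G : α → ℝ} {An Gn : ℕ → α → ℝ} {C : ℝ}
    (hAm : ∀ n, AEStronglyMeasurable (An n) μ) (hAb : ∀ n, ∀ᵐ x ∂μ, |An n x| ≤ C)
    (hA : ∀ᵐ x ∂μ, Tendsto (fun n => An n x) atTop (𝓝 (A x)))
    (hGi : ∀ n, Integrable (Gn n) μ) (hG : Integrable G μ)
    (hGn : Tendsto (fun n => ∫ x, |Gn n x - G x| ∂μ) atTop (𝓝 0)) :
    Tendsto (fun n => ∫ x, An n x * Gn n x ∂μ) atTop (𝓝 (∫ x, A x * G x ∂μ)) := by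
  have h1 : Tendsto (fun n => ∫ x, An n x * G x ∂μ) atTop (𝓝 (∫ x, A x * G x ∂μ)) := by
    refine tendsto_integral_of_dominated_convergence (fun x => C * |G x|)
      (fun n => (hAm n).mul hG.aestronglyMeasurable) (hG.abs.const_mul C) (fun n => ?_) ?_
    · filter_upwards [hAb n] with x hx
      rw [Real.norm_eq_abs, abs_mul]
      exact mul_le_mul_of_nonneg_right hx (abs_nonneg _)
    · filter_upwards [hA] with x hx using hx.mul_const _
  have h2 : Tendsto (fun n => ∫ x, An n x * (Gn n x - G x) ∂μ) atTop (𝓝 0) := by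
    refine squeeze_zero_norm (fun n => ?_) (by simpa using hGn.const_mul C)
    calc ‖∫ x, An n x * (Gn n x - G x) ∂μ‖ ≤ ∫ x, C * |Gn n x - G x| ∂μ := by
          refine norm_integral_le_of_norm_le (((hGi n).sub hG).abs.const_mul C) ?_
          filter_upwards [hAb n] with x hx
          rw [Real.norm_eq_abs, abs_mul]
          exact mul_le_mul_of_nonneg_right hx (abs_nonneg _)
      _ = C * ∫ x, |Gn n x - G x| ∂μ := integral_const_mul _ _
  have h3 := h1.add h2
  rw [add_zero] at h3
  refine h3.congr fun n => ?_
  have hb : ∀ᵐ x ∂μ, ‖An n x‖ ≤ C := hAb n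
  have i1 : Integrable (fun x => Gn n x - G x) μ := (hGi n).sub hG
  rw [← integral_add (hG.bdd_mul (hAm n) hb) (i1.bdd_mul (hAm n) hb)]
  congr 1; ext x; ring

end

/-! ### Weakly differentiable functions and the chain rule -/

/-- `f` is a bounded function on `Ω` with weak partial derivatives `g j ∈ L¹(Ω)`. Boundedness makes
the class stable under products and compositions with `C¹` functions. -/
structure WeakDiff {N : ℕ} (Ω : Set (EuclideanSpace ℝ (Fin N))) (f : EuclideanSpace ℝ (Fin N) → ℝ)
    (g : Fin N → EuclideanSpace ℝ (Fin N) → ℝ) : Prop where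
  aesm : AEStronglyMeasurable f (volume.restrict Ω)
  bdd : ∃ C : ℝ, ∀ x ∈ Ω, |f x| ≤ C
  int : ∀ j, IntegrableOn (g j) Ω
  weak : ∀ j, IsWeakPartial Ω j f (g j)

section

variable {N : ℕ} {Ω : Set (EuclideanSpace ℝ (Fin N))} {f h : EuclideanSpace ℝ (Fin N) → ℝ}
  {g k : Fin N → EuclideanSpace ℝ (Fin N) → ℝ}

lemma IsTestFunction.integrable_fderiv {φ : EuclideanSpace ℝ (Fin N) → ℝ}
    (hφ : IsTestFunction Ω φ) (v : EuclideanSpace ℝ (Fin N)) :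
    Integrable fun x => fderiv ℝ φ x v :=
  ((hφ.smooth.continuous_fderiv (by simp)).clm_apply continuous_const).integrable_of_hasCompactSupport
    (hφ.compact.fderiv_apply ℝ v)

lemma IsTestFunction.bounded {φ : EuclideanSpace ℝ (Fin N) → ℝ}
    (hφ : IsTestFunction Ω φ) : ∃ B : ℝ, ∀ x, |φ x| ≤ B :=
  hφ.compact.exists_bound_of_continuous hφ.smooth.continuous

lemma IsTestFunction.eq_zero {φ : EuclideanSpace ℝ (Fin N) → ℝ}
    (hφ : IsTestFunction Ω φ) {x : EuclideanSpace ℝ (Fin N)} (hx : x ∉ Ω) : φ x = 0 :=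
  image_eq_zero_of_notMem_tsupport fun h => hx (hφ.support_subset h)

lemma IsTestFunction.fderiv_eq_zero {φ : EuclideanSpace ℝ (Fin N) → ℝ}
    (hφ : IsTestFunction Ω φ) {x : EuclideanSpace ℝ (Fin N)} (hx : x ∉ Ω) : fderiv ℝ φ x = 0 :=
  image_eq_zero_of_notMem_tsupport fun h => hx (hφ.support_subset (tsupport_fderiv_subset ℝ h))

lemma IsTestFunction.exists_closedBall_subset {φ : EuclideanSpace ℝ (Fin N) → ℝ}
    (hφ : IsTestFunction Ω φ) (hΩ : IsOpen Ω) :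
    ∀ᶠ n in atTop, ∀ x ∈ tsupport φ, Metric.closedBall x (bump N n).rOut ⊆ Ω := by
  obtain ⟨δ, hδ, hsub⟩ := hφ.compact.exists_cthickening_subset_open hΩ hφ.support_subset
  filter_upwards [(tendsto_rOut_bump N).eventually_lt_const hδ] with n hn x hx y hy
  exact hsub (Metric.mem_cthickening_of_dist_le y x δ _ hx ((Metric.mem_closedBall.1 hy).trans hn.le))

lemma exists_bound_on_square {Φ : ℝ → ℝ → ℝ} (hΦ : Continuous fun z : ℝ × ℝ => Φ z.1 z.2)
    (C : ℝ) : ∃ B : ℝ, ∀ x y, |x| ≤ C → |y| ≤ C → |Φ x y| ≤ B := by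
  obtain ⟨B, hB⟩ := ((isCompact_Icc (a := -C) (b := C)).prod
    (isCompact_Icc (a := -C) (b := C))).exists_bound_of_continuousOn hΦ.continuousOn
  exact ⟨B, fun x y hx hy => hB (x, y) ⟨abs_le.1 hx, abs_le.1 hy⟩⟩

lemma integrableOn_of_bounded (hfin : volume Ω ≠ ⊤) (hΩ : MeasurableSet Ω)
    (hf : AEStronglyMeasurable f (volume.restrict Ω)) {C : ℝ} (hC : ∀ x ∈ Ω, |f x| ≤ C) :
    IntegrableOn f Ω := by
  have : IsFiniteMeasure (volume.restrict Ω) := isFiniteMeasure_restrict.2 hfin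
  exact Integrable.of_bound hf C ((ae_restrict_iff' hΩ).2 (Eventually.of_forall hC))

lemma WeakDiff.integrableOn (hf : WeakDiff Ω f g) (hfin : volume Ω ≠ ⊤) (hΩ : MeasurableSet Ω) :
    IntegrableOn f Ω := by
  obtain ⟨C, hC⟩ := hf.bdd
  exact integrableOn_of_bounded hfin hΩ hf.aesm hC

/-- Chain rule for a `C¹` function of two bounded weakly differentiable functions: it holds
classically for the mollifications and passes to the limit. -/
lemma WeakDiff.comp₂ (hΩ : IsOpen Ω) (hfin : volume Ω ≠ ⊤) (hf : WeakDiff Ω f g)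
    (hh : WeakDiff Ω h k) {Φ Φ₁ Φ₂ : ℝ → ℝ → ℝ}
    (hΦ : ∀ x y, HasFDerivAt (fun z : ℝ × ℝ => Φ z.1 z.2)
      (Φ₁ x y • ContinuousLinearMap.fst ℝ ℝ ℝ + Φ₂ x y • ContinuousLinearMap.snd ℝ ℝ ℝ) (x, y))
    (hΦ₁ : Continuous fun z : ℝ × ℝ => Φ₁ z.1 z.2)
    (hΦ₂ : Continuous fun z : ℝ × ℝ => Φ₂ z.1 z.2) :
    WeakDiff Ω (fun x => Φ (f x) (h x))
      (fun j x => Φ₁ (f x) (h x) * g j x + Φ₂ (f x) (h x) * k j x) := by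
  have hΩm := hΩ.measurableSet
  obtain ⟨C₁, hC₁⟩ := hf.bdd
  obtain ⟨C₂, hC₂⟩ := hh.bdd
  set C := max (max C₁ C₂) 0 with hC
  have hΦc : Continuous fun z : ℝ × ℝ => Φ z.1 z.2 :=
    continuous_iff_continuousAt.2 fun z => (hΦ z.1 z.2).continuousAt
  have hfC : ∀ x, |Ω.indicator f x| ≤ C := fun x => by
    by_cases hx : x ∈ Ω
    · rw [Set.indicator_of_mem hx]
      exact (hC₁ x hx).trans ((le_max_left _ _).trans (le_max_left _ _))
    · rw [Set.indicator_of_notMem hx, abs_zero]; exact le_max_right _ _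
  have hhC : ∀ x, |Ω.indicator h x| ≤ C := fun x => by
    by_cases hx : x ∈ Ω
    · rw [Set.indicator_of_mem hx]
      exact (hC₂ x hx).trans ((le_max_right _ _).trans (le_max_left _ _))
    · rw [Set.indicator_of_notMem hx, abs_zero]; exact le_max_right _ _
  obtain ⟨B, hB⟩ := exists_bound_on_square hΦc C
  obtain ⟨B₁, hB₁⟩ := exists_bound_on_square hΦ₁ C
  obtain ⟨B₂, hB₂⟩ := exists_bound_on_square hΦ₂ C
  have hfi : Integrable (Ω.indicator f) := (hf.integrableOn hfin hΩm).integrable_indicator hΩm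
  have hhi : Integrable (Ω.indicator h) := (hh.integrableOn hfin hΩm).integrable_indicator hΩm
  have hm : ∀ {Ψ : ℝ → ℝ → ℝ}, (Continuous fun z : ℝ × ℝ => Ψ z.1 z.2) →
      AEStronglyMeasurable (fun x => Ψ (f x) (h x)) (volume.restrict Ω) := fun hΨ =>
    hΨ.comp_aestronglyMeasurable (hf.aesm.prodMk hh.aesm)
  have hfΩ : ∀ x ∈ Ω, |f x| ≤ C := fun x hx => by simpa [hx] using hfC x
  have hhΩ : ∀ x ∈ Ω, |h x| ≤ C := fun x hx => by simpa [hx] using hhC x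
  have hae : ∀ {Ψ : ℝ → ℝ → ℝ} {B : ℝ}, (∀ x y, |x| ≤ C → |y| ≤ C → |Ψ x y| ≤ B) →
      ∀ᵐ x ∂volume.restrict Ω, ‖Ψ (f x) (h x)‖ ≤ B := fun hΨ =>
    (ae_restrict_iff' hΩm).2 (Eventually.of_forall fun x hx => hΨ _ _ (hfΩ x hx) (hhΩ x hx))
  refine ⟨hm hΦc, ⟨B, fun x hx => hB _ _ (hfΩ x hx) (hhΩ x hx)⟩, fun j => ?_, fun j φ hφ => ?_⟩
  · exact ((hf.int j).bdd_mul (hm hΦ₁) (hae hB₁)).add ((hh.int j).bdd_mul (hm hΦ₂) (hae hB₂))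
  set e : EuclideanSpace ℝ (Fin N) := EuclideanSpace.single j 1
  obtain ⟨Bφ, hBφ⟩ := hφ.bounded
  have hgi : Integrable (Ω.indicator (g j)) := (hf.int j).integrable_indicator hΩm
  have hki : Integrable (Ω.indicator (k j)) := (hh.int j).integrable_indicator hΩm
  have lim : ∀ {Ψ : ℝ → ℝ → ℝ}, (Continuous fun z : ℝ × ℝ => Ψ z.1 z.2) →
      ∀ᵐ x, Tendsto (fun n => Ψ (mollify n (Ω.indicator f) x) (mollify n (Ω.indicator h) x)) atTop
        (𝓝 (Ψ (Ω.indicator f x) (Ω.indicator h x))) := fun hΨ => by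
    filter_upwards [ae_tendsto_mollify hfi, ae_tendsto_mollify hhi] with x h1 h2
    exact (hΨ.tendsto (_, _)).comp (h1.prodMk_nhds h2)
  have hcont : ∀ {Ψ : ℝ → ℝ → ℝ}, (Continuous fun z : ℝ × ℝ => Ψ z.1 z.2) → ∀ n, Continuous
      fun x => Ψ (mollify n (Ω.indicator f) x) (mollify n (Ω.indicator h) x) := fun hΨ n =>
    hΨ.comp ((contDiff_mollify hfi n).continuous.prodMk (contDiff_mollify hhi n).continuous)
  have L1 := tendsto_integral_mul_of_bounded_of_L1 (μ := volume) (C := B)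
    (fun n => (hcont hΦc n).aestronglyMeasurable)
    (fun n => Eventually.of_forall fun x => hB _ _ (abs_mollify_le hfC n x)
      (abs_mollify_le hhC n x)) (lim hΦc)
    (Gn := fun _ x => fderiv ℝ φ x e) (fun _ => hφ.integrable_fderiv e) (hφ.integrable_fderiv e)
    (by simp)
  have R : ∀ {Ψ : ℝ → ℝ → ℝ} {B : ℝ} {q : EuclideanSpace ℝ (Fin N) → ℝ},
      (Continuous fun z : ℝ × ℝ => Ψ z.1 z.2) → (∀ x y, |x| ≤ C → |y| ≤ C → |Ψ x y| ≤ B) →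
      Integrable q → Tendsto (fun n => ∫ x, (Ψ (mollify n (Ω.indicator f) x)
        (mollify n (Ω.indicator h) x) * φ x) * mollify n q x) atTop
        (𝓝 (∫ x, (Ψ (Ω.indicator f x) (Ω.indicator h x) * φ x) * q x)) := by
    intro Ψ B q hΨ hΨB hq
    refine tendsto_integral_mul_of_bounded_of_L1 (C := B * Bφ)
      (fun n => ((hcont hΨ n).mul hφ.smooth.continuous).aestronglyMeasurable)
      (fun n => Eventually.of_forall fun x => ?_) ?_ (integrable_mollify hq) hq
      (tendsto_integral_abs_mollify_sub hq)
    · rw [abs_mul]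
      have := hΨB _ _ (abs_mollify_le hfC n x) (abs_mollify_le hhC n x)
      exact mul_le_mul this (hBφ x) (abs_nonneg _) ((abs_nonneg _).trans this)
    · filter_upwards [lim hΨ] with x hx using hx.mul_const _
  have L2 := ((R hΦ₁ hB₁ hgi).add (R hΦ₂ hB₂ hki)).neg
  -- Once the mollification radius is smaller than the distance of the support of `φ` to the boundary,
  -- classical integration by parts applies, with the mollified weak derivatives.
  have key : ∀ᶠ n in atTop,
      (-(∫ x, (Φ₁ (mollify n (Ω.indicator f) x) (mollify n (Ω.indicator h) x) * φ x) *
          mollify n (Ω.indicator (g j)) x) +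
        -∫ x, (Φ₂ (mollify n (Ω.indicator f) x) (mollify n (Ω.indicator h) x) * φ x) *
          mollify n (Ω.indicator (k j)) x)
      = ∫ x, Φ (mollify n (Ω.indicator f) x) (mollify n (Ω.indicator h) x) * fderiv ℝ φ x e := by
    filter_upwards [hφ.exists_closedBall_subset hΩ] with n hn
    have sf := contDiff_mollify hfi n
    have sh := contDiff_mollify hhi n
    have hder : ∀ x, HasFDerivAt
        (fun x => Φ (mollify n (Ω.indicator f) x) (mollify n (Ω.indicator h) x))
        ((Φ₁ (mollify n (Ω.indicator f) x) (mollify n (Ω.indicator h) x) •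
          ContinuousLinearMap.fst ℝ ℝ ℝ +
          Φ₂ (mollify n (Ω.indicator f) x) (mollify n (Ω.indicator h) x) •
          ContinuousLinearMap.snd ℝ ℝ ℝ).comp
          ((fderiv ℝ (mollify n (Ω.indicator f)) x).prod
            (fderiv ℝ (mollify n (Ω.indicator h)) x))) x := fun x =>
      HasFDerivAt.comp (g := fun z : ℝ × ℝ => Φ z.1 z.2)
        (f := fun x => (mollify n (Ω.indicator f) x, mollify n (Ω.indicator h) x)) x
        (hΦ (mollify n (Ω.indicator f) x) (mollify n (Ω.indicator h) x))
        (((sf.differentiable (by simp)) x).hasFDerivAt.prodMk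
          ((sh.differentiable (by simp)) x).hasFDerivAt)
    have hder' : ∀ x, fderiv ℝ
        (fun x => Φ (mollify n (Ω.indicator f) x) (mollify n (Ω.indicator h) x)) x e * φ x
        = (Φ₁ (mollify n (Ω.indicator f) x) (mollify n (Ω.indicator h) x) * φ x) *
          mollify n (Ω.indicator (g j)) x
        + (Φ₂ (mollify n (Ω.indicator f) x) (mollify n (Ω.indicator h) x) * φ x) *
          mollify n (Ω.indicator (k j)) x := fun x => by
      by_cases hx : x ∈ tsupport φ
      · have e1 := fderiv_mollify_indicator hΩm (hf.integrableOn hfin hΩm) (hf.weak j) (hn x hx)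
        have e2 := fderiv_mollify_indicator hΩm (hh.integrableOn hfin hΩm) (hh.weak j) (hn x hx)
        rw [(hder x).fderiv, ← e1, ← e2]
        simp
        ring
      · simp [image_eq_zero_of_notMem_tsupport hx]
    have int' : ∀ {Ψ : ℝ → ℝ → ℝ} {q : EuclideanSpace ℝ (Fin N) → ℝ},
        (Continuous fun z : ℝ × ℝ => Ψ z.1 z.2) → Integrable q → Integrable fun x =>
          (Ψ (mollify n (Ω.indicator f) x) (mollify n (Ω.indicator h) x) * φ x) *
          mollify n q x := fun hΨ hq =>
      (((hcont hΨ n).mul hφ.smooth.continuous).mul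
        (contDiff_mollify hq n).continuous).integrable_of_hasCompactSupport
        (HasCompactSupport.mul_right (HasCompactSupport.mul_left hφ.compact))
    rw [integral_mul_fderiv_eq_neg_fderiv_mul_of_integrable, ← neg_add,
      ← integral_add (int' hΦ₁ hgi) (int' hΦ₂ hki)]
    · simp only [hder']
    · simp only [hder']
      exact (int' hΦ₁ hgi).add (int' hΦ₂ hki)
    · exact ((hcont hΦc n).mul ((hφ.smooth.continuous_fderiv (by simp)).clm_apply
        continuous_const)).integrable_of_hasCompactSupport
        (HasCompactSupport.mul_left (hφ.compact.fderiv_apply ℝ e))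
    · exact ((hcont hΦc n).mul hφ.smooth.continuous).integrable_of_hasCompactSupport
        (HasCompactSupport.mul_left hφ.compact)
    · exact fun x _ => (hder x).differentiableAt
    · exact fun x _ => hφ.smooth.differentiable (by simp) x
  have fin := tendsto_nhds_unique (L1.congr' (key.mono fun n hn => hn.symm))
    (L2.congr fun n => by ring)
  have i1 : Integrable fun x => (Φ₁ (Ω.indicator f x) (Ω.indicator h x) * φ x) *
      Ω.indicator (g j) x := by
    have : IntegrableOn (fun x => Φ₁ (f x) (h x) * g j x * φ x) Ω :=
      ((hf.int j).bdd_mul (hm hΦ₁) (hae hB₁)).mul_bdd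
      (c := Bφ) hφ.smooth.continuous.aestronglyMeasurable (Eventually.of_forall hBφ)
    refine (this.integrable_indicator hΩm).congr (Eventually.of_forall fun x => ?_)
    by_cases hx : x ∈ Ω
    · simp only [Set.indicator_of_mem hx]; ring
    · simp [hx]
  have i2 : Integrable fun x => (Φ₂ (Ω.indicator f x) (Ω.indicator h x) * φ x) *
      Ω.indicator (k j) x := by
    have : IntegrableOn (fun x => Φ₂ (f x) (h x) * k j x * φ x) Ω :=
      ((hh.int j).bdd_mul (hm hΦ₂) (hae hB₂)).mul_bdd
      (c := Bφ) hφ.smooth.continuous.aestronglyMeasurable (Eventually.of_forall hBφ)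
    refine (this.integrable_indicator hΩm).congr (Eventually.of_forall fun x => ?_)
    by_cases hx : x ∈ Ω
    · simp only [Set.indicator_of_mem hx]; ring
    · simp [hx]
  rw [← integral_add i1 i2] at fin
  rw [← integral_indicator hΩm, ← integral_indicator hΩm]
  convert fin using 1
  · congr 1; ext x
    by_cases hx : x ∈ Ω
    · simp [hx, e]
    · simp [hx, hφ.fderiv_eq_zero hx]
  · congr 2; ext x
    by_cases hx : x ∈ Ω
    · simp only [Set.indicator_of_mem hx]; ring
    · simp [hx]

lemma WeakDiff.mul (hΩ : IsOpen Ω) (hfin : volume Ω ≠ ⊤) (hf : WeakDiff Ω f g)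
    (hh : WeakDiff Ω h k) :
    WeakDiff Ω (fun x => f x * h x) (fun j x => h x * g j x + f x * k j x) :=
  hf.comp₂ hΩ hfin hh (Φ := fun x y => x * y) (Φ₁ := fun _ y => y) (Φ₂ := fun x _ => x)
    (fun x y => by
      have := (hasFDerivAt_fst (𝕜 := ℝ) (p := (x, y))).mul (hasFDerivAt_snd (𝕜 := ℝ) (p := (x, y)))
      exact this.congr_fderiv (add_comm _ _))
    continuous_snd continuous_fst

lemma WeakDiff.add (hΩ : IsOpen Ω) (hfin : volume Ω ≠ ⊤) (hf : WeakDiff Ω f g)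
    (hh : WeakDiff Ω h k) :
    WeakDiff Ω (fun x => f x + h x) (fun j x => g j x + k j x) := by
  have := hf.comp₂ hΩ hfin hh (Φ := fun x y => x + y) (Φ₁ := fun _ _ => 1) (Φ₂ := fun _ _ => 1)
    (fun x y => by
      have := (hasFDerivAt_fst (𝕜 := ℝ) (p := (x, y))).add (hasFDerivAt_snd (𝕜 := ℝ) (p := (x, y)))
      exact this.congr_fderiv (by simp))
    continuous_const continuous_const
  simpa using this

lemma WeakDiff.zero : WeakDiff Ω (fun _ => 0) (fun _ _ => 0) where
  aesm := aestronglyMeasurable_const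
  bdd := ⟨0, by simp⟩
  int _ := integrableOn_zero
  weak _ _ _ := by simp

lemma WeakDiff.sum (hΩ : IsOpen Ω) (hfin : volume Ω ≠ ⊤) {ι : Type*} (s : Finset ι)
    {f : ι → EuclideanSpace ℝ (Fin N) → ℝ} {g : ι → Fin N → EuclideanSpace ℝ (Fin N) → ℝ}
    (hf : ∀ i ∈ s, WeakDiff Ω (f i) (g i)) :
    WeakDiff Ω (fun x => ∑ i ∈ s, f i x) (fun j x => ∑ i ∈ s, g i j x) := by
  classical
  induction s using Finset.induction_on with
  | empty => simpa using WeakDiff.zero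
  | insert a s ha ih =>
    simp only [Finset.sum_insert ha]
    exact (hf a (Finset.mem_insert_self a s)).add hΩ hfin
      (ih fun i hi => hf i (Finset.mem_insert_of_mem hi))

end

/-! ### The Gagliardo–Nirenberg inequality for weakly differentiable functions -/

section

variable {N : ℕ} {Ω B : Set (EuclideanSpace ℝ (Fin N))} {w : EuclideanSpace ℝ (Fin N) → ℝ}
  {g : Fin N → EuclideanSpace ℝ (Fin N) → ℝ}

lemma enorm_clm_le_sum (ℓ : EuclideanSpace ℝ (Fin N) →L[ℝ] ℝ) :
    ‖ℓ‖ₑ ≤ ∑ j, ‖ℓ (EuclideanSpace.single j 1)‖ₑ := by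
  have h : ‖ℓ‖ ≤ ∑ j, ‖ℓ (EuclideanSpace.single j 1)‖ := by
    refine ℓ.opNorm_le_bound (Finset.sum_nonneg fun _ _ => norm_nonneg _) fun x => ?_
    have hx : x = ∑ j, x j • EuclideanSpace.single j (1 : ℝ) := by
      ext i
      simp [Pi.single_apply]
    calc ‖ℓ x‖ = ‖∑ j, x j • ℓ (EuclideanSpace.single j 1)‖ := by
          conv_lhs => rw [hx]
          simp only [map_sum, map_smul]
      _ ≤ ∑ j, ‖x j • ℓ (EuclideanSpace.single j 1)‖ := norm_sum_le _ _
      _ ≤ ∑ j, ‖ℓ (EuclideanSpace.single j 1)‖ * ‖x‖ := by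
          refine Finset.sum_le_sum fun j _ => ?_
          rw [norm_smul, mul_comm]
          exact mul_le_mul_of_nonneg_left (PiLp.norm_apply_le x j) (norm_nonneg _)
      _ = _ := by rw [Finset.sum_mul]
  calc ‖ℓ‖ₑ = ENNReal.ofReal ‖ℓ‖ := (ofReal_norm ℓ).symm
    _ ≤ ENNReal.ofReal (∑ j, ‖ℓ (EuclideanSpace.single j 1)‖) := ENNReal.ofReal_le_ofReal h
    _ = _ := by
        rw [ENNReal.ofReal_sum_of_nonneg fun _ _ => norm_nonneg _]
        simp only [ofReal_norm]

lemma tendsto_lintegral_enorm_mollify {f : EuclideanSpace ℝ (Fin N) → ℝ} (hf : Integrable f) :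
    Tendsto (fun n => ∫⁻ x, ‖mollify n f x‖ₑ) atTop (𝓝 (∫⁻ x, ‖f x‖ₑ)) := by
  have h1 : Tendsto (fun n => ∫ x, ‖mollify n f x‖) atTop (𝓝 (∫ x, ‖f x‖)) := by
    rw [tendsto_iff_norm_sub_tendsto_zero]
    refine squeeze_zero (fun _ => norm_nonneg _) (fun n => ?_) (tendsto_integral_abs_mollify_sub hf)
    have i1 : Integrable fun x => |mollify n f x - f x| := ((integrable_mollify hf n).sub hf).abs
    rw [← integral_sub (integrable_mollify hf n).norm hf.norm]
    exact norm_integral_le_of_norm_le i1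
      (Eventually.of_forall fun x => abs_norm_sub_norm_le (mollify n f x) (f x))
  have h2 := ENNReal.tendsto_ofReal h1
  simpa only [ofReal_integral_norm_eq_lintegral_enorm hf,
    ofReal_integral_norm_eq_lintegral_enorm (integrable_mollify hf _)] using h2

/-- For a function vanishing outside `Ω`, where `closure Ω ⊆ B`, the partial derivatives of the
fine mollifications are everywhere the mollified weak derivatives. -/
lemma eventually_fderiv_mollify (hB : IsOpen B) (hBfin : volume B ≠ ⊤)
    (hcl : IsCompact (closure Ω)) (hΩB : closure Ω ⊆ B) (hw : WeakDiff B w g)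
    (hw0 : ∀ x ∉ Ω, w x = 0) (hg0 : ∀ j, ∀ x ∉ Ω, g j x = 0) :
    ∀ᶠ n in atTop, ∀ j x, fderiv ℝ (mollify n (B.indicator w)) x (EuclideanSpace.single j 1)
      = mollify n (B.indicator (g j)) x := by
  obtain ⟨δ, hδ, hsub⟩ := hcl.exists_cthickening_subset_open hB hΩB
  filter_upwards [(tendsto_rOut_bump N).eventually_lt_const (half_pos hδ)] with n hn j x
  have hzero : ∀ {v : EuclideanSpace ℝ (Fin N) → ℝ}, (∀ y ∉ Ω, v y = 0) →
      ∀ y ∉ Metric.cthickening (δ / 2) (closure Ω), mollify n (B.indicator v) y = 0 := by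
    intro v hv y hy
    refine mollify_eq_zero fun z hz => ?_
    have : z ∉ Ω := fun hzΩ => hy (Metric.mem_cthickening_of_dist_le y z _ _ (subset_closure hzΩ)
      (by rw [dist_comm]; exact (Metric.mem_closedBall.1 hz).trans hn.le))
    exact Set.indicator_apply_eq_zero.2 fun _ => hv z this
  by_cases hx : x ∈ Metric.cthickening (δ / 2) (closure Ω)
  · refine fderiv_mollify_indicator hB.measurableSet (hw.integrableOn hBfin hB.measurableSet)
      (hw.weak j) (fun y hy => hsub ?_)
    have h1 : y ∈ Metric.cthickening (δ / 2) (Metric.cthickening (δ / 2) (closure Ω)) :=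
      Metric.mem_cthickening_of_dist_le y x _ _ hx ((Metric.mem_closedBall.1 hy).trans hn.le)
    have h2 := Metric.cthickening_cthickening_subset (half_pos hδ).le (half_pos hδ).le
      (closure Ω) h1
    rwa [add_halves] at h2
  · rw [hzero (hg0 j) x hx]
    have : mollify n (B.indicator w) =ᶠ[𝓝 x] fun _ => 0 := by
      filter_upwards [Metric.isClosed_cthickening.isOpen_compl.mem_nhds hx] with y hy
      exact hzero hw0 y hy
    rw [this.fderiv_eq]
    simp

/-- Gagliardo–Nirenberg inequality `‖w‖_{N/(N-1)} ≤ C ‖∇w‖₁` for weakly differentiable functions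
vanishing outside a bounded set. -/
lemma exists_lintegral_rpow_le {p : ℝ} (hp : Real.HolderConjugate N p) :
    ∃ C : ℝ≥0, ∀ {Ω B : Set (EuclideanSpace ℝ (Fin N))} {w : EuclideanSpace ℝ (Fin N) → ℝ}
      {g : Fin N → EuclideanSpace ℝ (Fin N) → ℝ}, IsOpen B → volume B ≠ ⊤ →
      IsCompact (closure Ω) → closure Ω ⊆ B → WeakDiff B w g →
      (∀ x ∉ Ω, w x = 0) → (∀ j, ∀ x ∉ Ω, g j x = 0) →
      ∫⁻ x, ‖w x‖ₑ ^ p ≤ C * (∑ j, ∫⁻ x, ‖g j x‖ₑ) ^ p := by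
  have hp' : Real.HolderConjugate (Module.finrank ℝ (EuclideanSpace ℝ (Fin N))) p := by
    simpa using hp
  refine ⟨lintegralPowLePowLIntegralFDerivConst
    (volume : Measure (EuclideanSpace ℝ (Fin N))) p, ?_⟩
  intro Ω B w g hB hBfin hcl hΩB hw hw0 hg0
  have hBm := hB.measurableSet
  have hwB : B.indicator w = w := Set.indicator_eq_self.2 fun x hx =>
    hΩB (subset_closure (by_contra fun h => hx (hw0 x h)))
  have hgB : ∀ j, B.indicator (g j) = g j := fun j => Set.indicator_eq_self.2 fun x hx =>
    hΩB (subset_closure (by_contra fun h => hx (hg0 j x h)))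
  have hwi : Integrable w := by
    rw [← hwB]; exact (hw.integrableOn hBfin hBm).integrable_indicator hBm
  have hgi : ∀ j, Integrable (g j) := fun j => by
    rw [← hgB]; exact (hw.int j).integrable_indicator hBm
  have hws : HasCompactSupport w :=
    HasCompactSupport.intro hcl fun x hx => hw0 x fun h => hx (subset_closure h)
  have step : ∀ᶠ n in atTop, ∫⁻ x, ‖mollify n w x‖ₑ ^ p
      ≤ lintegralPowLePowLIntegralFDerivConst (volume : Measure (EuclideanSpace ℝ (Fin N))) p *
        (∑ j, ∫⁻ x, ‖mollify n (g j) x‖ₑ) ^ p := by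
    filter_upwards [eventually_fderiv_mollify hB hBfin hcl hΩB hw hw0 hg0] with n hn
    rw [hwB] at hn
    refine (lintegral_pow_le_pow_lintegral_fderiv volume
      ((contDiff_mollify hwi n).of_le (by norm_cast))
      ((bump N n).hasCompactSupport_normed.convolution _ hws) hp').trans ?_
    gcongr
    · exact hp.symm.nonneg
    rw [← lintegral_finsetSum' _ fun j _ =>
      (integrable_mollify (hgi j) n).aestronglyMeasurable.enorm]
    refine lintegral_mono fun x => (enorm_clm_le_sum _).trans_eq ?_
    refine Finset.sum_congr rfl fun j _ => ?_
    have := hn j x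
    rw [hgB] at this
    exact congrArg _ this
  have lim : Tendsto (fun n => (lintegralPowLePowLIntegralFDerivConst
      (volume : Measure (EuclideanSpace ℝ (Fin N))) p : ℝ≥0∞) *
      (∑ j, ∫⁻ x, ‖mollify n (g j) x‖ₑ) ^ p) atTop (𝓝 (lintegralPowLePowLIntegralFDerivConst
      (volume : Measure (EuclideanSpace ℝ (Fin N))) p * (∑ j, ∫⁻ x, ‖g j x‖ₑ) ^ p)) := by
    refine ENNReal.Tendsto.const_mul ?_ (Or.inr ENNReal.coe_ne_top)
    exact (ENNReal.continuous_rpow_const.tendsto _).comp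
      (tendsto_finsetSum _ fun j _ => tendsto_lintegral_enorm_mollify (hgi j))
  calc ∫⁻ x, ‖w x‖ₑ ^ p = ∫⁻ x, liminf (fun n => ‖mollify n w x‖ₑ ^ p) atTop := by
        refine lintegral_congr_ae ?_
        filter_upwards [ae_tendsto_mollify hwi] with x hx
        exact (((ENNReal.continuous_rpow_const.tendsto _).comp hx.enorm).liminf_eq).symm
    _ ≤ liminf (fun n => ∫⁻ x, ‖mollify n w x‖ₑ ^ p) atTop :=
        lintegral_liminf_le fun n =>
          ((contDiff_mollify hwi n).continuous.measurable.enorm).pow_const _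
    _ ≤ liminf (fun n => (lintegralPowLePowLIntegralFDerivConst
      (volume : Measure (EuclideanSpace ℝ (Fin N))) p : ℝ≥0∞) *
      (∑ j, ∫⁻ x, ‖mollify n (g j) x‖ₑ) ^ p) atTop := liminf_le_liminf step
    _ = _ := lim.liminf_eq

end

/-! ### Graph coordinates near the boundary -/

section

variable {N : ℕ} {Ω : Set (EuclideanSpace ℝ (Fin N))} {ν : EuclideanSpace ℝ (Fin N)}

/-- The point at height `t` above the graph of `γ : ν^⊥ → ℝ`, over `y ∈ ν^⊥`. -/
def graphPoint (ν : EuclideanSpace ℝ (Fin N))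
    (γ : ((Submodule.span ℝ {ν})ᗮ : Submodule ℝ (EuclideanSpace ℝ (Fin N))) → ℝ)
    (y : ((Submodule.span ℝ {ν})ᗮ : Submodule ℝ (EuclideanSpace ℝ (Fin N)))) (t : ℝ) :
    EuclideanSpace ℝ (Fin N) :=
  (y : EuclideanSpace ℝ (Fin N)) + (γ y + t) • ν

lemma proj_add_smul (y : ((Submodule.span ℝ {ν})ᗮ : Submodule ℝ (EuclideanSpace ℝ (Fin N))))
    (c : ℝ) : ((Submodule.span ℝ {ν})ᗮ).orthogonalProjectionOnto
      ((y : EuclideanSpace ℝ (Fin N)) + c • ν) = y := by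
  rw [map_add, Submodule.orthogonalProjectionOnto_mem_subspace_eq_self,
    Submodule.orthogonalProjectionOnto_orthogonal_apply_eq_zero
      (Submodule.smul_mem _ _ (Submodule.mem_span_singleton_self ν)), add_zero]

lemma inner_add_smul (hν : ‖ν‖ = 1)
    (y : ((Submodule.span ℝ {ν})ᗮ : Submodule ℝ (EuclideanSpace ℝ (Fin N)))) (c : ℝ) :
    ⟪ν, (y : EuclideanSpace ℝ (Fin N)) + c • ν⟫_ℝ = c := by
  rw [inner_add_right, Submodule.mem_orthogonal_singleton_iff_inner_right.1 y.2, inner_smul_right,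
    real_inner_self_eq_norm_sq, hν]
  ring

lemma proj_add_inner_smul (hν : ‖ν‖ = 1) (x : EuclideanSpace ℝ (Fin N)) :
    ((((Submodule.span ℝ {ν})ᗮ).orthogonalProjectionOnto x :
      ((Submodule.span ℝ {ν})ᗮ : Submodule ℝ (EuclideanSpace ℝ (Fin N)))) :
      EuclideanSpace ℝ (Fin N)) + ⟪ν, x⟫_ℝ • ν = x := by
  have h := Submodule.starProjection_add_starProjection_orthogonal (K := Submodule.span ℝ {ν}) x
  rw [Submodule.starProjection_unit_singleton ℝ hν] at h
  rw [add_comm]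
  exact h

/-- Fubini's theorem in the orthogonal decomposition `ν^⊥ × ℝ`. -/
lemma lintegral_eq_lintegral_add_smul (hν : ‖ν‖ = 1) {F : EuclideanSpace ℝ (Fin N) → ℝ≥0∞}
    (hF : Measurable F) :
    ∫⁻ x, F x = ∫⁻ y : ((Submodule.span ℝ {ν})ᗮ : Submodule ℝ (EuclideanSpace ℝ (Fin N))),
      ∫⁻ c : ℝ, F ((y : EuclideanSpace ℝ (Fin N)) + c • ν) := by
  have h1 := ((Submodule.span ℝ {ν}).measurePreserving_measurableEquivProd
    (0 : EuclideanSpace ℝ (Fin N)))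
  rw [InnerProductSpace.euclideanHausdorffMeasure_eq_volume] at h1
  have h2 := (LinearIsometryEquiv.toSpanUnitSingleton (𝕜 := ℝ) ν hν).measurePreserving
  have hG : Measurable fun z : (Submodule.span ℝ {ν}) ×
      ((Submodule.span ℝ {ν})ᗮ : Submodule ℝ (EuclideanSpace ℝ (Fin N))) =>
      F ((z.1 : EuclideanSpace ℝ (Fin N)) + (z.2 : EuclideanSpace ℝ (Fin N))) := by
    exact hF.comp (by fun_prop)
  calc ∫⁻ x, F x = ∫⁻ z, F ((z.1 : EuclideanSpace ℝ (Fin N)) + (z.2 : EuclideanSpace ℝ (Fin N)))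
        ∂(volume : Measure ((Submodule.span ℝ {ν}) ×
          ((Submodule.span ℝ {ν})ᗮ : Submodule ℝ (EuclideanSpace ℝ (Fin N))))) := by
        rw [← (h1.symm _).lintegral_comp hF]
        simp
    _ = ∫⁻ y : ((Submodule.span ℝ {ν})ᗮ : Submodule ℝ (EuclideanSpace ℝ (Fin N))),
        ∫⁻ a : Submodule.span ℝ {ν},
          F ((a : EuclideanSpace ℝ (Fin N)) + (y : EuclideanSpace ℝ (Fin N))) := by
        rw [Measure.volume_eq_prod, lintegral_prod_symm _ hG.aemeasurable]
    _ = _ := by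
        refine lintegral_congr fun y => ?_
        have hGy : Measurable fun a : Submodule.span ℝ {ν} =>
            F ((a : EuclideanSpace ℝ (Fin N)) + (y : EuclideanSpace ℝ (Fin N))) := by
          exact hF.comp (by fun_prop)
        rw [← h2.lintegral_comp hGy]
        simp [add_comm]

lemma continuous_graphPoint
    {γ : ((Submodule.span ℝ {ν})ᗮ : Submodule ℝ (EuclideanSpace ℝ (Fin N))) → ℝ}
    (hγ : Continuous γ) : Continuous fun z :
      ((Submodule.span ℝ {ν})ᗮ : Submodule ℝ (EuclideanSpace ℝ (Fin N))) × ℝ =>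
      graphPoint ν γ z.1 z.2 := by
  unfold graphPoint
  fun_prop

lemma lintegral_graphPoint (hν : ‖ν‖ = 1)
    {γ : ((Submodule.span ℝ {ν})ᗮ : Submodule ℝ (EuclideanSpace ℝ (Fin N))) → ℝ}
    {F : EuclideanSpace ℝ (Fin N) → ℝ≥0∞} (hF : Measurable F) :
    ∫⁻ y, ∫⁻ t : ℝ, F (graphPoint ν γ y t) = ∫⁻ x, F x := by
  rw [lintegral_eq_lintegral_add_smul hν hF]
  refine lintegral_congr fun y => ?_
  exact lintegral_add_left_eq_self (μ := volume)
    (fun c : ℝ => F ((y : EuclideanSpace ℝ (Fin N)) + c • ν)) (γ y)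

lemma hasDerivAt_graphPoint
    (γ : ((Submodule.span ℝ {ν})ᗮ : Submodule ℝ (EuclideanSpace ℝ (Fin N))) → ℝ)
    (y : ((Submodule.span ℝ {ν})ᗮ : Submodule ℝ (EuclideanSpace ℝ (Fin N)))) (t : ℝ) :
    HasDerivAt (graphPoint ν γ y) ν t := by
  have h := (((hasDerivAt_id t).const_add (γ y)).smul_const ν).const_add
    (y : EuclideanSpace ℝ (Fin N))
  rwa [one_smul] at h

/-- Mean value bound along a vertical segment above the graph: the value at height `τ` is at most
the mean value over heights in `[τ, H]` plus the integral of the derivative. -/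
lemma mul_enorm_graphPoint_le (hν : ‖ν‖ = 1) {φ : EuclideanSpace ℝ (Fin N) → ℝ}
    (hφ : ContDiff ℝ ∞ φ)
    (γ : ((Submodule.span ℝ {ν})ᗮ : Submodule ℝ (EuclideanSpace ℝ (Fin N))) → ℝ)
    (y : ((Submodule.span ℝ {ν})ᗮ : Submodule ℝ (EuclideanSpace ℝ (Fin N)))) {τ H : ℝ} :
    ENNReal.ofReal (H - τ) * ‖φ (graphPoint ν γ y τ)‖ₑ
      ≤ (∫⁻ t in Set.Icc τ H, ‖φ (graphPoint ν γ y t)‖ₑ)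
        + ENNReal.ofReal (H - τ) * ∫⁻ t in Set.Icc τ H, ‖fderiv ℝ φ (graphPoint ν γ y t)‖ₑ := by
  have hder : ∀ t, HasDerivAt (fun t => φ (graphPoint ν γ y t))
      (fderiv ℝ φ (graphPoint ν γ y t) ν) t := fun t =>
    ((hφ.differentiable (by simp)) _).hasFDerivAt.comp_hasDerivAt t (hasDerivAt_graphPoint γ y t)
  have hgc : Continuous (graphPoint ν γ y) :=
    continuous_iff_continuousAt.2 fun t => (hasDerivAt_graphPoint γ y t).continuousAt
  have hcont : Continuous fun t => fderiv ℝ φ (graphPoint ν γ y t) ν :=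
    ((hφ.continuous_fderiv (by simp)).comp hgc).clm_apply continuous_const
  set D := ∫⁻ t in Set.Icc τ H, ‖fderiv ℝ φ (graphPoint ν γ y t)‖ₑ
  have key : ∀ t ∈ Set.Icc τ H, ‖φ (graphPoint ν γ y τ)‖ₑ ≤ ‖φ (graphPoint ν γ y t)‖ₑ + D := by
    intro t ht
    have ftc : ∫ s in τ..t, fderiv ℝ φ (graphPoint ν γ y s) ν
        = φ (graphPoint ν γ y t) - φ (graphPoint ν γ y τ) :=
      intervalIntegral.integral_eq_sub_of_hasDerivAt (fun s _ => hder s)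
        (hcont.intervalIntegrable _ _)
    have h1 : φ (graphPoint ν γ y τ) = φ (graphPoint ν γ y t)
        - ∫ s in τ..t, fderiv ℝ φ (graphPoint ν γ y s) ν := by rw [ftc]; ring
    rw [h1]
    refine enorm_sub_le.trans (add_le_add_right ?_ _)
    rw [intervalIntegral.integral_of_le ht.1]
    refine (enorm_integral_le_lintegral_enorm _).trans ?_
    refine (lintegral_mono_set
      (Set.Ioc_subset_Icc_self.trans (Set.Icc_subset_Icc_right ht.2))).trans ?_
    refine lintegral_mono fun s => ?_
    calc ‖fderiv ℝ φ (graphPoint ν γ y s) ν‖ₑ ≤ ‖fderiv ℝ φ (graphPoint ν γ y s)‖ₑ * ‖ν‖ₑ :=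
          ContinuousLinearMap.le_opENorm _ _
      _ = _ := by rw [← ofReal_norm ν, hν]; simp
  have hmeas : Measurable fun t => ‖φ (graphPoint ν γ y t)‖ₑ :=
    (hφ.continuous.comp hgc).measurable.enorm
  calc ENNReal.ofReal (H - τ) * ‖φ (graphPoint ν γ y τ)‖ₑ
      = ∫⁻ _ in Set.Icc τ H, ‖φ (graphPoint ν γ y τ)‖ₑ := by
        rw [lintegral_const, Measure.restrict_apply MeasurableSet.univ, Set.univ_inter,
          Real.volume_Icc, mul_comm]
    _ ≤ ∫⁻ t in Set.Icc τ H, (‖φ (graphPoint ν γ y t)‖ₑ + D) :=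
        setLIntegral_mono (hmeas.add measurable_const) key
    _ = _ := by
        rw [lintegral_add_left hmeas, lintegral_const, Measure.restrict_apply MeasurableSet.univ,
          Set.univ_inter, Real.volume_Icc, mul_comm D]

end

/-! ### The trace inequality -/

section

variable {N : ℕ} {Ω : Set (EuclideanSpace ℝ (Fin N))} {ν : EuclideanSpace ℝ (Fin N)}
  {f : EuclideanSpace ℝ (Fin N) → ℝ} {g : Fin N → EuclideanSpace ℝ (Fin N) → ℝ}

lemma lintegral_enorm_indicator (hΩ : MeasurableSet Ω) (f : EuclideanSpace ℝ (Fin N) → ℝ) :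
    ∫⁻ x, ‖Ω.indicator f x‖ₑ = ∫⁻ x in Ω, ‖f x‖ₑ := by
  rw [← lintegral_indicator hΩ]
  refine lintegral_congr fun x => ?_
  by_cases hx : x ∈ Ω <;> simp [hx]

/-- Trace estimate for mollifications on a surface parallel to the boundary. -/
lemma eventually_lintegral_mollify_graphPoint_le (hΩ : IsOpen Ω) (hfin : volume Ω ≠ ⊤)
    (hf : WeakDiff Ω f g) (hν : ‖ν‖ = 1)
    {γ : ((Submodule.span ℝ {ν})ᗮ : Submodule ℝ (EuclideanSpace ℝ (Fin N))) → ℝ}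
    (hγ : Continuous γ)
    {D : Set ((Submodule.span ℝ {ν})ᗮ : Submodule ℝ (EuclideanSpace ℝ (Fin N)))}
    (hD : IsCompact D) {τ H : ℝ} (hsub : ∀ y ∈ D, ∀ t ∈ Set.Icc τ H, graphPoint ν γ y t ∈ Ω) :
    ∀ᶠ n in atTop, ENNReal.ofReal (H - τ) *
        ∫⁻ y in D, ‖mollify n (Ω.indicator f) (graphPoint ν γ y τ)‖ₑ
      ≤ (∫⁻ x, ‖mollify n (Ω.indicator f) x‖ₑ)
        + ENNReal.ofReal (H - τ) * ∑ j, ∫⁻ x, ‖mollify n (Ω.indicator (g j)) x‖ₑ := by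
  have hΩm := hΩ.measurableSet
  have hfi : Integrable (Ω.indicator f) := (hf.integrableOn hfin hΩm).integrable_indicator hΩm
  have hgi : ∀ j, Integrable (Ω.indicator (g j)) := fun j =>
    (hf.int j).integrable_indicator hΩm
  have hGc := continuous_graphPoint (ν := ν) hγ
  have hK : IsCompact ((fun z : ((Submodule.span ℝ {ν})ᗮ :
      Submodule ℝ (EuclideanSpace ℝ (Fin N))) × ℝ => graphPoint ν γ z.1 z.2) ''
      (D ×ˢ Set.Icc τ H)) := (hD.prod isCompact_Icc).image hGc
  have hKΩ : ((fun z : ((Submodule.span ℝ {ν})ᗮ :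
      Submodule ℝ (EuclideanSpace ℝ (Fin N))) × ℝ => graphPoint ν γ z.1 z.2) ''
      (D ×ˢ Set.Icc τ H)) ⊆ Ω := by
    rintro _ ⟨z, hz, rfl⟩
    exact hsub _ hz.1 _ hz.2
  obtain ⟨δ, hδ, hδsub⟩ := hK.exists_cthickening_subset_open hΩ hKΩ
  filter_upwards [(tendsto_rOut_bump N).eventually_lt_const hδ] with n hn
  have hs := contDiff_mollify hfi n
  set G : EuclideanSpace ℝ (Fin N) → ℝ≥0∞ := fun x => ∑ j, ‖mollify n (Ω.indicator (g j)) x‖ₑ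
  have hGm : Measurable G := Finset.measurable_fun_sum _ fun j _ =>
    (contDiff_mollify (hgi j) n).continuous.measurable.enorm
  have hle : ∀ y ∈ D, ∀ t ∈ Set.Icc τ H,
      ‖fderiv ℝ (mollify n (Ω.indicator f)) (graphPoint ν γ y t)‖ₑ ≤ G (graphPoint ν γ y t) := by
    intro y hy t ht
    refine (enorm_clm_le_sum _).trans_eq (Finset.sum_congr rfl fun j _ => ?_)
    rw [fderiv_mollify_indicator hΩm (hf.integrableOn hfin hΩm) (hf.weak j)]
    intro x hx
    exact hδsub (Metric.mem_cthickening_of_dist_le x (graphPoint ν γ y t) δ _ ⟨(y, t), ⟨hy, ht⟩, rfl⟩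
      ((Metric.mem_closedBall.1 hx).trans hn.le))
  have hFm : Measurable fun x => ‖mollify n (Ω.indicator f) x‖ₑ := hs.continuous.measurable.enorm
  have hFm' : Measurable fun y => ‖mollify n (Ω.indicator f) (graphPoint ν γ y τ)‖ₑ :=
    hFm.comp (hGc.comp (Continuous.prodMk_left τ)).measurable
  have hFmm : Measurable fun y => ∫⁻ t : ℝ, ‖mollify n (Ω.indicator f) (graphPoint ν γ y t)‖ₑ :=
    Measurable.lintegral_prod_right' (hFm.comp hGc.measurable)
  have hGmm : Measurable fun y => ∫⁻ t : ℝ, G (graphPoint ν γ y t) :=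
    Measurable.lintegral_prod_right' (hGm.comp hGc.measurable)
  calc ENNReal.ofReal (H - τ) * ∫⁻ y in D, ‖mollify n (Ω.indicator f) (graphPoint ν γ y τ)‖ₑ
      = ∫⁻ y in D, ENNReal.ofReal (H - τ) * ‖mollify n (Ω.indicator f) (graphPoint ν γ y τ)‖ₑ :=
        (lintegral_const_mul _ hFm').symm
    _ ≤ ∫⁻ y in D, ((∫⁻ t : ℝ, ‖mollify n (Ω.indicator f) (graphPoint ν γ y t)‖ₑ)
        + ENNReal.ofReal (H - τ) * ∫⁻ t : ℝ, G (graphPoint ν γ y t)) := by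
        refine setLIntegral_mono (hFmm.add (hGmm.const_mul _)) fun y hy => ?_
        refine (mul_enorm_graphPoint_le hν hs γ y).trans (add_le_add (setLIntegral_le_lintegral _ _) ?_)
        refine mul_le_mul_right ?_ _
        refine le_trans (setLIntegral_mono' measurableSet_Icc fun t ht => hle y hy t ht)
          (setLIntegral_le_lintegral _ _)
    _ ≤ ∫⁻ y, ((∫⁻ t : ℝ, ‖mollify n (Ω.indicator f) (graphPoint ν γ y t)‖ₑ)
        + ENNReal.ofReal (H - τ) * ∫⁻ t : ℝ, G (graphPoint ν γ y t)) :=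
        setLIntegral_le_lintegral _ _
    _ = (∫⁻ x, ‖mollify n (Ω.indicator f) x‖ₑ) + ENNReal.ofReal (H - τ) * ∫⁻ x, G x := by
        rw [lintegral_add_left hFmm, lintegral_const_mul _ hGmm, lintegral_graphPoint hν hFm,
          lintegral_graphPoint hν hGm]
    _ = _ := by
        congr 2
        exact lintegral_finsetSum _ fun j _ =>
          (contDiff_mollify (hgi j) n).continuous.measurable.enorm

/-- Trace estimate on the graph itself: let the mollification parameter, and then the distance of
the parallel surfaces, tend to zero. -/
lemma lintegral_graphPoint_zero_le (hΩ : IsOpen Ω) (hfin : volume Ω ≠ ⊤)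
    (hfc : ContinuousOn f (closure Ω)) (hf : WeakDiff Ω f g) (hν : ‖ν‖ = 1)
    {γ : ((Submodule.span ℝ {ν})ᗮ : Submodule ℝ (EuclideanSpace ℝ (Fin N))) → ℝ}
    (hγ : Continuous γ)
    {D : Set ((Submodule.span ℝ {ν})ᗮ : Submodule ℝ (EuclideanSpace ℝ (Fin N)))}
    (hD : IsCompact D) {H : ℝ} (hH : 0 < H)
    (hsub : ∀ y ∈ D, ∀ t ∈ Set.Ioc 0 H, graphPoint ν γ y t ∈ Ω) :
    ENNReal.ofReal (H / 2) * ∫⁻ y in D, ‖f (graphPoint ν γ y 0)‖ₑ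
      ≤ (∫⁻ x in Ω, ‖f x‖ₑ) + ENNReal.ofReal H * ∑ j, ∫⁻ x in Ω, ‖g j x‖ₑ := by
  have hΩm := hΩ.measurableSet
  have hDm := hD.measurableSet
  have hfi : Integrable (Ω.indicator f) := (hf.integrableOn hfin hΩm).integrable_indicator hΩm
  have hgi : ∀ j, Integrable (Ω.indicator (g j)) := fun j =>
    (hf.int j).integrable_indicator hΩm
  have hGc := continuous_graphPoint (ν := ν) hγ
  set R := (∫⁻ x in Ω, ‖f x‖ₑ) + ENNReal.ofReal H * ∑ j, ∫⁻ x in Ω, ‖g j x‖ₑ with hR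
  have inner : ∀ τ, 0 < τ → τ ≤ H / 2 →
      ENNReal.ofReal (H / 2) * ∫⁻ y in D, ‖f (graphPoint ν γ y τ)‖ₑ ≤ R := by
    intro τ hτ hτH
    have ev := eventually_lintegral_mollify_graphPoint_le hΩ hfin hf hν hγ hD (τ := τ) (H := H)
      fun y hy t ht => hsub y hy t ⟨hτ.trans_le ht.1, ht.2⟩
    have lim : Tendsto (fun n => (∫⁻ x, ‖mollify n (Ω.indicator f) x‖ₑ)
        + ENNReal.ofReal H * ∑ j, ∫⁻ x, ‖mollify n (Ω.indicator (g j)) x‖ₑ) atTop (𝓝 R) := by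
      rw [hR, ← lintegral_enorm_indicator hΩm f]
      simp only [← lintegral_enorm_indicator hΩm (g _)]
      exact (tendsto_lintegral_enorm_mollify hfi).add (ENNReal.Tendsto.const_mul
        (tendsto_finsetSum _ fun j _ => tendsto_lintegral_enorm_mollify (hgi j))
        (Or.inr ENNReal.ofReal_ne_top))
    have hpt : ∀ y ∈ D, Tendsto (fun n => ‖mollify n (Ω.indicator f) (graphPoint ν γ y τ)‖ₑ) atTop
        (𝓝 ‖f (graphPoint ν γ y τ)‖ₑ) := by
      intro y hy
      have hmem : graphPoint ν γ y τ ∈ Ω := hsub y hy τ ⟨hτ, by linarith⟩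
      have hev : Ω.indicator f =ᶠ[𝓝 (graphPoint ν γ y τ)] f := by
        filter_upwards [hΩ.mem_nhds hmem] with x hx using Set.indicator_of_mem hx f
      have hca : ContinuousAt (Ω.indicator f) (graphPoint ν γ y τ) :=
        ((hfc.mono subset_closure).continuousAt (hΩ.mem_nhds hmem)).congr hev.symm
      have := (tendsto_mollify_of_continuousAt hfi hca).enorm
      rwa [Set.indicator_of_mem hmem] at this
    calc ENNReal.ofReal (H / 2) * ∫⁻ y in D, ‖f (graphPoint ν γ y τ)‖ₑ
        = ENNReal.ofReal (H / 2) * ∫⁻ y in D,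
          liminf (fun n => ‖mollify n (Ω.indicator f) (graphPoint ν γ y τ)‖ₑ) atTop := by
          congr 1
          exact setLIntegral_congr_fun hDm fun y hy => ((hpt y hy).liminf_eq).symm
      _ ≤ ENNReal.ofReal (H / 2) * liminf (fun n =>
          ∫⁻ y in D, ‖mollify n (Ω.indicator f) (graphPoint ν γ y τ)‖ₑ) atTop := by
          gcongr
          exact lintegral_liminf_le fun n => ((contDiff_mollify hfi n).continuous.comp
            (hGc.comp (Continuous.prodMk_left τ))).measurable.enorm
      _ = liminf (fun n => ENNReal.ofReal (H / 2) *
          ∫⁻ y in D, ‖mollify n (Ω.indicator f) (graphPoint ν γ y τ)‖ₑ) atTop :=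
          (ENNReal.liminf_const_mul_of_ne_top (by simp)).symm
      _ ≤ liminf (fun n => (∫⁻ x, ‖mollify n (Ω.indicator f) x‖ₑ)
        + ENNReal.ofReal H * ∑ j, ∫⁻ x, ‖mollify n (Ω.indicator (g j)) x‖ₑ) atTop := by
          refine liminf_le_liminf ?_
          filter_upwards [ev] with n hn
          have h1 : ENNReal.ofReal (H / 2) ≤ ENNReal.ofReal (H - τ) :=
            ENNReal.ofReal_le_ofReal (by linarith)
          have h2 : ENNReal.ofReal (H - τ) ≤ ENNReal.ofReal H :=
            ENNReal.ofReal_le_ofReal (by linarith)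
          exact ((mul_le_mul_left h1 _).trans hn).trans
            (add_le_add_right (mul_le_mul_left h2 _) _)
      _ = R := lim.liminf_eq
  set τ : ℕ → ℝ := fun k => H / 2 / ((k : ℝ) + 1)
  have hτ0 : ∀ k, 0 < τ k := fun k => by positivity
  have hτH : ∀ k, τ k ≤ H / 2 := fun k => div_le_self (by positivity) (by simp)
  have hτl : Tendsto τ atTop (𝓝 0) := by
    have := (tendsto_one_div_add_atTop_nhds_zero_nat (𝕜 := ℝ)).const_mul (H / 2)
    simpa [τ, div_eq_mul_inv] using this
  have hpt : ∀ y ∈ D, Tendsto (fun k => ‖f (graphPoint ν γ y (τ k))‖ₑ) atTop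
      (𝓝 ‖f (graphPoint ν γ y 0)‖ₑ) := by
    intro y hy
    have hmem : ∀ k, graphPoint ν γ y (τ k) ∈ Ω := fun k =>
      hsub y hy _ ⟨hτ0 k, (hτH k).trans (by linarith)⟩
    have hlim : Tendsto (fun k => graphPoint ν γ y (τ k)) atTop (𝓝 (graphPoint ν γ y 0)) :=
      ((hGc.comp (Continuous.prodMk_right y)).tendsto 0).comp hτl
    have hcl : graphPoint ν γ y 0 ∈ closure Ω :=
      mem_closure_of_tendsto hlim (Eventually.of_forall hmem)
    exact (((hfc _ hcl).tendsto).comp (tendsto_nhdsWithin_iff.2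
      ⟨hlim, Eventually.of_forall fun k => subset_closure (hmem k)⟩)).enorm
  have hmeas : ∀ k, AEMeasurable (fun y => ‖f (graphPoint ν γ y (τ k))‖ₑ) (volume.restrict D) := by
    intro k
    have : ContinuousOn (fun y => f (graphPoint ν γ y (τ k))) D :=
      hfc.comp (hGc.comp (Continuous.prodMk_left (τ k))).continuousOn fun y hy =>
        subset_closure (hsub y hy _ ⟨hτ0 k, (hτH k).trans (by linarith)⟩)
    exact (this.aemeasurable hDm).enorm
  calc ENNReal.ofReal (H / 2) * ∫⁻ y in D, ‖f (graphPoint ν γ y 0)‖ₑ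
      = ENNReal.ofReal (H / 2) * ∫⁻ y in D,
          liminf (fun k => ‖f (graphPoint ν γ y (τ k))‖ₑ) atTop := by
        congr 1
        exact setLIntegral_congr_fun hDm fun y hy => ((hpt y hy).liminf_eq).symm
    _ ≤ ENNReal.ofReal (H / 2) * liminf (fun k =>
          ∫⁻ y in D, ‖f (graphPoint ν γ y (τ k))‖ₑ) atTop := by
        gcongr
        exact lintegral_liminf_le' hmeas
    _ = liminf (fun k => ENNReal.ofReal (H / 2) *
          ∫⁻ y in D, ‖f (graphPoint ν γ y (τ k))‖ₑ) atTop :=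
        (ENNReal.liminf_const_mul_of_ne_top (by simp)).symm
    _ ≤ liminf (fun _ : ℕ => R) atTop :=
        liminf_le_liminf (Eventually.of_forall fun k => inner _ (hτ0 k) (hτH k))
    _ = R := liminf_const R

end

section

variable {N : ℕ} {Ω : Set (EuclideanSpace ℝ (Fin N))} {ν : EuclideanSpace ℝ (Fin N)}

/-- The surface measure of a Lipschitz graph is dominated by the Lebesgue measure of its
projection. -/
lemma lintegral_hausdorff_le_of_subset_graph (hν : ‖ν‖ = 1)
    {G : ((Submodule.span ℝ {ν})ᗮ : Submodule ℝ (EuclideanSpace ℝ (Fin N))) →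
      EuclideanSpace ℝ (Fin N)} (hG : Continuous G)
    {D : Set ((Submodule.span ℝ {ν})ᗮ : Submodule ℝ (EuclideanSpace ℝ (Fin N)))}
    {K : ℝ≥0} (hK : LipschitzOnWith K G D)
    {S : Set (EuclideanSpace ℝ (Fin N))} (hS : S ⊆ G '' D)
    (F : EuclideanSpace ℝ (Fin N) → ℝ≥0∞) :
    ∫⁻ x in S, F x ∂(Measure.euclideanHausdorffMeasure (N - 1)) ≤
      (K : ℝ≥0∞) ^ ((N - 1 : ℕ) : ℝ) * ∫⁻ y in D, F (G y) := by
  have hν0 : ν ≠ 0 := fun h => by simp [h] at hν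
  have hrank : Module.finrank ℝ
      ((Submodule.span ℝ {ν})ᗮ : Submodule ℝ (EuclideanSpace ℝ (Fin N))) = N - 1 := by
    have h := Submodule.finrank_add_finrank_orthogonal (Submodule.span ℝ {ν})
    rw [finrank_span_singleton hν0, finrank_euclideanSpace_fin] at h
    omega
  have hvol : (Measure.euclideanHausdorffMeasure (N - 1) : Measure
      ((Submodule.span ℝ {ν})ᗮ : Submodule ℝ (EuclideanSpace ℝ (Fin N)))) = volume := by
    rw [← InnerProductSpace.euclideanHausdorffMeasure_eq_volume, hrank]
  have hle : (Measure.euclideanHausdorffMeasure (N - 1) :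
      Measure (EuclideanSpace ℝ (Fin N))).restrict S ≤
      (K : ℝ≥0∞) ^ ((N - 1 : ℕ) : ℝ) • Measure.map G (volume.restrict D) := by
    refine Measure.le_iff.2 fun A hA => ?_
    rw [Measure.restrict_apply hA, Measure.smul_apply, Measure.map_apply hG.measurable hA,
      Measure.restrict_apply (hG.measurable hA), smul_eq_mul, ← hvol]
    have hsub : A ∩ S ⊆ G '' (G ⁻¹' A ∩ D) := by
      rintro x ⟨hxA, hxS⟩
      obtain ⟨y, hy, rfl⟩ := hS hxS
      exact ⟨y, ⟨hxA, hy⟩, rfl⟩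
    refine (measure_mono hsub).trans ?_
    have := (hK.mono (Set.inter_subset_right (s := G ⁻¹' A))).hausdorffMeasure_image_le
      (d := ((N - 1 : ℕ) : ℝ)) (Nat.cast_nonneg _)
    simp only [Measure.euclideanHausdorffMeasure_def, Measure.smul_apply, ENNReal.smul_def,
      smul_eq_mul]
    rw [mul_left_comm]
    exact mul_le_mul_right this _
  calc ∫⁻ x in S, F x ∂(Measure.euclideanHausdorffMeasure (N - 1))
      ≤ ∫⁻ x, F x ∂((K : ℝ≥0∞) ^ ((N - 1 : ℕ) : ℝ) • Measure.map G (volume.restrict D)) :=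
        lintegral_mono' hle le_rfl
    _ = (K : ℝ≥0∞) ^ ((N - 1 : ℕ) : ℝ) * ∫⁻ x, F x ∂(Measure.map G (volume.restrict D)) :=
        lintegral_smul_measure _ _
    _ ≤ _ := mul_le_mul_right (lintegral_map_le F G) _

/-- The trace inequality in a neighbourhood of a boundary point. -/
lemma exists_local_trace (hΩ : IsOpen Ω) (hfin : volume Ω ≠ ⊤) (hC2 : HasC2Boundary Ω)
    {x₀ : EuclideanSpace ℝ (Fin N)} (hx₀ : x₀ ∈ frontier Ω) :
    ∃ U ∈ 𝓝 x₀, ∃ C : ℝ≥0, ∀ (f : EuclideanSpace ℝ (Fin N) → ℝ)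
      (g : Fin N → EuclideanSpace ℝ (Fin N) → ℝ), ContinuousOn f (closure Ω) → WeakDiff Ω f g →
      ∫⁻ x in frontier Ω ∩ U, ‖f x‖ₑ ∂(Measure.euclideanHausdorffMeasure (N - 1)) ≤
        C * ((∫⁻ x in Ω, ‖f x‖ₑ) + ∑ j, ∫⁻ x in Ω, ‖g j x‖ₑ) := by
  obtain ⟨ν, hν, γ, hγ, r, hr, hloc⟩ := hC2 x₀ hx₀
  set P := ((Submodule.span ℝ {ν})ᗮ).orthogonalProjectionOnto with hP
  have hγc := hγ.continuous
  have hGc := continuous_graphPoint (ν := ν) hγc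
  -- Boundary points near `x₀` lie on the graph.
  have hgraph : ∀ x ∈ frontier Ω ∩ Metric.ball x₀ r, γ (P x) = ⟪ν, x⟫_ℝ := by
    rintro x ⟨hxf, hxb⟩
    refine le_antisymm ?_ (not_lt.1 fun hlt => ?_)
    · have hc : x ∈ closure (Ω ∩ Metric.ball x₀ r) :=
        mem_closure_iff_nhds.2 fun t ht => by
          obtain ⟨z, hz⟩ := mem_closure_iff_nhds.1 hxf.1 _
            (inter_mem ht (Metric.isOpen_ball.mem_nhds hxb))
          exact ⟨z, hz.1.1, hz.2, hz.1.2⟩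
      have hcl : IsClosed {x : EuclideanSpace ℝ (Fin N) | γ (P x) ≤ ⟪ν, x⟫_ℝ} :=
        isClosed_le (hγc.comp P.continuous) (by fun_prop)
      refine closure_minimal (fun z hz => ?_) hcl hc
      rw [hloc] at hz
      exact hz.2.le
    · have : x ∈ Ω ∩ Metric.ball x₀ r := by rw [hloc]; exact ⟨hxb, hlt⟩
      exact (hΩ.frontier_eq ▸ hxf).2 this.1
  have hx₀G : graphPoint ν γ (P x₀) 0 = x₀ := by
    rw [graphPoint, add_zero, hgraph x₀ ⟨hx₀, Metric.mem_ball_self hr⟩]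
    exact proj_add_inner_smul hν x₀
  obtain ⟨δ, hδ, hδsub⟩ : ∃ δ > 0, ∀ y ∈ Metric.closedBall (P x₀) δ, ∀ t : ℝ, |t| ≤ δ →
      graphPoint ν γ y t ∈ Metric.ball x₀ r := by
    have hn : (fun z : ((Submodule.span ℝ {ν})ᗮ : Submodule ℝ (EuclideanSpace ℝ (Fin N))) × ℝ =>
        graphPoint ν γ z.1 z.2) ⁻¹' Metric.ball x₀ r ∈ 𝓝 (P x₀, (0 : ℝ)) :=
      hGc.continuousAt.preimage_mem_nhds (by
        simp only [hx₀G]; exact Metric.ball_mem_nhds _ hr)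
    obtain ⟨δ, hδ, hsub⟩ := Metric.nhds_basis_closedBall.mem_iff.1 hn
    refine ⟨δ, hδ, fun y hy t ht => ?_⟩
    exact @hsub (y, t) (by
      rw [← closedBall_prod_same]
      exact ⟨hy, by simpa using ht⟩)
  set D := Metric.closedBall (P x₀) δ with hDdef
  have hD : IsCompact D := isCompact_closedBall _ _
  have hsub : ∀ y ∈ D, ∀ t ∈ Set.Ioc 0 δ, graphPoint ν γ y t ∈ Ω := by
    intro y hy t ht
    have hb := hδsub y hy t (by rw [abs_of_pos ht.1]; exact ht.2)
    have : graphPoint ν γ y t ∈ Ω ∩ Metric.ball x₀ r := by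
      rw [hloc]
      refine ⟨hb, ?_⟩
      rw [graphPoint, proj_add_smul, inner_add_smul hν]
      linarith [ht.1]
    exact this.1
  have hG0 : ContDiff ℝ 2 fun y => graphPoint ν γ y 0 := by
    unfold graphPoint
    exact (((Submodule.span ℝ {ν})ᗮ).subtypeL.contDiff).add
      ((hγ.add contDiff_const).smul contDiff_const)
  obtain ⟨K, hK⟩ := (hG0.contDiffOn (s := D)).exists_lipschitzOnWith (by norm_num)
    (convex_closedBall _ _) hD
  have hS : frontier Ω ∩ Metric.ball x₀ (min r δ) ⊆ (fun y => graphPoint ν γ y 0) '' D := by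
    rintro x ⟨hxf, hxb⟩
    refine ⟨P x, ?_, ?_⟩
    · have h1 : dist (P x) (P x₀) ≤ dist x x₀ := by
        rw [dist_eq_norm, dist_eq_norm, ← map_sub]
        exact Submodule.norm_orthogonalProjectionOnto_apply_le _ _
      exact h1.trans ((Metric.mem_ball.1 hxb).le.trans (min_le_right _ _))
    · simp only [graphPoint, add_zero]
      rw [hgraph x ⟨hxf, Metric.ball_subset_ball (min_le_left _ _) hxb⟩]
      exact proj_add_inner_smul hν x
  refine ⟨Metric.ball x₀ (min r δ), Metric.ball_mem_nhds _ (lt_min hr hδ),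
    K ^ ((N - 1 : ℕ) : ℝ) * ((Real.toNNReal (δ / 2))⁻¹ * (1 + Real.toNNReal δ)), ?_⟩
  intro f g hfc hf
  have h1 := lintegral_hausdorff_le_of_subset_graph hν hG0.continuous hK hS
    fun x => ‖f x‖ₑ
  have h2 := lintegral_graphPoint_zero_le hΩ hfin hfc hf hν hγc hD hδ hsub
  refine h1.trans ?_
  have hpos : Real.toNNReal (δ / 2) ≠ 0 := (Real.toNNReal_pos.2 (by positivity)).ne'
  rw [ENNReal.coe_mul, ENNReal.coe_rpow_of_nonneg _ (Nat.cast_nonneg _), mul_assoc]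
  refine mul_le_mul_right ?_ _
  rw [ENNReal.coe_mul, ENNReal.coe_inv hpos, mul_assoc, ← ENNReal.div_eq_inv_mul,
    ENNReal.le_div_iff_mul_le (Or.inl (by simpa using hpos)) (Or.inl ENNReal.coe_ne_top), mul_comm]
  refine h2.trans ?_
  rw [ENNReal.coe_add, ENNReal.coe_one, add_mul, one_mul]
  have e : (Real.toNNReal δ : ℝ≥0∞) = ENNReal.ofReal δ := rfl
  rw [e, mul_add]
  exact add_le_add le_self_add le_add_self

/-- Trace inequality: the `L¹(∂Ω)` norm is controlled by the `W^{1,1}(Ω)` norm. -/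
lemma exists_trace (hΩ : IsOpen Ω) (hb : Bornology.IsBounded Ω) (hC2 : HasC2Boundary Ω) :
    ∃ C : ℝ≥0, ∀ (f : EuclideanSpace ℝ (Fin N) → ℝ)
      (g : Fin N → EuclideanSpace ℝ (Fin N) → ℝ), ContinuousOn f (closure Ω) → WeakDiff Ω f g →
      ∫⁻ x, ‖f x‖ₑ ∂(surfaceMeasure Ω) ≤
        C * ((∫⁻ x in Ω, ‖f x‖ₑ) + ∑ j, ∫⁻ x in Ω, ‖g j x‖ₑ) := by
  have hfin : volume Ω ≠ ⊤ := hb.measure_lt_top.ne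
  have hcomp : IsCompact (frontier Ω) :=
    Metric.isCompact_of_isClosed_isBounded isClosed_frontier
      (hb.closure.subset frontier_subset_closure)
  have key : ∃ C : ℝ≥0, ∀ (f : EuclideanSpace ℝ (Fin N) → ℝ)
      (g : Fin N → EuclideanSpace ℝ (Fin N) → ℝ), ContinuousOn f (closure Ω) → WeakDiff Ω f g →
      ∫⁻ x in frontier Ω ∩ frontier Ω, ‖f x‖ₑ ∂(Measure.euclideanHausdorffMeasure (N - 1)) ≤
        C * ((∫⁻ x in Ω, ‖f x‖ₑ) + ∑ j, ∫⁻ x in Ω, ‖g j x‖ₑ) := by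
    refine hcomp.induction_on (p := fun S => ∃ C : ℝ≥0, ∀ (f : EuclideanSpace ℝ (Fin N) → ℝ)
      (g : Fin N → EuclideanSpace ℝ (Fin N) → ℝ), ContinuousOn f (closure Ω) → WeakDiff Ω f g →
      ∫⁻ x in frontier Ω ∩ S, ‖f x‖ₑ ∂(Measure.euclideanHausdorffMeasure (N - 1)) ≤
        C * ((∫⁻ x in Ω, ‖f x‖ₑ) + ∑ j, ∫⁻ x in Ω, ‖g j x‖ₑ)) ?_ ?_ ?_ ?_
    · exact ⟨0, fun f g _ _ => by simp⟩
    · rintro S T hST ⟨C, hC⟩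
      exact ⟨C, fun f g hfc hf => (lintegral_mono_set
        (Set.inter_subset_inter_right _ hST)).trans (hC f g hfc hf)⟩
    · rintro S T ⟨C, hC⟩ ⟨C', hC'⟩
      refine ⟨C + C', fun f g hfc hf => ?_⟩
      rw [Set.inter_union_distrib_left, ENNReal.coe_add, add_mul]
      exact (lintegral_union_le _ _ _).trans (add_le_add (hC f g hfc hf) (hC' f g hfc hf))
    · intro x hx
      obtain ⟨U, hU, C, hC⟩ := exists_local_trace hΩ hfin hC2 hx
      exact ⟨U, mem_nhdsWithin_of_mem_nhds hU, C, hC⟩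
  rwa [Set.inter_self] at key

end

/-! ### Lipschitz functions and truncated powers -/

section

variable {N : ℕ} {Ω : Set (EuclideanSpace ℝ (Fin N))} {f : EuclideanSpace ℝ (Fin N) → ℝ}

/-- Lipschitz functions are weakly differentiable, by Rademacher's theorem. The line derivative is `0`
at the exceptional points. -/
lemma weakDiff_of_lipschitzWith (hΩ : IsOpen Ω) (hb : Bornology.IsBounded Ω) {L : ℝ≥0}
    (hf : LipschitzWith L f) :
    WeakDiff Ω f (fun j x => lineDeriv ℝ f x (EuclideanSpace.single j 1)) where
  aesm := hf.continuous.aestronglyMeasurable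
  bdd := by
    obtain ⟨C, hC⟩ := hb.isCompact_closure.exists_bound_of_continuousOn hf.continuous.continuousOn
    exact ⟨C, fun x hx => hC x (subset_closure hx)⟩
  int j := by
    have h := hf.locallyIntegrable_lineDeriv (μ := volume) (EuclideanSpace.single j (1 : ℝ))
    exact (h.integrableOn_isCompact hb.isCompact_closure).mono_set subset_closure
  weak j φ hφ := by
    obtain ⟨D, hD⟩ : ∃ D, LipschitzWith D φ :=
      hφ.smooth.lipschitzWith_of_hasCompactSupport hφ.compact (by simp)
    have h := hf.integral_lineDeriv_mul_eq (μ := volume) hD hφ.compact (EuclideanSpace.single j 1)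
    have e1 : ∀ x, lineDeriv ℝ φ x (-EuclideanSpace.single j 1)
        = - fderiv ℝ φ x (EuclideanSpace.single j 1) := fun x => by
      rw [(hφ.smooth.differentiable (by simp) x).lineDeriv_eq_fderiv, map_neg]
    simp only [e1, neg_mul, integral_neg] at h
    rw [← integral_indicator hΩ.measurableSet, ← integral_indicator hΩ.measurableSet]
    have e2 : (Ω.indicator fun x => f x * fderiv ℝ φ x (EuclideanSpace.single j 1))
        = fun x => fderiv ℝ φ x (EuclideanSpace.single j 1) * f x := by
      ext x
      by_cases hx : x ∈ Ω
      · simp [hx, mul_comm]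
      · simp [hx, hφ.fderiv_eq_zero hx]
    have e3 : (Ω.indicator fun x => lineDeriv ℝ f x (EuclideanSpace.single j 1) * φ x)
        = fun x => lineDeriv ℝ f x (EuclideanSpace.single j 1) * φ x := by
      ext x
      by_cases hx : x ∈ Ω
      · simp [hx]
      · simp [hx, hφ.eq_zero hx]
    rw [e2, e3, h, neg_neg]

lemma abs_lineDeriv_le {L : ℝ≥0} (hf : LipschitzWith L f) (x : EuclideanSpace ℝ (Fin N))
    (j : Fin N) : |lineDeriv ℝ f x (EuclideanSpace.single j 1)| ≤ L := by
  have := norm_lineDeriv_le_of_lipschitz ℝ hf (x₀ := x) (v := EuclideanSpace.single j (1 : ℝ))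
  simpa using this

end

/-- A `C¹` truncation `(t-1)₊² t^(σ-2)` of the power `t^σ`, vanishing for `t ≤ 1`. The base
`max t 1` only serves to make the formula regular for `t ≤ 1`. -/
noncomputable def truncPow (t σ : ℝ) : ℝ := max (t - 1) 0 ^ 2 * max t 1 ^ (σ - 2)

/-- The derivative of `truncPow` in `t`. -/
noncomputable def truncPowT (t σ : ℝ) : ℝ :=
  2 * max (t - 1) 0 * max t 1 ^ (σ - 2)
    + max (t - 1) 0 ^ 2 * ((σ - 2) * max t 1 ^ (σ - 3))

/-- The derivative of `truncPow` in `σ`. -/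
noncomputable def truncPowS (t σ : ℝ) : ℝ :=
  max (t - 1) 0 ^ 2 * (max t 1 ^ (σ - 2) * Real.log (max t 1))

lemma truncPow_of_le {t : ℝ} (ht : t ≤ 1) (σ : ℝ) : truncPow t σ = 0 := by
  simp [truncPow, max_eq_right (sub_nonpos.2 ht)]

lemma truncPowT_of_le {t : ℝ} (ht : t ≤ 1) (σ : ℝ) : truncPowT t σ = 0 := by
  simp [truncPowT, max_eq_right (sub_nonpos.2 ht)]

lemma truncPowS_of_le {t : ℝ} (ht : t ≤ 1) (σ : ℝ) : truncPowS t σ = 0 := by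
  simp [truncPowS, max_eq_right (sub_nonpos.2 ht)]

lemma truncPow_of_ge {t : ℝ} (ht : 1 ≤ t) (σ : ℝ) :
    truncPow t σ = (t - 1) ^ 2 * t ^ (σ - 2) := by
  simp [truncPow, max_eq_left (sub_nonneg.2 ht), max_eq_left ht]

lemma truncPowT_of_ge {t : ℝ} (ht : 1 ≤ t) (σ : ℝ) :
    truncPowT t σ = 2 * (t - 1) * t ^ (σ - 2) + (t - 1) ^ 2 * ((σ - 2) * t ^ (σ - 3)) := by
  simp [truncPowT, max_eq_left (sub_nonneg.2 ht), max_eq_left ht]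

lemma truncPowS_of_ge {t : ℝ} (ht : 1 ≤ t) (σ : ℝ) :
    truncPowS t σ = (t - 1) ^ 2 * (t ^ (σ - 2) * Real.log t) := by
  simp [truncPowS, max_eq_left (sub_nonneg.2 ht), max_eq_left ht]

lemma max_one_ne_zero (t : ℝ) : max t 1 ≠ 0 := (lt_max_of_lt_right one_pos).ne'

lemma continuous_max_rpow (c : ℝ) : Continuous fun z : ℝ × ℝ => max z.1 1 ^ (z.2 - c) :=
  Continuous.rpow (by fun_prop) (by fun_prop) fun z => Or.inl (max_one_ne_zero z.1)

lemma continuous_truncPowT : Continuous fun z : ℝ × ℝ => truncPowT z.1 z.2 := by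
  have h2 := continuous_max_rpow 2
  have h3 := continuous_max_rpow 3
  unfold truncPowT
  fun_prop

lemma continuous_truncPowS : Continuous fun z : ℝ × ℝ => truncPowS z.1 z.2 := by
  have h2 := continuous_max_rpow 2
  have h3 : Continuous fun z : ℝ × ℝ => Real.log (max z.1 1) :=
    Continuous.log (by fun_prop) fun z => max_one_ne_zero z.1
  unfold truncPowS
  fun_prop

lemma hasFDerivAt_truncPow (t σ : ℝ) :
    HasFDerivAt (fun z : ℝ × ℝ => truncPow z.1 z.2)
      (truncPowT t σ • ContinuousLinearMap.fst ℝ ℝ ℝ + truncPowS t σ •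
        ContinuousLinearMap.snd ℝ ℝ ℝ) (t, σ) := by
  rcases lt_trichotomy t 1 with ht | ht | ht
  · rw [truncPowT_of_le ht.le, truncPowS_of_le ht.le, zero_smul, zero_smul, add_zero]
    refine (hasFDerivAt_const (0 : ℝ) (t, σ)).congr_of_eventuallyEq ?_
    filter_upwards [continuous_fst.continuousAt.eventually_lt_const (show (t, σ).1 < 1 from ht)]
      with z hz using truncPow_of_le hz.le _
  · subst ht
    rw [truncPowT_of_le le_rfl, truncPowS_of_le le_rfl, zero_smul, zero_smul, add_zero]
    -- Here `truncPow` is a product of an `o(|z - (1, σ)|)` with a locally bounded function.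
    refine HasFDerivAt.of_isLittleO ?_
    have hA : (fun z : ℝ × ℝ => max (z.1 - 1) 0 ^ 2) =o[𝓝 ((1 : ℝ), σ)]
        fun z => z - ((1 : ℝ), σ) := by
      have h1 : (fun z : ℝ × ℝ => max (z.1 - 1) 0 ^ 2) =O[𝓝 ((1 : ℝ), σ)]
          fun z => ‖z - ((1 : ℝ), σ)‖ ^ 2 := by
        refine Asymptotics.IsBigO.of_bound 1 (Eventually.of_forall fun z => ?_)
        have h2 : |z.1 - 1| ≤ ‖z - ((1 : ℝ), σ)‖ := norm_fst_le (z - ((1 : ℝ), σ))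
        have h3 : max (z.1 - 1) 0 ≤ ‖z - ((1 : ℝ), σ)‖ :=
          max_le ((le_abs_self _).trans h2) (norm_nonneg _)
        rw [one_mul, norm_pow, norm_pow, norm_norm, Real.norm_eq_abs,
          abs_of_nonneg (le_max_right _ _)]
        exact pow_le_pow_left₀ (le_max_right _ _) h3 2
      refine h1.trans_isLittleO ?_
      have h4 : Tendsto (fun z : ℝ × ℝ => z - ((1 : ℝ), σ)) (𝓝 ((1 : ℝ), σ)) (𝓝 0) := by
        have : Continuous fun z : ℝ × ℝ => z - ((1 : ℝ), σ) := by fun_prop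
        simpa using this.tendsto ((1 : ℝ), σ)
      exact (Asymptotics.isLittleO_norm_pow_id one_lt_two).comp_tendsto h4
    have hB : (fun z : ℝ × ℝ => max z.1 1 ^ (z.2 - 2)) =O[𝓝 ((1 : ℝ), σ)] fun _ => (1 : ℝ) :=
      ((continuous_max_rpow 2).tendsto _).isBigO_one ℝ
    have h0 : truncPow 1 σ = 0 := truncPow_of_le le_rfl σ
    have h5 := hA.norm_right.mul_isBigO hB
    simp only [mul_one] at h5
    simpa [h0, truncPow] using h5.norm_right
  · rw [truncPowT_of_ge ht.le, truncPowS_of_ge ht.le]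
    have ht0 : 0 < t := one_pos.trans ht
    have h1 : HasFDerivAt (fun z : ℝ × ℝ => z.1) (ContinuousLinearMap.fst ℝ ℝ ℝ) (t, σ) :=
      hasFDerivAt_fst
    have h2 : HasFDerivAt (fun z : ℝ × ℝ => z.2) (ContinuousLinearMap.snd ℝ ℝ ℝ) (t, σ) :=
      hasFDerivAt_snd
    have h3 := ((h1.sub_const 1).pow 2).mul (h1.rpow (h2.sub_const 2) ht0)
    have h4 := h3.congr_of_eventuallyEq (f₁ := fun z : ℝ × ℝ => truncPow z.1 z.2) (by
      filter_upwards [continuous_fst.continuousAt.eventually_const_lt (show 1 < (t, σ).1 from ht)]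
        with z hz
      simpa using truncPow_of_ge hz.le _)
    refine h4.congr_fderiv ?_
    ext <;> simp
    rw [show σ - 2 - 1 = σ - 3 by ring]; ring

lemma truncPow_nonneg (t σ : ℝ) : 0 ≤ truncPow t σ :=
  mul_nonneg (sq_nonneg _) (Real.rpow_nonneg (le_max_of_le_right zero_le_one) _)

lemma truncPow_le {t : ℝ} (ht : 1 ≤ t) (σ : ℝ) : truncPow t σ ≤ t ^ σ := by
  have ht0 : 0 < t := one_pos.trans_le ht
  rw [truncPow_of_ge ht]
  calc (t - 1) ^ 2 * t ^ (σ - 2) ≤ t ^ 2 * t ^ (σ - 2) := by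
        gcongr
        linarith
    _ = t ^ σ := by
        rw [← Real.rpow_natCast, ← Real.rpow_add ht0]; congr 1; push_cast; ring

lemma abs_truncPowT_le {t : ℝ} (ht : 1 ≤ t) (σ : ℝ) :
    |truncPowT t σ| ≤ (2 + |σ - 2|) * t ^ (σ - 1) := by
  have ht0 : 0 < t := one_pos.trans_le ht
  have e1 : t * t ^ (σ - 2) = t ^ (σ - 1) := by
    nth_rewrite 1 [← Real.rpow_one t]
    rw [← Real.rpow_add ht0]; congr 1; ring
  have e2 : t ^ 2 * t ^ (σ - 3) = t ^ (σ - 1) := by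
    rw [← Real.rpow_natCast, ← Real.rpow_add ht0]; congr 1; push_cast; ring
  rw [truncPowT_of_ge ht, add_mul, ← e1]
  refine (abs_add_le _ _).trans (add_le_add ?_ ?_)
  · rw [abs_of_nonneg (by have := sub_nonneg.2 ht; positivity), mul_assoc]
    gcongr
    linarith
  · rw [e1, ← e2, abs_mul, abs_mul, abs_of_nonneg (sq_nonneg (t - 1)),
      abs_of_pos (Real.rpow_pos_of_pos ht0 _)]
    calc (t - 1) ^ 2 * (|σ - 2| * t ^ (σ - 3)) ≤ t ^ 2 * (|σ - 2| * t ^ (σ - 3)) := by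
          gcongr
          linarith
      _ = _ := by ring

lemma abs_truncPowS_le {t : ℝ} (ht : 1 ≤ t) (σ : ℝ) :
    |truncPowS t σ| ≤ t ^ σ * Real.log t := by
  have h : truncPowS t σ = truncPow t σ * Real.log t := by
    rw [truncPowS_of_ge ht, truncPow_of_ge ht]; ring
  rw [h, abs_of_nonneg (mul_nonneg (truncPow_nonneg _ _) (Real.log_nonneg ht))]
  exact mul_le_mul_of_nonneg_right (truncPow_le ht σ) (Real.log_nonneg ht)

lemma rpow_le_truncPow {t : ℝ} (ht : 2 ≤ t) (σ : ℝ) : t ^ σ ≤ 4 * truncPow t σ := by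
  have ht0 : 0 < t := by linarith
  rw [truncPow_of_ge (by linarith)]
  have e : t ^ σ = t ^ 2 * t ^ (σ - 2) := by
    rw [← Real.rpow_natCast, ← Real.rpow_add ht0]; congr 1; push_cast; ring
  rw [e, ← mul_assoc]
  gcongr
  nlinarith

lemma mul_truncPow (t σ : ℝ) : t * truncPow t σ = truncPow t (σ + 1) := by
  rcases le_total t 1 with ht | ht
  · rw [truncPow_of_le ht, truncPow_of_le ht, mul_zero]
  · have ht0 : 0 < t := one_pos.trans_le ht
    rw [truncPow_of_ge ht, truncPow_of_ge ht, show σ + 1 - 2 = (σ - 2) + 1 by ring,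
      Real.rpow_add_one ht0.ne']
    ring

section

variable {N : ℕ} {Ω : Set (EuclideanSpace ℝ (Fin N))} {f h : EuclideanSpace ℝ (Fin N) → ℝ}
  {g k : Fin N → EuclideanSpace ℝ (Fin N) → ℝ}

lemma WeakDiff.truncPow (hΩ : IsOpen Ω) (hfin : volume Ω ≠ ⊤) (hf : WeakDiff Ω f g)
    (hh : WeakDiff Ω h k) :
    WeakDiff Ω (fun x => truncPow (f x) (h x))
      (fun j x => truncPowT (f x) (h x) * g j x + truncPowS (f x) (h x) * k j x) :=
  hf.comp₂ hΩ hfin hh hasFDerivAt_truncPow continuous_truncPowT continuous_truncPowS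

end

/-! ### Young inequalities with uniform constants -/

/-- Young's inequality in the strictly subcritical case `a + b ≤ 1 - κ`, with a constant that is
uniform in the exponents. -/
lemma exists_young_subcritical {κ δ : ℝ} (hκ : 0 < κ) (hδ : 0 < δ) :
    ∃ C : ℝ, 0 ≤ C ∧ ∀ x y a b : ℝ, 0 ≤ x → 0 ≤ y → 0 ≤ a → 0 ≤ b → a + b ≤ 1 - κ →
      x ^ a * y ^ b ≤ δ * (x + y) + C := by
  set R : ℝ := δ ^ (-1 / κ)
  have hR : 0 < R := Real.rpow_pos_of_pos hδ _
  refine ⟨δ + R, by positivity, fun x y a b hx hy ha hb hab => ?_⟩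
  set T : ℝ := max (max x y) 1
  have hT1 : 1 ≤ T := le_max_right _ _
  have hT0 : 0 < T := one_pos.trans_le hT1
  have hxT : x ≤ T := (le_max_left _ _).trans (le_max_left _ _)
  have hyT : y ≤ T := (le_max_right _ _).trans (le_max_left _ _)
  have hTsum : T ≤ x + y + 1 :=
    max_le (max_le (by linarith) (by linarith)) (by linarith)
  have h1 : x ^ a * y ^ b ≤ T ^ (1 - κ) := by
    calc x ^ a * y ^ b ≤ T ^ a * T ^ b := by gcongr
      _ = T ^ (a + b) := (Real.rpow_add hT0 a b).symm
      _ ≤ T ^ (1 - κ) := Real.rpow_le_rpow_of_exponent_le hT1 hab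
  have h2 : T ^ (1 - κ) ≤ δ * T + R := by
    rcases le_total R T with h | h
    · have h3 : T ^ (-κ) ≤ δ := by
        calc T ^ (-κ) ≤ R ^ (-κ) := Real.rpow_le_rpow_of_nonpos hR h (by linarith)
          _ = δ := by
            rw [← Real.rpow_mul hδ.le, show -1 / κ * -κ = 1 by field_simp, Real.rpow_one]
      calc T ^ (1 - κ) = T ^ (-κ) * T := by
            rw [← Real.rpow_add_one hT0.ne']; congr 1; ring
        _ ≤ δ * T := by gcongr
        _ ≤ _ := by linarith
    · calc T ^ (1 - κ) ≤ T ^ (1 : ℝ) := Real.rpow_le_rpow_of_exponent_le hT1 (by linarith)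
        _ = T := Real.rpow_one T
        _ ≤ R := h
        _ ≤ _ := by nlinarith
  nlinarith

/-- Young's inequality `x^a y^(1-a) ≤ C x + δ y`, uniformly for `a` bounded away from `0`. -/
lemma exists_young_critical {a₀ δ : ℝ} (ha₀ : 0 < a₀) (hδ : 0 < δ) :
    ∃ C : ℝ, 0 ≤ C ∧ ∀ x y a : ℝ, 0 ≤ x → 0 ≤ y → a₀ ≤ a → a ≤ 1 →
      x ^ a * y ^ (1 - a) ≤ C * x + δ * y := by
  set K : ℝ := max 1 (δ ^ (-1 / a₀))
  have hK1 : 1 ≤ K := le_max_left _ _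
  have hK0 : 0 < K := one_pos.trans_le hK1
  have hKδ : K ^ (-a₀) ≤ δ := by
    calc K ^ (-a₀) ≤ (δ ^ (-1 / a₀)) ^ (-a₀) :=
          Real.rpow_le_rpow_of_nonpos (Real.rpow_pos_of_pos hδ _) (le_max_right _ _) (by linarith)
      _ = δ := by
          rw [← Real.rpow_mul hδ.le, show -1 / a₀ * -a₀ = 1 by field_simp, Real.rpow_one]
  refine ⟨δ * K, by positivity, fun x y a hx hy ha ha1 => ?_⟩
  set T : ℝ := max (K * x) y
  have hT0 : 0 ≤ T := le_max_of_le_right hy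
  have hTsum : T ≤ K * x + y :=
    max_le (by linarith) (by have := mul_nonneg hK0.le hx; linarith)
  have ha0 : 0 < a := ha₀.trans_le ha
  have h1 : x ^ a = K ^ (-a) * (K * x) ^ a := by
    rw [Real.mul_rpow hK0.le hx, ← mul_assoc, ← Real.rpow_add hK0, neg_add_cancel,
      Real.rpow_zero, one_mul]
  have h2 : K ^ (-a) ≤ δ :=
    (Real.rpow_le_rpow_of_exponent_le hK1 (by linarith)).trans hKδ
  calc x ^ a * y ^ (1 - a) = K ^ (-a) * ((K * x) ^ a * y ^ (1 - a)) := by rw [h1]; ring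
    _ ≤ δ * (T ^ a * T ^ (1 - a)) := by
        have h3 : (K * x) ^ a ≤ T ^ a :=
          Real.rpow_le_rpow (by positivity) (le_max_left _ _) ha0.le
        have h4 : y ^ (1 - a) ≤ T ^ (1 - a) :=
          Real.rpow_le_rpow hy (le_max_right _ _) (by linarith)
        gcongr
    _ = δ * T := by
        rw [← Real.rpow_add_of_nonneg hT0 ha0.le (by linarith), add_sub_cancel, Real.rpow_one]
    _ ≤ δ * (K * x + y) := by gcongr
    _ = _ := by ring

/-! ### Functions in `H¹₀(Ω)` -/

lemma tendsto_integral_mul_of_tendsto_eLpNorm_two {α : Type*} [MeasurableSpace α] {μ : Measure α}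
    {v h : α → ℝ} {vn : ℕ → α → ℝ} (hvn : ∀ n, MemLp (vn n) 2 μ) (hv : MemLp v 2 μ)
    (hh : MemLp h 2 μ) (hlim : Tendsto (fun n => eLpNorm (fun x => vn n x - v x) 2 μ) atTop (𝓝 0)) :
    Tendsto (fun n => ∫ x, vn n x * h x ∂μ) atTop (𝓝 (∫ x, v x * h x ∂μ)) := by
  refine tendsto_integral_of_L1' _ (hv.integrable_mul hh).aestronglyMeasurable
    (Eventually.of_forall fun n => (hvn n).integrable_mul hh) ?_
  have hmul : Tendsto (fun n => eLpNorm (fun x => vn n x - v x) 2 μ * eLpNorm h 2 μ) atTop (𝓝 0) := by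
    simpa using ENNReal.Tendsto.mul_const hlim (Or.inr hh.eLpNorm_ne_top)
  refine tendsto_of_tendsto_of_tendsto_of_le_of_le tendsto_const_nhds hmul (fun _ => zero_le)
    fun n => ?_
  have h1 := eLpNorm_smul_le_mul_eLpNorm (p := 2) (q := 2) (r := 1) hh.aestronglyMeasurable
    ((hvn n).sub hv).aestronglyMeasurable
  refine le_trans (le_of_eq ?_) h1
  congr 1
  ext x
  simp [sub_mul]

section

variable {N : ℕ} {Ω : Set (EuclideanSpace ℝ (Fin N))} {u : EuclideanSpace ℝ (Fin N) → ℝ}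
  {Du : EuclideanSpace ℝ (Fin N) → EuclideanSpace ℝ (Fin N)}

lemma gradient_apply {φ : EuclideanSpace ℝ (Fin N) → ℝ} (x : EuclideanSpace ℝ (Fin N)) (j : Fin N) :
    gradient φ x j = fderiv ℝ φ x (EuclideanSpace.single j 1) := by
  have h : ⟪gradient φ x, EuclideanSpace.single j (1 : ℝ)⟫_ℝ
      = fderiv ℝ φ x (EuclideanSpace.single j 1) := by
    rw [gradient, InnerProductSpace.toDual_symm_apply]
  rw [← h, EuclideanSpace.inner_single_right]
  simp

lemma IsC1Closure.exists_bound (hu : IsC1Closure Ω u Du) (hb : Bornology.IsBounded Ω) :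
    ∃ C : ℝ, (∀ x ∈ closure Ω, |u x| ≤ C) ∧ ∀ x ∈ closure Ω, ‖Du x‖ ≤ C := by
  obtain ⟨C₁, h₁⟩ := hb.isCompact_closure.exists_bound_of_continuousOn hu.continuousOn
  obtain ⟨C₂, h₂⟩ := hb.isCompact_closure.exists_bound_of_continuousOn hu.continuousOn_grad
  exact ⟨max C₁ C₂, fun x hx => (h₁ x hx).trans (le_max_left _ _),
    fun x hx => (h₂ x hx).trans (le_max_right _ _)⟩

lemma IsTestFunction.memLp {φ : EuclideanSpace ℝ (Fin N) → ℝ} (hφ : IsTestFunction Ω φ)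
    (p : ℝ≥0∞) {S : Set (EuclideanSpace ℝ (Fin N))} : MemLp φ p (volume.restrict S) :=
  (hφ.smooth.continuous.memLp_of_hasCompactSupport hφ.compact).restrict S

lemma IsTestFunction.memLp_fderiv {φ : EuclideanSpace ℝ (Fin N) → ℝ} (hφ : IsTestFunction Ω φ)
    (p : ℝ≥0∞) {S : Set (EuclideanSpace ℝ (Fin N))} (v : EuclideanSpace ℝ (Fin N)) :
    MemLp (fun x => fderiv ℝ φ x v) p (volume.restrict S) :=
  (((hφ.smooth.continuous_fderiv (by simp)).clm_apply continuous_const).memLp_of_hasCompactSupport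
    (hφ.compact.fderiv_apply ℝ v)).restrict S

lemma tendsto_eLpNorm_fderiv_sub {φ : ℕ → EuclideanSpace ℝ (Fin N) → ℝ}
    (h : Tendsto (fun n => eLpNorm (fun x => gradient (φ n) x - Du x) 2 (volume.restrict Ω))
      atTop (𝓝 0)) (j : Fin N) :
    Tendsto (fun n => eLpNorm (fun x => fderiv ℝ (φ n) x (EuclideanSpace.single j 1) - Du x j) 2
      (volume.restrict Ω)) atTop (𝓝 0) := by
  refine tendsto_of_tendsto_of_tendsto_of_le_of_le tendsto_const_nhds h (fun _ => zero_le)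
    fun n => eLpNorm_mono fun x => ?_
  rw [← gradient_apply]
  exact PiLp.norm_apply_le (gradient (φ n) x - Du x) j

/-- The extension by zero of `u ∈ H¹₀(Ω)` is weakly differentiable in any larger domain. -/
lemma weakDiff_indicator (hΩ : IsOpen Ω) (hb : Bornology.IsBounded Ω) (hu : IsC1Closure Ω u Du)
    (hL2 : MemLp u 2 (volume.restrict Ω)) (hL2g : ∀ i, MemLp (fun x => Du x i) 2 (volume.restrict Ω))
    (h0 : IsH10 Ω u Du) {B : Set (EuclideanSpace ℝ (Fin N))} (hΩB : Ω ⊆ B) :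
    WeakDiff B (Ω.indicator u) (fun j => Ω.indicator fun x => Du x j) := by
  have hΩm := hΩ.measurableSet
  have hfin : volume Ω ≠ ⊤ := hb.measure_lt_top.ne
  have : IsFiniteMeasure (volume.restrict Ω) := isFiniteMeasure_restrict.2 hfin
  obtain ⟨C, hC, -⟩ := hu.exists_bound hb
  refine ⟨?_, ⟨max C 0, fun x _ => ?_⟩, fun j => ?_, fun j ψ hψ => ?_⟩
  · exact ((aestronglyMeasurable_indicator_iff hΩm).2 hL2.aestronglyMeasurable).restrict
  · by_cases hx : x ∈ Ω
    · simpa [hx] using Or.inl (hC x (subset_closure hx))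
    · simp [hx]
  · have h : IntegrableOn (fun x => Du x j) Ω := (hL2g j).integrable one_le_two
    exact (h.integrable_indicator hΩm).integrableOn
  obtain ⟨φ, hφ, hφu, hφD⟩ := h0
  have e1 : ∀ (v : EuclideanSpace ℝ (Fin N) → ℝ) (s : EuclideanSpace ℝ (Fin N) → ℝ),
      ∫ x in B, Ω.indicator v x * s x = ∫ x in Ω, v x * s x := fun v s => by
    have h1 : (fun x => Ω.indicator v x * s x) = Ω.indicator fun x => v x * s x := by
      ext x
      by_cases hx : x ∈ Ω <;> simp [hx]
    rw [h1, setIntegral_indicator hΩm, Set.inter_eq_right.2 hΩB]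
  rw [e1, e1]
  have l1 := tendsto_integral_mul_of_tendsto_eLpNorm_two (fun n => (hφ n).memLp 2) hL2
    (hψ.memLp_fderiv 2 (EuclideanSpace.single j 1)) hφu
  have l2 := (tendsto_integral_mul_of_tendsto_eLpNorm_two
    (fun n => (hφ n).memLp_fderiv 2 (EuclideanSpace.single j 1)) (hL2g j)
    (hψ.memLp 2) (tendsto_eLpNorm_fderiv_sub hφD j)).neg
  refine tendsto_nhds_unique l1 (l2.congr fun n => ?_)
  have e2 : ∀ (v : EuclideanSpace ℝ (Fin N) → ℝ), (∀ x ∉ Ω, v x = 0) →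
      ∫ x in Ω, v x = ∫ x, v x := fun v hv => setIntegral_eq_integral_of_forall_compl_eq_zero hv
  rw [e2 _ fun x hx => by simp [(hφ n).fderiv_eq_zero hx],
    e2 _ fun x hx => by simp [(hφ n).eq_zero hx]]
  rw [integral_mul_fderiv_eq_neg_fderiv_mul_of_integrable]
  · exact ((((hφ n).smooth.continuous_fderiv (by simp)).clm_apply continuous_const).mul
      hψ.smooth.continuous).integrable_of_hasCompactSupport (HasCompactSupport.mul_left hψ.compact)
  · exact ((hφ n).smooth.continuous.mul ((hψ.smooth.continuous_fderiv (by simp)).clm_apply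
      continuous_const)).integrable_of_hasCompactSupport
      (HasCompactSupport.mul_right (hφ n).compact)
  · exact ((hφ n).smooth.continuous.mul hψ.smooth.continuous).integrable_of_hasCompactSupport
      (HasCompactSupport.mul_left hψ.compact)
  · exact fun x _ => (hφ n).smooth.differentiable (by simp) x
  · exact fun x _ => hψ.smooth.differentiable (by simp) x

/-- Integration by parts of a weakly differentiable field against the gradient of `u ∈ H¹₀(Ω)`:
there is no boundary term. -/
lemma integral_field_mul_grad (hb : Bornology.IsBounded Ω) (hΩm : MeasurableSet Ω)
    (hL2 : MemLp u 2 (volume.restrict Ω)) (hL2g : ∀ i, MemLp (fun x => Du x i) 2 (volume.restrict Ω))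
    (h0 : IsH10 Ω u Du) {W : Fin N → EuclideanSpace ℝ (Fin N) → ℝ}
    {g : Fin N → Fin N → EuclideanSpace ℝ (Fin N) → ℝ} (hW : ∀ i, WeakDiff Ω (W i) (g i))
    (hg : ∀ i, MemLp (g i i) 2 (volume.restrict Ω)) :
    ∑ i, ∫ x in Ω, Du x i * W i x = - ∑ i, ∫ x in Ω, u x * g i i x := by
  have hfin : volume Ω ≠ ⊤ := hb.measure_lt_top.ne
  have : IsFiniteMeasure (volume.restrict Ω) := isFiniteMeasure_restrict.2 hfin
  obtain ⟨φ, hφ, hφu, hφD⟩ := h0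
  rw [← Finset.sum_neg_distrib]
  refine Finset.sum_congr rfl fun i _ => ?_
  have hWL : MemLp (W i) 2 (volume.restrict Ω) := by
    obtain ⟨C, hC⟩ := (hW i).bdd
    exact MemLp.of_bound (hW i).aesm C ((ae_restrict_iff' hΩm).2 (Eventually.of_forall hC))
  have l1 := tendsto_integral_mul_of_tendsto_eLpNorm_two
    (fun n => (hφ n).memLp_fderiv 2 (EuclideanSpace.single i 1)) (hL2g i) hWL
    (tendsto_eLpNorm_fderiv_sub hφD i)
  have l2 := (tendsto_integral_mul_of_tendsto_eLpNorm_two (fun n => (hφ n).memLp 2) hL2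
    (hg i) hφu).neg
  refine tendsto_nhds_unique l1 (l2.congr fun n => ?_)
  have := (hW i).weak i (φ n) (hφ n)
  simp only [mul_comm (fderiv ℝ (φ n) _ _), mul_comm (φ n _), this]

end

/-! ### The parabolic embedding with a variable exponent -/

section

variable {N : ℕ} {Ω : Set (EuclideanSpace ℝ (Fin N))}

/-- Hölder's inequality combined with the Gagliardo–Nirenberg inequality:
`∫ |w| |u|^(2/N) ≤ ‖w‖_{N/(N-1)} ‖u‖₂^(2/N) ≤ C ‖∇w‖₁`. -/
lemma exists_integral_mul_rpow_le (hN : 2 ≤ N) (hΩ : MeasurableSet Ω)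
    (hb : Bornology.IsBounded Ω) (M : ℝ) :
    ∃ C : ℝ, 0 ≤ C ∧ ∀ {B : Set (EuclideanSpace ℝ (Fin N))} {w u : EuclideanSpace ℝ (Fin N) → ℝ}
      {g : Fin N → EuclideanSpace ℝ (Fin N) → ℝ}, IsOpen B → volume B ≠ ⊤ → closure Ω ⊆ B →
      WeakDiff B w g → (∀ x ∉ Ω, w x = 0) → (∀ j, ∀ x ∉ Ω, g j x = 0) →
      AEStronglyMeasurable u (volume.restrict Ω) →
      eLpNorm u 2 (volume.restrict Ω) ≤ ENNReal.ofReal M →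
      ∫ x in Ω, |w x| * |u x| ^ (2 / (N : ℝ)) ≤ C * ∑ j, ∫ x in Ω, |g j x| := by
  have hN1 : (1 : ℝ) < N := by exact_mod_cast hN
  have hN0 : (0 : ℝ) < N := by linarith
  have hpq := Real.HolderConjugate.conjExponent hN1
  set p := Real.conjExponent N
  have hp0 : 0 < p := hpq.symm.pos
  obtain ⟨C₀, hC₀⟩ := exists_lintegral_rpow_le (N := N) hpq
  set C₁ : ℝ≥0∞ := (C₀ : ℝ≥0∞) ^ (1 / p) * (ENNReal.ofReal M ^ (2 : ℝ)) ^ (1 / (N : ℝ)) with hC₁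
  have hC₁t : C₁ ≠ ⊤ := ENNReal.mul_ne_top
    (ENNReal.rpow_ne_top_of_nonneg (by positivity) ENNReal.coe_ne_top)
    (ENNReal.rpow_ne_top_of_nonneg (by positivity)
      (ENNReal.rpow_ne_top_of_nonneg (by positivity) ENNReal.ofReal_ne_top))
  refine ⟨C₁.toReal, ENNReal.toReal_nonneg, ?_⟩
  intro B w u g hB hBfin hΩB hw hw0 hg0 hu huM
  have hGN := hC₀ hB hBfin hb.isCompact_closure hΩB hw hw0 hg0
  have hwm : AEStronglyMeasurable w (volume.restrict Ω) :=
    hw.aesm.mono_measure (Measure.restrict_mono (subset_closure.trans hΩB) le_rfl)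
  have hgi : ∀ j, IntegrableOn (g j) Ω := fun j =>
    (hw.int j).mono_set (subset_closure.trans hΩB)
  have hg : ∀ j, ∫⁻ x, ‖g j x‖ₑ = ∫⁻ x in Ω, ‖g j x‖ₑ := fun j => by
    rw [← lintegral_enorm_indicator hΩ]
    congr 1; ext x
    by_cases hx : x ∈ Ω <;> simp [hx, hg0 j x]
  simp only [hg] at hGN
  have hu2 : ∫⁻ x in Ω, ‖u x‖ₑ ^ (2 : ℝ) ≤ ENNReal.ofReal M ^ (2 : ℝ) := by
    rw [eLpNorm_eq_lintegral_rpow_enorm_toReal two_ne_zero ENNReal.ofNat_ne_top] at huM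
    have h := ENNReal.rpow_le_rpow huM (z := 2) zero_le_two
    rw [← ENNReal.rpow_mul] at h
    simpa using h
  have hHolder : ∫⁻ x in Ω, ‖w x‖ₑ * ‖u x‖ₑ ^ (2 / (N : ℝ)) ≤
      C₁ * ∑ j, ∫⁻ x in Ω, ‖g j x‖ₑ := by
    calc ∫⁻ x in Ω, ‖w x‖ₑ * ‖u x‖ₑ ^ (2 / (N : ℝ))
        ≤ (∫⁻ x in Ω, ‖w x‖ₑ ^ p) ^ (1 / p) *
          (∫⁻ x in Ω, (‖u x‖ₑ ^ (2 / (N : ℝ))) ^ (N : ℝ)) ^ (1 / (N : ℝ)) :=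
          ENNReal.lintegral_mul_le_Lp_mul_Lq _ hpq.symm hwm.enorm (hu.enorm.pow_const _)
      _ = (∫⁻ x in Ω, ‖w x‖ₑ ^ p) ^ (1 / p) *
          (∫⁻ x in Ω, ‖u x‖ₑ ^ (2 : ℝ)) ^ (1 / (N : ℝ)) := by
          simp only [← ENNReal.rpow_mul, div_mul_cancel₀ _ hN0.ne']
      _ ≤ ((C₀ : ℝ≥0∞) * (∑ j, ∫⁻ x in Ω, ‖g j x‖ₑ) ^ p) ^ (1 / p) *
          (ENNReal.ofReal M ^ (2 : ℝ)) ^ (1 / (N : ℝ)) := by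
          gcongr
          exact (setLIntegral_le_lintegral _ _).trans hGN
      _ = C₁ * ∑ j, ∫⁻ x in Ω, ‖g j x‖ₑ := by
          rw [ENNReal.mul_rpow_of_nonneg _ _ (by positivity), ← ENNReal.rpow_mul,
            mul_one_div_cancel hp0.ne', ENNReal.rpow_one, hC₁]
          ring
  have hm : AEStronglyMeasurable (fun x => w x * |u x| ^ (2 / (N : ℝ))) (volume.restrict Ω) :=
    hwm.mul (hu.norm.aemeasurable.pow_const _).aestronglyMeasurable
  have e1 : ∫ x in Ω, |w x| * |u x| ^ (2 / (N : ℝ))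
      = (∫⁻ x in Ω, ‖w x‖ₑ * ‖u x‖ₑ ^ (2 / (N : ℝ))).toReal := by
    have h := integral_norm_eq_lintegral_enorm hm
    have h1 : ∀ x, ‖w x * |u x| ^ (2 / (N : ℝ))‖ = |w x| * |u x| ^ (2 / (N : ℝ)) := fun x => by
      rw [norm_mul, Real.norm_eq_abs, Real.norm_of_nonneg (Real.rpow_nonneg (abs_nonneg _) _)]
    have h2 : ∀ x, ‖w x * |u x| ^ (2 / (N : ℝ))‖ₑ = ‖w x‖ₑ * ‖u x‖ₑ ^ (2 / (N : ℝ)) := fun x => by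
      rw [enorm_mul, Real.enorm_eq_ofReal (Real.rpow_nonneg (abs_nonneg (u x)) _),
        ← ENNReal.ofReal_rpow_of_nonneg (abs_nonneg _) (by positivity), ← Real.norm_eq_abs,
        ofReal_norm]
    simpa only [h1, h2] using h
  have e2 : ∀ j, ∫ x in Ω, |g j x| = (∫⁻ x in Ω, ‖g j x‖ₑ).toReal := fun j =>
    integral_norm_eq_lintegral_enorm (hgi j).aestronglyMeasurable
  have hgt : ∀ j ∈ Finset.univ, ∫⁻ x in Ω, ‖g j x‖ₑ ≠ ⊤ := fun j _ => (hgi j).2.ne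
  rw [e1]
  simp only [e2]
  rw [← ENNReal.toReal_sum hgt, ← ENNReal.toReal_mul]
  exact ENNReal.toReal_mono (ENNReal.mul_ne_top hC₁t (ENNReal.sum_ne_top.2 hgt)) hHolder

/-- Pointwise bound for the gradient of a truncation of `|u|^k`, `k = ((n+2)e-2)/n`, where `D`
stands for `|∇u|` and `K` bounds the derivative of `k/2`. -/
lemma exists_truncPow_gradient_bound {n e₀ e₁ K δ : ℝ} (hn : 2 ≤ n) (he₀ : 1 < e₀) (he₁ : e₀ ≤ e₁)
    (hK : 0 ≤ K) (hδ : 0 < δ) :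
    ∃ C : ℝ, 0 ≤ C ∧ ∀ e u D : ℝ, e₀ ≤ e → e ≤ e₁ → 0 ≤ D →
      |truncPowT (u * u) (((n + 2) * e - 2) / n / 2)| * (2 * |u| * D)
        + |truncPowS (u * u) (((n + 2) * e - 2) / n / 2)| * K
        ≤ δ * |u| ^ (e * (n + 2) / n) + C * D ^ e + C := by
  have hn0 : 0 < n := by linarith
  have he₁0 : 0 < e₁ := by linarith
  obtain ⟨C₁, hC₁, h₁⟩ := exists_young_critical (a₀ := 1 / e₁)
    (δ := δ / 2 / (2 * (4 + e₁))) (by positivity) (by positivity)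
  obtain ⟨C₂, hC₂, h₂⟩ := exists_young_subcritical (κ := 1 / n / (2 * e₁))
    (δ := δ / 2 / (2 * n * (K + 1))) (by positivity) (by positivity)
  refine ⟨2 * (4 + e₁) * C₁ + 2 * n * (K + 1) * C₂, by positivity, fun e u D hee₀ hee₁ hD => ?_⟩
  have he0 : 0 < e := by linarith
  set k := ((n + 2) * e - 2) / n with hk
  set m := e * (n + 2) / n with hm
  have hkm : k = m - 2 / n := by rw [hk, hm]; ring
  have hm0 : 0 < m := by positivity
  have hme : m ≤ 2 * e₁ := by
    rw [hm, div_le_iff₀ hn0]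
    nlinarith
  have hk0 : 0 < k := by
    rw [hk]
    have : 0 < (n + 2) * e - 2 := by nlinarith
    positivity
  have hk1 : k ≤ 2 * e₁ := by
    have : 0 < 2 / n := by positivity
    linarith
  have hDe : 0 ≤ D ^ e := Real.rpow_nonneg hD _
  have hum : 0 ≤ |u| ^ m := Real.rpow_nonneg (abs_nonneg _) _
  rcases le_or_gt (u * u) 1 with hu | hu
  · rw [truncPowT_of_le hu, truncPowS_of_le hu]
    simp only [abs_zero, zero_mul, add_zero]
    positivity
  set v := |u| with hv
  have hv0 : 0 ≤ v := abs_nonneg _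
  have huv : u * u = v ^ (2 : ℝ) := by
    rw [hv, Real.rpow_two, sq_abs]; ring
  have hv1 : 1 < v := by
    rw [huv, Real.rpow_two] at hu
    nlinarith
  have hvp : 0 < v := by linarith
  have hpow : ∀ s : ℝ, (v ^ (2 : ℝ)) ^ s = v ^ (2 * s) := fun s => (Real.rpow_mul hv0 2 s).symm
  have b1 : |truncPowT (u * u) (k / 2)| * (2 * v * D)
      ≤ δ / 2 * v ^ m + 2 * (4 + e₁) * C₁ * D ^ e := by
    have h := abs_truncPowT_le hu.le (k / 2)
    rw [huv, hpow, show 2 * (k / 2 - 1) = k - 2 by ring, ← huv] at h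
    have hA : 2 + |k / 2 - 2| ≤ 4 + e₁ := by
      have : |k / 2 - 2| ≤ e₁ + 2 := abs_le.2 ⟨by linarith, by linarith⟩
      linarith
    have hyoung := h₁ (D ^ e) (v ^ m) (1 / e) hDe hum
      (one_div_le_one_div_of_le he0 hee₁) (by rw [div_le_one he0]; linarith)
    have hexp : (D ^ e) ^ (1 / e) * (v ^ m) ^ (1 - 1 / e) = v ^ (k - 1) * D := by
      rw [← Real.rpow_mul hD, mul_one_div_cancel he0.ne', Real.rpow_one, ← Real.rpow_mul hv0,
        mul_comm]
      congr 2
      rw [hm, hk]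
      field_simp
      ring
    rw [hexp] at hyoung
    calc |truncPowT (u * u) (k / 2)| * (2 * v * D)
        ≤ ((4 + e₁) * v ^ (k - 2)) * (2 * v * D) := by
          refine mul_le_mul_of_nonneg_right (h.trans ?_) (by positivity)
          exact mul_le_mul_of_nonneg_right hA (Real.rpow_nonneg hv0 _)
      _ = 2 * (4 + e₁) * (v ^ (k - 1) * D) := by
          rw [show k - 1 = (k - 2) + 1 by ring, Real.rpow_add_one hvp.ne']
          ring
      _ ≤ 2 * (4 + e₁) * (C₁ * D ^ e + δ / 2 / (2 * (4 + e₁)) * v ^ m) := by gcongr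
      _ = _ := by field_simp; ring
  have b2 : |truncPowS (u * u) (k / 2)| * K ≤ δ / 2 * v ^ m + 2 * n * (K + 1) * C₂ := by
    have h := abs_truncPowS_le hu.le (k / 2)
    rw [huv, hpow, show 2 * (k / 2) = k by ring, Real.log_rpow hvp, ← huv] at h
    have hlog : Real.log v ≤ n * v ^ (1 / n) := by
      have := Real.log_le_rpow_div hv0 (ε := 1 / n) (by positivity)
      rwa [div_div_eq_mul_div, div_one, mul_comm] at this
    have hyoung := h₂ 0 (v ^ m) 0 ((k + 1 / n) / m) le_rfl hum le_rfl (by positivity) (by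
      rw [zero_add, show k + 1 / n = m - 1 / n by rw [hkm]; ring, sub_div, div_self hm0.ne']
      have : 1 / n / (2 * e₁) ≤ 1 / n / m := by gcongr
      linarith)
    rw [Real.rpow_zero, one_mul, zero_add, ← Real.rpow_mul hv0, mul_div_cancel₀ _ hm0.ne'] at hyoung
    calc |truncPowS (u * u) (k / 2)| * K ≤ (v ^ k * (2 * (n * v ^ (1 / n)))) * (K + 1) := by
          refine mul_le_mul (h.trans ?_) (by linarith) hK (by positivity)
          gcongr
      _ = 2 * n * (K + 1) * v ^ (k + 1 / n) := by
          rw [Real.rpow_add hvp]; ring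
      _ ≤ 2 * n * (K + 1) * (δ / 2 / (2 * n * (K + 1)) * v ^ m + C₂) := by gcongr
      _ = _ := by field_simp
  have hC2' : 0 ≤ 2 * n * (K + 1) * C₂ * D ^ e := by positivity
  have hC1' : 0 ≤ 2 * (4 + e₁) * C₁ := by positivity
  nlinarith

lemma integrableOn_rpow (hΩ : MeasurableSet Ω) (hfin : volume Ω ≠ ⊤)
    {f s : EuclideanSpace ℝ (Fin N) → ℝ} (hf : AEStronglyMeasurable f (volume.restrict Ω))
    (hs : AEStronglyMeasurable s (volume.restrict Ω)) {C S : ℝ} (hf0 : ∀ x ∈ Ω, 0 ≤ f x)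
    (hfC : ∀ x ∈ Ω, f x ≤ C) (hs0 : ∀ x ∈ Ω, 0 ≤ s x) (hsS : ∀ x ∈ Ω, s x ≤ S) :
    IntegrableOn (fun x => f x ^ s x) Ω := by
  refine integrableOn_of_bounded hfin hΩ
    (hf.aemeasurable.pow hs.aemeasurable).aestronglyMeasurable (C := max C 1 ^ S) fun x hx => ?_
  rw [abs_of_nonneg (Real.rpow_nonneg (hf0 x hx) _)]
  calc f x ^ s x ≤ max C 1 ^ s x :=
        Real.rpow_le_rpow (hf0 x hx) ((hfC x hx).trans (le_max_left _ _)) (hs0 x hx)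
    _ ≤ max C 1 ^ S := Real.rpow_le_rpow_of_exponent_le (le_max_right _ _) (hsS x hx)

/-- Embedding of parabolic type with a variable exponent: for functions with bounded `L²` norm,
`∫ |u|^(e(N+2)/N)` is controlled linearly by `∫ |∇u|^e`. The point is that
`|u|^(e(N+2)/N) = |u|^k |u|^(2/N)` for `k = ((N+2)e-2)/N`, so that the Gagliardo–Nirenberg inequality
applied to (a truncation of) `|u|^k` is linear in the integrals. -/
lemma exists_embedding (hN : 2 ≤ N) (hΩ : IsOpen Ω) (hb : Bornology.IsBounded Ω) {e₀ e₁ : ℝ}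
    (he₀ : 1 < e₀) (he₁ : e₀ ≤ e₁) (L : ℝ≥0) (M : ℝ) :
    ∃ C : ℝ, 0 ≤ C ∧ ∀ {e u : EuclideanSpace ℝ (Fin N) → ℝ}
      {Du : EuclideanSpace ℝ (Fin N) → EuclideanSpace ℝ (Fin N)},
      LipschitzWith L e → (∀ x ∈ Ω, e₀ ≤ e x) → (∀ x ∈ Ω, e x ≤ e₁) → IsC1Closure Ω u Du →
      MemLp u 2 (volume.restrict Ω) → (∀ i, MemLp (fun x => Du x i) 2 (volume.restrict Ω)) →
      IsH10 Ω u Du → eLpNorm u 2 (volume.restrict Ω) ≤ ENNReal.ofReal M →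
      ∫ x in Ω, |u x| ^ (e x * ((N : ℝ) + 2) / N) ≤ C * (∫ x in Ω, ‖Du x‖ ^ e x) + C := by
  have hΩm := hΩ.measurableSet
  have hfin : volume Ω ≠ ⊤ := hb.measure_lt_top.ne
  have hn : (2 : ℝ) ≤ N := by exact_mod_cast hN
  have hn0 : (0 : ℝ) < N := by linarith
  have he₁0 : 0 < e₁ := by linarith
  obtain ⟨A, hA0, hA⟩ := exists_integral_mul_rpow_le hN hΩm hb M
  set c : ℝ≥0 := ⟨((N : ℝ) + 2) / N / 2, by positivity⟩ with hc
  set K : ℝ≥0 := c * L with hK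
  set δ : ℝ := 1 / (8 * (A + 1) * N) with hδ
  have hδ0 : 0 < δ := by positivity
  obtain ⟨P, hP0, hP⟩ := exists_truncPow_gradient_bound (K := K) hn he₀ he₁ K.2 hδ0
  set V : ℝ := volume.real Ω
  have hV : 0 ≤ V := measureReal_nonneg
  refine ⟨2 * (2 ^ e₁ * V + 4 * A * N * P * (1 + V)), by positivity, ?_⟩
  intro e u Du hLe hee₀ hee₁ hu hL2 hL2g h0 huM
  obtain ⟨R, hR⟩ := hb.closure.subset_ball (0 : EuclideanSpace ℝ (Fin N))
  set B := Metric.ball (0 : EuclideanSpace ℝ (Fin N)) R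
  have hB : IsOpen B := Metric.isOpen_ball
  have hBb : Bornology.IsBounded B := Metric.isBounded_ball
  have hBfin : volume B ≠ ⊤ := measure_ball_lt_top.ne
  set kf : EuclideanSpace ℝ (Fin N) → ℝ := fun x => (((N : ℝ) + 2) * e x - 2) / N / 2 with hkf
  have hkL : LipschitzWith K kf := LipschitzWith.of_dist_le_mul fun x y => by
    have h1 : kf x - kf y = c * (e x - e y) := by
      have hcr : (c : ℝ) = ((N : ℝ) + 2) / N / 2 := rfl
      rw [hcr]; simp only [hkf]; ring
    rw [Real.dist_eq, h1, abs_mul, abs_of_nonneg (NNReal.coe_nonneg c), hK, NNReal.coe_mul, mul_assoc]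
    have h2 := hLe.dist_le_mul x y
    rw [Real.dist_eq] at h2
    exact mul_le_mul_of_nonneg_left h2 (NNReal.coe_nonneg c)
  have hU := weakDiff_indicator hΩ hb hu hL2 hL2g h0 (subset_closure.trans hR)
  have hw := (hU.mul hB hBfin hU).truncPow hB hBfin (weakDiff_of_lipschitzWith hB hBb hkL)
  have hzero : ∀ x ∉ Ω, Ω.indicator u x * Ω.indicator u x ≤ 1 := fun x hx => by simp [hx]
  have hAw := hA hB hBfin hR hw (fun x hx => truncPow_of_le (hzero x hx) _)
    (fun j x hx => by
      rw [truncPowT_of_le (hzero x hx), truncPowS_of_le (hzero x hx)]; ring)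
    hL2.aestronglyMeasurable huM
  obtain ⟨Cu, hCu, hCD⟩ := hu.exists_bound hb
  have hem : AEStronglyMeasurable e (volume.restrict Ω) := hLe.continuous.aestronglyMeasurable
  have hDm : AEStronglyMeasurable Du (volume.restrict Ω) :=
    (hu.continuousOn_grad.mono subset_closure).aestronglyMeasurable hΩm
  have hm0 : ∀ x ∈ Ω, 0 ≤ e x * ((N : ℝ) + 2) / N := fun x hx => by
    have := hee₀ x hx
    have : 0 < e x := by linarith
    positivity
  have hm1 : ∀ x ∈ Ω, e x * ((N : ℝ) + 2) / N ≤ 2 * e₁ := fun x hx => by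
    rw [div_le_iff₀ hn0]
    have := hee₀ x hx
    have := hee₁ x hx
    nlinarith
  have hum : IntegrableOn (fun x => |u x| ^ (e x * ((N : ℝ) + 2) / N)) Ω :=
    integrableOn_rpow hΩm hfin hL2.aestronglyMeasurable.norm
      ((hem.mul_const _).mul_const _) (fun x _ => abs_nonneg _)
      (fun x hx => hCu x (subset_closure hx)) hm0 hm1
  have hDe : IntegrableOn (fun x => ‖Du x‖ ^ e x) Ω :=
    integrableOn_rpow hΩm hfin hDm.norm hem (fun x _ => norm_nonneg _)
      (fun x hx => hCD x (subset_closure hx)) (fun x hx => by have := hee₀ x hx; linarith) hee₁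
  have hone : IntegrableOn (fun _ : EuclideanSpace ℝ (Fin N) => (1 : ℝ)) Ω :=
    integrableOn_const hfin
  set Y := ∫ x in Ω, |u x| ^ (e x * ((N : ℝ) + 2) / N) with hY
  set X := ∫ x in Ω, ‖Du x‖ ^ e x with hX
  have hX0 : 0 ≤ X := integral_nonneg fun x => Real.rpow_nonneg (norm_nonneg _) _
  have hint1 : ∫ _ in Ω, (1 : ℝ) = V := by simp [V]
  -- The gradient of the truncation.
  have hgrad : ∀ j, ∫ x in Ω, |truncPowT (Ω.indicator u x * Ω.indicator u x) (kf x) *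
      (Ω.indicator u x * Ω.indicator (fun x => Du x j) x +
        Ω.indicator u x * Ω.indicator (fun x => Du x j) x) +
      truncPowS (Ω.indicator u x * Ω.indicator u x) (kf x) *
        lineDeriv ℝ kf x (EuclideanSpace.single j 1)| ≤ δ * Y + P * X + P * V := by
    intro j
    have hi : IntegrableOn (fun x => δ * |u x| ^ (e x * ((N : ℝ) + 2) / N) + P * ‖Du x‖ ^ e x
        + P * 1) Ω := ((hum.const_mul δ).add (hDe.const_mul P)).add (hone.const_mul P)
    refine (setIntegral_mono_on ((hw.int j).mono_set (subset_closure.trans hR)).abs hi hΩm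
      fun x hx => ?_).trans_eq ?_
    · simp only [Set.indicator_of_mem hx]
      refine le_trans ?_ ((hP (e x) (u x) ‖Du x‖ (hee₀ x hx) (hee₁ x hx) (norm_nonneg _)).trans_eq
        (by ring))
      refine (abs_add_le _ _).trans (add_le_add ?_ ?_)
      · rw [abs_mul]
        refine mul_le_mul_of_nonneg_left ?_ (abs_nonneg _)
        rw [← two_mul, abs_mul, abs_mul, abs_two, mul_assoc]
        have : |Du x j| ≤ ‖Du x‖ := PiLp.norm_apply_le (Du x) j
        gcongr
      · rw [abs_mul]
        exact mul_le_mul_of_nonneg_left (abs_lineDeriv_le hkL x j) (abs_nonneg _)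
    · have i1 : IntegrableOn (fun x => δ * |u x| ^ (e x * ((N : ℝ) + 2) / N)) Ω := hum.const_mul δ
      have i2 : IntegrableOn (fun x => P * ‖Du x‖ ^ e x) Ω := hDe.const_mul P
      have i12 : IntegrableOn (fun x => δ * |u x| ^ (e x * ((N : ℝ) + 2) / N)
        + P * ‖Du x‖ ^ e x) Ω := i1.add i2
      rw [integral_add i12 (hone.const_mul P), integral_add i1 i2, integral_const_mul,
        integral_const_mul, integral_const_mul, hint1]
  have hsum : A * ∑ j : Fin N, (∫ x in Ω,
      |truncPowT (Ω.indicator u x * Ω.indicator u x) (kf x) *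
      (Ω.indicator u x * Ω.indicator (fun x => Du x j) x +
        Ω.indicator u x * Ω.indicator (fun x => Du x j) x) +
      truncPowS (Ω.indicator u x * Ω.indicator u x) (kf x) *
        lineDeriv ℝ kf x (EuclideanSpace.single j 1)|) ≤ A * (N * (δ * Y + P * X + P * V)) := by
    refine mul_le_mul_of_nonneg_left ?_ hA0
    refine (Finset.sum_le_sum fun j _ => hgrad j).trans_eq ?_
    rw [Finset.sum_const, Finset.card_univ, Fintype.card_fin, nsmul_eq_mul]
  have hW := hAw.trans hsum
  -- Recover the full power of `u` from the truncation.
  have hwi : IntegrableOn (fun x => |truncPow (Ω.indicator u x * Ω.indicator u x) (kf x)|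
      * |u x| ^ (2 / (N : ℝ))) Ω := by
    obtain ⟨Cw, hCw⟩ := hw.bdd
    have hwm := hw.aesm.mono_measure (Measure.restrict_mono (subset_closure.trans hR) le_rfl)
    refine Integrable.bdd_mul (c := Cw) ?_ hwm.norm ?_
    · exact integrableOn_rpow hΩm hfin hL2.aestronglyMeasurable.norm
        (aestronglyMeasurable_const (b := 2 / (N : ℝ))) (fun x _ => abs_nonneg _)
        (fun x hx => hCu x (subset_closure hx)) (fun _ _ => by positivity) (fun _ _ => le_rfl)
    · refine (ae_restrict_iff' hΩm).2 (Eventually.of_forall fun x hx => ?_)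
      rw [Real.norm_eq_abs, abs_abs]
      exact hCw x (hR (subset_closure hx))
  have hYle : Y ≤ 2 ^ e₁ * V + 4 * ∫ x in Ω,
      |truncPow (Ω.indicator u x * Ω.indicator u x) (kf x)| * |u x| ^ (2 / (N : ℝ)) := by
    have hi : IntegrableOn (fun x => 2 ^ e₁ * 1 +
        4 * (|truncPow (Ω.indicator u x * Ω.indicator u x) (kf x)| * |u x| ^ (2 / (N : ℝ)))) Ω :=
      (hone.const_mul _).add (hwi.const_mul 4)
    refine (setIntegral_mono_on hum hi hΩm fun x hx => ?_).trans_eq ?_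
    · simp only [Set.indicator_of_mem hx]
      have hpow : ∀ s : ℝ, |u x| ^ (2 * s) = (u x * u x) ^ s := fun s => by
        rw [Real.rpow_mul (abs_nonneg _), Real.rpow_two, sq_abs, sq]
      rcases le_total 2 (u x * u x) with h2 | h2
      · have h3 := rpow_le_truncPow h2 (kf x)
        have hu0 : 0 < |u x| := abs_pos.2 fun h => by rw [h] at h2; norm_num at h2
        have h4 : |u x| ^ (e x * ((N : ℝ) + 2) / N)
            = (u x * u x) ^ kf x * |u x| ^ (2 / (N : ℝ)) := by
          rw [← hpow, ← Real.rpow_add hu0]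
          congr 1
          simp only [hkf]
          field_simp
          ring
        rw [h4, abs_of_nonneg (truncPow_nonneg _ _)]
        have h5 : 0 ≤ |u x| ^ (2 / (N : ℝ)) := Real.rpow_nonneg (abs_nonneg _) _
        have h6 : (0 : ℝ) < 2 ^ e₁ := Real.rpow_pos_of_pos two_pos _
        nlinarith
      · have h3 : |u x| ^ (e x * ((N : ℝ) + 2) / N)
            = (u x * u x) ^ (e x * ((N : ℝ) + 2) / N / 2) := by
          rw [← hpow]; congr 1; ring
        rw [h3, mul_one]
        have h4 : (u x * u x) ^ (e x * ((N : ℝ) + 2) / N / 2) ≤ 2 ^ e₁ :=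
          (Real.rpow_le_rpow (mul_self_nonneg _) h2 (by have := hm0 x hx; positivity)).trans
            (Real.rpow_le_rpow_of_exponent_le one_le_two (by have := hm1 x hx; linarith))
        have h5 : 0 ≤ |truncPow (u x * u x) (kf x)| * |u x| ^ (2 / (N : ℝ)) := by positivity
        linarith
    · have i1 : IntegrableOn (fun _ : EuclideanSpace ℝ (Fin N) => 2 ^ e₁ * (1 : ℝ)) Ω :=
        hone.const_mul _
      rw [integral_add i1 (hwi.const_mul 4), integral_const_mul, integral_const_mul, hint1]
  -- The choice of `δ` allows to absorb `Y`.
  have hAδ : 4 * (A * (N * (δ * Y))) ≤ Y / 2 := by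
    have hY0 : 0 ≤ Y := integral_nonneg fun x => Real.rpow_nonneg (abs_nonneg _) _
    have : 4 * (A * (N * (δ * Y))) = A / (A + 1) * (Y / 2) := by
      rw [hδ]; field_simp; ring
    rw [this]
    exact mul_le_of_le_one_left (by positivity) ((div_le_one (by positivity)).2 (by linarith))
  have h2V : 0 ≤ 2 ^ e₁ * V := by positivity
  have hQ : 0 ≤ 4 * A * N * P := by positivity
  have hfinal : Y ≤ 2 * (2 ^ e₁ * V + 4 * A * N * P * (X + V)) := by nlinarith
  refine hfinal.trans ?_
  have h3 : 0 ≤ 4 * A * N * P * (V * X) := by positivity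
  have h4 : 0 ≤ 2 ^ e₁ * V * X := by positivity
  nlinarith

end

/-! ### Interpolation: higher integrability of the gradient -/

/-- Young's inequality for the integrand `|u| |div W|` of the integration by parts. All the powers
are strictly subcritical for the pair `t^(e/2)`, `|u|^(e(n+2)/n)`, where `e = s + 3/(n+2)`: the
defect is `1/(n+2)` and comes from `3 < 4`. -/
lemma exists_interpolation_pointwise {n s₀ s₁ A δ : ℝ} (hn : 2 ≤ n) (hs₀ : 2 * n / (n + 2) < s₀)
    (hs₁ : s₀ ≤ s₁) (hA : 0 ≤ A) (hδ : 0 < δ) :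
    ∃ C : ℝ, 0 ≤ C ∧ ∀ s e u t h : ℝ, s₀ ≤ s → s ≤ s₁ → e = s + 3 / (n + 2) → 0 ≤ u → 1 ≤ t →
      0 ≤ h → u * (A * t ^ (e / 2 - 1) * h + A * t ^ (e / 2 - 1 / 2) * Real.log t)
        ≤ δ * (t ^ ((s - 2) / 2) * h ^ 2) + δ * (t ^ (e / 2) + u ^ (e * (n + 2) / n)) + C := by
  have hn2 : 0 < n + 2 := by linarith
  have hs1 : 1 < s₀ := by
    refine lt_of_le_of_lt ?_ hs₀
    rw [le_div_iff₀ hn2]; linarith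
  have hρ : 0 < 3 / (n + 2) := by positivity
  set e₁ := s₁ + 3 / (n + 2) with he₁
  have he₁0 : 0 < e₁ := by linarith
  set κ := 1 / (n + 2) / e₁ with hκ
  have hκ0 : 0 < κ := by positivity
  set Q₁ := A ^ 2 / (4 * δ) with hQ₁
  set Q₂ := A * (2 * (n + 2)) with hQ₂
  have hQ₁0 : 0 ≤ Q₁ := by positivity
  have hQ₂0 : 0 ≤ Q₂ := by positivity
  obtain ⟨C, hC0, hC⟩ := exists_young_subcritical (κ := κ) (δ := δ / (Q₁ + Q₂ + 1)) hκ0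
    (by positivity)
  refine ⟨(Q₁ + Q₂) * C, by positivity, fun s e u t h hss₀ hss₁ he hu ht hh => ?_⟩
  have ht0 : 0 < t := by linarith
  have he0 : 1 < e := by linarith
  have hee : e ≤ e₁ := by linarith
  have hm0 : 0 < e * (n + 2) / n := by positivity
  have hκe : κ ≤ 1 / (n + 2) / e := by
    rw [hκ]; gcongr
  have hx : 0 ≤ t ^ (e / 2) := by positivity
  have hy : 0 ≤ u ^ (e * (n + 2) / n) := by positivity
  have htp : ∀ r : ℝ, (t ^ (e / 2)) ^ (2 * r / e) = t ^ r := fun r => by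
    rw [← Real.rpow_mul ht0.le]; congr 1; field_simp
  have hup : ∀ r : ℝ, (u ^ (e * (n + 2) / n)) ^ (r * n / (n + 2) / e) = u ^ r := fun r => by
    rw [← Real.rpow_mul hu]; congr 1; field_simp
  set r := (s - 2) / 2 + 3 / (n + 2) with hr
  have hr0 : 0 ≤ r := by
    have : 2 * n / (n + 2) = 2 - 4 / (n + 2) := by field_simp; ring
    have : 3 / (n + 2) = 3 / 4 * (4 / (n + 2)) := by ring
    rw [hr]; nlinarith
  have y1 := hC _ _ (2 * r / e) (2 * n / (n + 2) / e) hx hy (by positivity) (by positivity) (by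
    have h1 : 2 * r + 2 * n / (n + 2) = e - 1 / (n + 2) := by
      rw [hr, he]; field_simp; ring
    rw [← add_div, h1, sub_div, div_self (by linarith)]
    linarith)
  rw [htp, hup] at y1
  have y2 := hC _ _ (2 * (e / 2 - 1 / 2 + 1 / (2 * (n + 2))) / e) (1 * n / (n + 2) / e) hx hy
    (by
      have : 0 < e / 2 - 1 / 2 := by linarith
      positivity) (by positivity) (by
    have h1 : 2 * (e / 2 - 1 / 2 + 1 / (2 * (n + 2))) + 1 * n / (n + 2) = e - 1 / (n + 2) := by
      field_simp; ring
    rw [← add_div, h1, sub_div, div_self (by linarith)]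
    linarith)
  rw [htp, hup, Real.rpow_one] at y2
  -- `t^(e/2-1)` is split so that half of the weight `t^((s-2)/2)` goes with `h`.
  have t1 : u * (A * t ^ (e / 2 - 1) * h) ≤ δ * (t ^ ((s - 2) / 2) * h ^ 2)
      + Q₁ * (t ^ r * u ^ (2 : ℝ)) := by
    set X := t ^ ((s - 2) / 2 / 2) with hX
    set Y := t ^ (r / 2) with hY
    have hXX : t ^ ((s - 2) / 2) = X ^ 2 := by
      rw [hX, sq, ← Real.rpow_add ht0]; congr 1; ring
    have hYY : t ^ r = Y ^ 2 := by
      rw [hY, sq, ← Real.rpow_add ht0]; congr 1; ring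
    have hXY : t ^ (e / 2 - 1) = X * Y := by
      rw [hX, hY, ← Real.rpow_add ht0]; congr 1; rw [hr, he]; ring
    rw [hXX, hYY, hXY, Real.rpow_two, hQ₁]
    have : δ * (X ^ 2 * h ^ 2) + A ^ 2 / (4 * δ) * (Y ^ 2 * u ^ 2) - u * (A * (X * Y) * h)
        = (2 * δ * (X * h) - A * (Y * u)) ^ 2 / (4 * δ) := by
      field_simp; ring
    have h2 : 0 ≤ (2 * δ * (X * h) - A * (Y * u)) ^ 2 / (4 * δ) := by positivity
    linarith
  have t2 : u * (A * t ^ (e / 2 - 1 / 2) * Real.log t)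
      ≤ Q₂ * (t ^ (e / 2 - 1 / 2 + 1 / (2 * (n + 2))) * u) := by
    have hlog := Real.log_le_rpow_div ht0.le (ε := 1 / (2 * (n + 2))) (by positivity)
    rw [div_div_eq_mul_div, div_one] at hlog
    calc u * (A * t ^ (e / 2 - 1 / 2) * Real.log t)
        ≤ u * (A * t ^ (e / 2 - 1 / 2) * (t ^ (1 / (2 * (n + 2))) * (2 * (n + 2)))) := by gcongr
      _ = _ := by rw [Real.rpow_add ht0, hQ₂]; ring
  have hδ' : (Q₁ + Q₂) * (δ / (Q₁ + Q₂ + 1)) ≤ δ := by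
    rw [mul_div_assoc', div_le_iff₀ (by positivity)]
    nlinarith
  have h3 : Q₁ * (t ^ r * u ^ (2 : ℝ)) ≤
      Q₁ * (δ / (Q₁ + Q₂ + 1) * (t ^ (e / 2) + u ^ (e * (n + 2) / n)) + C) := by gcongr
  have h4 : Q₂ * (t ^ (e / 2 - 1 / 2 + 1 / (2 * (n + 2))) * u) ≤
      Q₂ * (δ / (Q₁ + Q₂ + 1) * (t ^ (e / 2) + u ^ (e * (n + 2) / n)) + C) := by gcongr
  have h5 : (Q₁ + Q₂) * (δ / (Q₁ + Q₂ + 1)) * (t ^ (e / 2) + u ^ (e * (n + 2) / n))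
      ≤ δ * (t ^ (e / 2) + u ^ (e * (n + 2) / n)) := by gcongr
  linarith

/-- Size of the derivative of `truncPow t σ` when `t = |∇u|²`: here `d` stands for a derivative of
`t`, `l` for one of `σ` and `h` for `|u_xx|`. -/
lemma abs_truncPow_deriv_le {t σ d l h L : ℝ} (ht : 1 ≤ t)
    (hd : |d| ≤ 2 * t ^ (1 / 2 : ℝ) * h) (hl : |l| ≤ L) :
    |truncPowT t σ * d + truncPowS t σ * l|
      ≤ 2 * (2 + |σ - 2|) * t ^ (σ - 1 / 2) * h + L * t ^ σ * Real.log t := by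
  have ht0 : 0 < t := by linarith
  have hlog := Real.log_nonneg ht
  refine (abs_add_le _ _).trans (add_le_add ?_ ?_)
  · rw [abs_mul]
    calc |truncPowT t σ| * |d| ≤ ((2 + |σ - 2|) * t ^ (σ - 1)) * (2 * t ^ (1 / 2 : ℝ) * h) :=
          mul_le_mul (abs_truncPowT_le ht σ) hd (abs_nonneg _) (by positivity)
      _ = 2 * (2 + |σ - 2|) * (t ^ (σ - 1) * t ^ (1 / 2 : ℝ)) * h := by ring
      _ = _ := by
        rw [← Real.rpow_add ht0]; congr 3; ring
  · rw [abs_mul]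
    calc |truncPowS t σ| * |l| ≤ (t ^ σ * Real.log t) * L :=
          mul_le_mul (abs_truncPowS_le ht σ) hl (abs_nonneg _) (by positivity)
      _ = _ := by ring

section

variable {N : ℕ} {Ω : Set (EuclideanSpace ℝ (Fin N))} {u : EuclideanSpace ℝ (Fin N) → ℝ}
  {Du : EuclideanSpace ℝ (Fin N) → EuclideanSpace ℝ (Fin N)}
  {D2u : Fin N → Fin N → EuclideanSpace ℝ (Fin N) → ℝ}

lemma hessSq_nonneg (x : EuclideanSpace ℝ (Fin N)) : 0 ≤ hessSq D2u x :=
  Finset.sum_nonneg fun _ _ => Finset.sum_nonneg fun _ _ => sq_nonneg _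

lemma IsH2.integrableOn_hessSq (hu : IsH2 Ω u Du D2u) : IntegrableOn (hessSq D2u) Ω :=
  integrable_finsetSum _ fun i _ => integrable_finsetSum _ fun j _ => (hu.memLp_hess i j).integrable_sq

lemma sum_mul_self_eq (ξ : EuclideanSpace ℝ (Fin N)) : ∑ i, ξ i * ξ i = ‖ξ‖ ^ 2 := by
  rw [EuclideanSpace.real_norm_sq_eq]
  simp only [sq]

lemma abs_hess_le (i j : Fin N) (x : EuclideanSpace ℝ (Fin N)) :
    |D2u i j x| ≤ √(hessSq D2u x) := by
  refine Real.abs_le_sqrt ?_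
  calc D2u i j x ^ 2 ≤ ∑ j, D2u i j x ^ 2 :=
        Finset.single_le_sum (f := fun j => D2u i j x ^ 2) (fun _ _ => sq_nonneg _)
          (Finset.mem_univ j)
    _ ≤ _ := Finset.single_le_sum (f := fun i => ∑ j, D2u i j x ^ 2)
          (fun _ _ => Finset.sum_nonneg fun _ _ => sq_nonneg _) (Finset.mem_univ i)

lemma abs_deriv_normSq_le (ξ x : EuclideanSpace ℝ (Fin N)) (j : Fin N) :
    |∑ i, (ξ i * D2u i j x + ξ i * D2u i j x)| ≤ 2 * ‖ξ‖ * √(hessSq D2u x) := by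
  have h1 : ∑ i, (ξ i * D2u i j x + ξ i * D2u i j x) = 2 * ∑ i, ξ i * D2u i j x := by
    rw [Finset.mul_sum]
    exact Finset.sum_congr rfl fun i _ => by ring
  have h2 : |∑ i, ξ i * D2u i j x| ≤ √(‖ξ‖ ^ 2 * hessSq D2u x) := by
    refine Real.abs_le_sqrt ((Finset.sum_mul_sq_le_sq_mul_sq _ _ _).trans ?_)
    rw [EuclideanSpace.real_norm_sq_eq]
    refine mul_le_mul_of_nonneg_left ?_ (Finset.sum_nonneg fun _ _ => sq_nonneg _)
    exact Finset.sum_le_sum fun i _ => Finset.single_le_sum (f := fun j => D2u i j x ^ 2)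
      (fun _ _ => sq_nonneg _) (Finset.mem_univ j)
  rw [Real.sqrt_mul (sq_nonneg _), Real.sqrt_sq (norm_nonneg _)] at h2
  rw [h1, abs_mul, abs_two, mul_assoc]
  exact mul_le_mul_of_nonneg_left h2 zero_le_two

lemma IsH2.weakDiff_grad (hu : IsH2 Ω u Du D2u) (hu1 : IsC1Closure Ω u Du)
    (hb : Bornology.IsBounded Ω) (i : Fin N) : WeakDiff Ω (fun x => Du x i) (D2u i) where
  aesm := (hu.memLp_grad i).aestronglyMeasurable
  bdd := by
    obtain ⟨C, -, hC⟩ := hu1.exists_bound hb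
    exact ⟨C, fun x hx => (PiLp.norm_apply_le (Du x) i).trans (hC x (subset_closure hx))⟩
  int j := by
    have : IsFiniteMeasure (volume.restrict Ω) := isFiniteMeasure_restrict.2 hb.measure_lt_top.ne
    exact (hu.memLp_hess i j).integrable one_le_two
  weak := hu.weak_hess i

lemma IsH2.weakDiff_normSq (hu : IsH2 Ω u Du D2u) (hu1 : IsC1Closure Ω u Du)
    (hΩ : IsOpen Ω) (hb : Bornology.IsBounded Ω) :
    WeakDiff Ω (fun x => ‖Du x‖ ^ 2)
      (fun j x => ∑ i, (Du x i * D2u i j x + Du x i * D2u i j x)) := by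
  have h := WeakDiff.sum hΩ hb.measure_lt_top.ne Finset.univ fun i _ =>
    (hu.weakDiff_grad hu1 hb i).mul hΩ hb.measure_lt_top.ne (hu.weakDiff_grad hu1 hb i)
  simpa only [sum_mul_self_eq] using h

lemma norm_eq_sq_rpow (ξ : EuclideanSpace ℝ (Fin N)) : ‖ξ‖ = (‖ξ‖ ^ 2) ^ (1 / 2 : ℝ) := by
  rw [← Real.sqrt_eq_rpow, Real.sqrt_sq (norm_nonneg _)]

lemma norm_rpow_eq (ξ : EuclideanSpace ℝ (Fin N)) (e : ℝ) : ‖ξ‖ ^ e = (‖ξ‖ ^ 2) ^ (e / 2) := by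
  rw [← Real.rpow_two, ← Real.rpow_mul (norm_nonneg _)]
  congr 1; ring

/-- The derivative `∂_i W_i` of the components of the field `W = truncPow (|∇u|²) σ ∇u`, where the
function `dσ i` stands for `∂_i σ`. -/
noncomputable def fieldDeriv (Du : EuclideanSpace ℝ (Fin N) → EuclideanSpace ℝ (Fin N))
    (D2u : Fin N → Fin N → EuclideanSpace ℝ (Fin N) → ℝ) (σ : EuclideanSpace ℝ (Fin N) → ℝ)
    (dσ : Fin N → EuclideanSpace ℝ (Fin N) → ℝ) (i : Fin N) (x : EuclideanSpace ℝ (Fin N)) : ℝ :=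
  Du x i * (truncPowT (‖Du x‖ ^ 2) (σ x) * ∑ k, (Du x k * D2u k i x + Du x k * D2u k i x) +
    truncPowS (‖Du x‖ ^ 2) (σ x) * dσ i x) + truncPow (‖Du x‖ ^ 2) (σ x) * D2u i i x

section fieldDeriv

variable {σ : EuclideanSpace ℝ (Fin N) → ℝ} {dσ : Fin N → EuclideanSpace ℝ (Fin N) → ℝ} {i : Fin N}
  {x : EuclideanSpace ℝ (Fin N)}

lemma fieldDeriv_of_le (hx : ‖Du x‖ ^ 2 ≤ 1) : fieldDeriv Du D2u σ dσ i x = 0 := by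
  rw [fieldDeriv, truncPowT_of_le hx, truncPowS_of_le hx, truncPow_of_le hx]
  ring

lemma abs_fieldDeriv_le {L S : ℝ} (hσ₀ : -1 ≤ σ x) (hσ₁ : σ x ≤ S) (hL : |dσ i x| ≤ L)
    (h1 : 1 ≤ ‖Du x‖ ^ 2) : |fieldDeriv Du D2u σ dσ i x| ≤
      (13 + 2 * S + L) * (‖Du x‖ ^ 2) ^ (σ x) * √(hessSq D2u x)
        + (13 + 2 * S + L) * (‖Du x‖ ^ 2) ^ (σ x + 1 / 2) * Real.log (‖Du x‖ ^ 2) := by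
  have hd := abs_deriv_normSq_le (D2u := D2u) (Du x) x i
  rw [norm_eq_sq_rpow (Du x)] at hd
  have hg := abs_truncPow_deriv_le (σ := σ x) h1 hd hL
  have hDi : |Du x i| ≤ (‖Du x‖ ^ 2) ^ (1 / 2 : ℝ) := by
    rw [← norm_eq_sq_rpow]; exact PiLp.norm_apply_le (Du x) i
  rw [fieldDeriv]
  set t := ‖Du x‖ ^ 2
  have ht0 : 0 < t := by linarith
  have hlog := Real.log_nonneg h1
  have hL0 : 0 ≤ L := (abs_nonneg _).trans hL
  have hσ2 : |σ x - 2| ≤ 4 + S := abs_le.2 ⟨by linarith, by linarith⟩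
  have hHx : 0 ≤ √(hessSq D2u x) := Real.sqrt_nonneg _
  have a1 : t ^ (1 / 2 : ℝ) * t ^ (σ x - 1 / 2) = t ^ (σ x) := by
    rw [← Real.rpow_add ht0]; congr 1; ring
  have a2 : t ^ (1 / 2 : ℝ) * t ^ (σ x) = t ^ (σ x + 1 / 2) := by
    rw [← Real.rpow_add ht0]; congr 1; ring
  have b1 : |truncPow t (σ x) * D2u i i x| ≤ t ^ (σ x) * √(hessSq D2u x) := by
    rw [abs_mul, abs_of_nonneg (truncPow_nonneg _ _)]
    exact mul_le_mul (truncPow_le h1 _) (abs_hess_le i i x) (abs_nonneg _) (by positivity)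
  refine ((abs_add_le _ _).trans (add_le_add ?_ b1)).trans
    (b := t ^ (1 / 2 : ℝ) * (2 * (2 + |σ x - 2|) * t ^ (σ x - 1 / 2) * √(hessSq D2u x)
      + L * t ^ (σ x) * Real.log t) + t ^ (σ x) * √(hessSq D2u x)) ?_
  · rw [abs_mul]
    exact mul_le_mul hDi hg (abs_nonneg _) (by positivity)
  · calc _ = (2 * (2 + |σ x - 2|) + 1) * t ^ (σ x) * √(hessSq D2u x)
          + L * t ^ (σ x + 1 / 2) * Real.log t := by
          linear_combination (2 * (2 + |σ x - 2|) * √(hessSq D2u x)) * a1 + L * Real.log t * a2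
      _ ≤ _ := by
          have c1 : 2 * (2 + |σ x - 2|) + 1 ≤ 13 + 2 * S + L := by linarith
          have c2 : L ≤ 13 + 2 * S + L := by linarith
          gcongr

lemma memLp_sqrt_hessSq (hu : IsH2 Ω u Du D2u) :
    MemLp (fun x => √(hessSq D2u x)) 2 (volume.restrict Ω) := by
  have hsum : IntegrableOn (fun x => hessSq D2u x) Ω := hu.integrableOn_hessSq
  have hm : AEStronglyMeasurable (fun x => √(hessSq D2u x)) (volume.restrict Ω) :=
    hsum.aestronglyMeasurable.aemeasurable.sqrt.aestronglyMeasurable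
  rw [memLp_two_iff_integrable_sq hm]
  simp only [Real.sq_sqrt (hessSq_nonneg _)]
  exact hsum

lemma memLp_fieldDeriv (hΩ : IsOpen Ω) (hb : Bornology.IsBounded Ω) (hu : IsH2 Ω u Du D2u)
    (hu1 : IsC1Closure Ω u Du) {L S : ℝ} (hσ₀ : ∀ x ∈ Ω, -1 ≤ σ x) (hσ₁ : ∀ x ∈ Ω, σ x ≤ S)
    (hL : ∀ x, |dσ i x| ≤ L)
    (hm : AEStronglyMeasurable (fieldDeriv Du D2u σ dσ i) (volume.restrict Ω)) :
    MemLp (fieldDeriv Du D2u σ dσ i) 2 (volume.restrict Ω) := by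
  have : IsFiniteMeasure (volume.restrict Ω) := isFiniteMeasure_restrict.2 hb.measure_lt_top.ne
  obtain ⟨R, -, hRD⟩ := hu1.exists_bound hb
  set A : ℝ := 13 + 2 * S + L with hA
  set T : ℝ := max R 1 ^ 2
  have hT1 : 1 ≤ T := one_le_pow₀ (le_max_right _ _)
  set K : ℝ := A * T ^ (S + 2) + A * T ^ (S + 2) * T with hK
  have hbound : MemLp (fun x => K * (√(hessSq D2u x) + 1)) 2 (volume.restrict Ω) :=
    ((memLp_sqrt_hessSq hu).add (memLp_const 1)).const_mul K
  refine hbound.mono' hm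
    ((ae_restrict_iff' hΩ.measurableSet).2 (Eventually.of_forall fun x hx => ?_))
  rw [Real.norm_eq_abs]
  have hA0 : 0 ≤ A := by
    have := (abs_nonneg _).trans (hL x)
    have := hσ₀ x hx
    have := hσ₁ x hx
    linarith
  have hHx : 0 ≤ √(hessSq D2u x) := Real.sqrt_nonneg _
  rcases le_total (‖Du x‖ ^ 2) 1 with h1 | h1
  · rw [fieldDeriv_of_le h1, abs_zero]; positivity
  have htT : ‖Du x‖ ^ 2 ≤ T :=
    pow_le_pow_left₀ (norm_nonneg _) ((hRD x (subset_closure hx)).trans (le_max_left _ _)) 2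
  have hs0 := hσ₀ x hx
  have hs1 := hσ₁ x hx
  refine (abs_fieldDeriv_le hs0 hs1 (hL x) h1).trans ?_
  rw [← hA]
  set t := ‖Du x‖ ^ 2
  have ht0 : 0 < t := by linarith
  have hpow : ∀ r : ℝ, r ≤ S + 2 → t ^ r ≤ T ^ (S + 2) := fun r hr =>
    (Real.rpow_le_rpow_of_exponent_le h1 hr).trans (Real.rpow_le_rpow ht0.le htT (by linarith))
  have p1 := hpow (σ x) (by linarith)
  have p2 := hpow (σ x + 1 / 2) (by linarith)
  have p3 : Real.log t ≤ T := (Real.log_le_self ht0.le).trans htT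
  have hlog := Real.log_nonneg h1
  have q1 : A * t ^ (σ x) * √(hessSq D2u x) ≤ A * T ^ (S + 2) * √(hessSq D2u x) := by gcongr
  have q2 : A * t ^ (σ x + 1 / 2) * Real.log t ≤ A * T ^ (S + 2) * T := by gcongr
  have q3 : 0 ≤ A * T ^ (S + 2) * T * √(hessSq D2u x) := by positivity
  have q4 : 0 ≤ A * T ^ (S + 2) := by positivity
  rw [hK]
  linarith

end fieldDeriv

/-- Interpolation: since `u` is bounded in `L²`, the integral of `|∇u|^e` with the exponent
`e = s + 3/(N+2)` is controlled by an arbitrarily small multiple of `∫ |∇u|^(s-2) |u_xx|²`, up to a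
constant; the function `Φ` dominates the latter integrand where `|∇u| ≥ 1`. One integrates `|∇u|^e = |∇u|^(e-2) ∇u · ∇u` by parts, applies Young's inequality, and
absorbs the powers of `u` with the embedding. -/
lemma exists_interpolation (hN : 2 ≤ N) (hΩ : IsOpen Ω) (hb : Bornology.IsBounded Ω) {s₀ s₁ δ : ℝ}
    (hs₀ : 2 * (N : ℝ) / ((N : ℝ) + 2) < s₀) (hs₁ : s₀ ≤ s₁) (L : ℝ≥0) (M : ℝ) (hδ : 0 < δ) :
    ∃ C : ℝ, 0 ≤ C ∧ ∀ {s u Φ : EuclideanSpace ℝ (Fin N) → ℝ}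
      {Du : EuclideanSpace ℝ (Fin N) → EuclideanSpace ℝ (Fin N)}
      {D2u : Fin N → Fin N → EuclideanSpace ℝ (Fin N) → ℝ},
      LipschitzWith L s → (∀ x ∈ Ω, s₀ ≤ s x) → (∀ x ∈ Ω, s x ≤ s₁) → IsC1Closure Ω u Du →
      IsH2 Ω u Du D2u → IsH10 Ω u Du → eLpNorm u 2 (volume.restrict Ω) ≤ ENNReal.ofReal M →
      IntegrableOn Φ Ω → (∀ x ∈ Ω, 0 ≤ Φ x) →
      (∀ x ∈ Ω, 1 ≤ ‖Du x‖ ^ 2 → (‖Du x‖ ^ 2) ^ ((s x - 2) / 2) * hessSq D2u x ≤ Φ x) →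
      ∫ x in Ω, ‖Du x‖ ^ (s x + 3 / ((N : ℝ) + 2)) ≤ δ * (∫ x in Ω, Φ x) + C := by
  have hΩm := hΩ.measurableSet
  have hfin : volume Ω ≠ ⊤ := hb.measure_lt_top.ne
  have hn : (2 : ℝ) ≤ N := by exact_mod_cast hN
  have hn0 : (0 : ℝ) < N := by linarith
  have hs1 : 1 < s₀ := by
    refine lt_of_le_of_lt ?_ hs₀
    rw [le_div_iff₀ (by positivity)]; linarith
  set ρ : ℝ := 3 / ((N : ℝ) + 2) with hρ
  have hρ0 : 0 < ρ := by positivity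
  set e₁ : ℝ := s₁ + ρ with he₁
  have he₁0 : 0 < e₁ := by linarith
  obtain ⟨E, hE0, hE⟩ := exists_embedding (e₀ := s₀ + ρ) (e₁ := e₁) hN hΩ hb (by linarith)
    (by linarith) L M
  set δ' : ℝ := min (δ / (8 * N)) (1 / (8 * N * (1 + E))) with hδ'
  have hδ'0 : 0 < δ' := by positivity
  set A : ℝ := 13 + e₁ + L with hA
  have hA0 : 0 ≤ A := by positivity
  obtain ⟨P, hP0, hP⟩ := exists_interpolation_pointwise hn hs₀ hs₁ hA0 hδ'0
  set V : ℝ := volume.real Ω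
  have hV : 0 ≤ V := measureReal_nonneg
  refine ⟨2 * (2 ^ e₁ * V + 4 * N * (δ' * E + P * V)), by positivity, ?_⟩
  intro s u Φ Du D2u hLs hs hs' hu hH2 h0 huM hΦi hΦ0 hΦ
  set e : EuclideanSpace ℝ (Fin N) → ℝ := fun x => s x + ρ with he
  set σ : EuclideanSpace ℝ (Fin N) → ℝ := fun x => e x / 2 - 1 with hσ
  have hLe : LipschitzWith L e := LipschitzWith.of_dist_le_mul fun x y => by
    simpa [he] using hLs.dist_le_mul x y
  have hLσ : LipschitzWith L σ := LipschitzWith.of_dist_le_mul fun x y => by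
    have h1 := hLe.dist_le_mul x y
    rw [Real.dist_eq] at h1 ⊢
    have h2 : σ x - σ y = (e x - e y) / 2 := by simp only [hσ]; ring
    rw [h2, abs_div, abs_two]
    have := abs_nonneg (e x - e y)
    linarith
  have hee₀ : ∀ x ∈ Ω, s₀ + ρ ≤ e x := fun x hx => by simpa [he] using hs x hx
  have hee₁ : ∀ x ∈ Ω, e x ≤ e₁ := fun x hx => by simpa [he, he₁] using hs' x hx
  have hemb := hE hLe hee₀ hee₁ hu hH2.memLp hH2.memLp_grad h0 huM
  have ht := hH2.weakDiff_normSq hu hΩ hb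
  have hT := ht.truncPow hΩ hfin (weakDiff_of_lipschitzWith hΩ hb hLσ)
  have hW := fun i => hT.mul hΩ hfin (hH2.weakDiff_grad hu hb i)
  have hσ₀ : ∀ x ∈ Ω, -1 ≤ σ x := fun x hx => by
    have := hee₀ x hx
    simp only [hσ]; linarith
  have hσ₁ : ∀ x ∈ Ω, σ x ≤ e₁ / 2 := fun x hx => by
    have := hee₁ x hx
    simp only [hσ]; linarith
  set G : Fin N → EuclideanSpace ℝ (Fin N) → ℝ := fieldDeriv Du D2u σ
    (fun j x => lineDeriv ℝ σ x (EuclideanSpace.single j 1)) with hG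
  have hGle : ∀ i, ∀ x ∈ Ω, 1 ≤ ‖Du x‖ ^ 2 → |G i x| ≤
      A * (‖Du x‖ ^ 2) ^ (e x / 2 - 1) * √(hessSq D2u x)
        + A * (‖Du x‖ ^ 2) ^ (e x / 2 - 1 / 2) * Real.log (‖Du x‖ ^ 2) := fun i x hx h1 => by
    have h := abs_fieldDeriv_le (D2u := D2u)
      (dσ := fun j x => lineDeriv ℝ σ x (EuclideanSpace.single j 1)) (hσ₀ x hx) (hσ₁ x hx)
      (abs_lineDeriv_le hLσ x i) h1
    rwa [show σ x + 1 / 2 = e x / 2 - 1 / 2 by simp only [hσ]; ring,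
      show 13 + 2 * (e₁ / 2) + (L : ℝ) = A by rw [hA]; ring] at h
  obtain ⟨R, hRu, hRD⟩ := hu.exists_bound hb
  have hGL2 : ∀ i, MemLp (G i) 2 (volume.restrict Ω) := fun i =>
    memLp_fieldDeriv hΩ hb hH2 hu hσ₀ hσ₁ (fun x => abs_lineDeriv_le hLσ x i)
      ((hW i).int i).aestronglyMeasurable
  have hIBP : ∑ i, ∫ x in Ω, Du x i * (truncPow (‖Du x‖ ^ 2) (σ x) * Du x i)
      = - ∑ i, ∫ x in Ω, u x * G i x :=
    integral_field_mul_grad (g := fun i j x => Du x i * (truncPowT (‖Du x‖ ^ 2) (σ x) *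
      ∑ k, (Du x k * D2u k j x + Du x k * D2u k j x) + truncPowS (‖Du x‖ ^ 2) (σ x) *
      lineDeriv ℝ σ x (EuclideanSpace.single j 1)) + truncPow (‖Du x‖ ^ 2) (σ x) * D2u i j x)
      hb hΩm hH2.memLp hH2.memLp_grad h0 hW hGL2
  have hDm : AEStronglyMeasurable Du (volume.restrict Ω) :=
    (hu.continuousOn_grad.mono subset_closure).aestronglyMeasurable hΩm
  have hem : AEStronglyMeasurable e (volume.restrict Ω) := hLe.continuous.aestronglyMeasurable
  have hm0 : ∀ x ∈ Ω, 0 ≤ e x * ((N : ℝ) + 2) / N := fun x hx => by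
    have := hee₀ x hx
    have : 0 < e x := by linarith
    positivity
  have hm1 : ∀ x ∈ Ω, e x * ((N : ℝ) + 2) / N ≤ 2 * e₁ := fun x hx => by
    rw [div_le_iff₀ hn0]
    have := hee₀ x hx
    have := hee₁ x hx
    nlinarith
  have hum : IntegrableOn (fun x => |u x| ^ (e x * ((N : ℝ) + 2) / N)) Ω :=
    integrableOn_rpow hΩm hfin hH2.memLp.aestronglyMeasurable.norm
      ((hem.mul_const _).mul_const _) (fun x _ => abs_nonneg _)
      (fun x hx => hRu x (subset_closure hx)) hm0 hm1
  have hDe : IntegrableOn (fun x => ‖Du x‖ ^ e x) Ω :=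
    integrableOn_rpow hΩm hfin hDm.norm hem (fun x _ => norm_nonneg _)
      (fun x hx => hRD x (subset_closure hx)) (fun x hx => by have := hee₀ x hx; linarith) hee₁
  have hone : IntegrableOn (fun _ : EuclideanSpace ℝ (Fin N) => (1 : ℝ)) Ω :=
    integrableOn_const hfin
  have hint1 : ∫ _ in Ω, (1 : ℝ) = V := by simp [V]
  set Y := ∫ x in Ω, |u x| ^ (e x * ((N : ℝ) + 2) / N) with hY
  set X := ∫ x in Ω, ‖Du x‖ ^ e x with hX
  set Z := ∫ x in Ω, Φ x with hZ
  have hX0 : 0 ≤ X := integral_nonneg fun x => Real.rpow_nonneg (norm_nonneg _) _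
  have hZ0 : 0 ≤ Z := setIntegral_nonneg hΩm hΦ0
  have hWi : ∀ i, IntegrableOn
      (fun x => Du x i * (truncPow (‖Du x‖ ^ 2) (σ x) * Du x i)) Ω := fun i =>
    ((hH2.weakDiff_grad hu hb i).mul hΩ hfin (hT.mul hΩ hfin (hH2.weakDiff_grad hu hb i))).integrableOn
      hfin hΩm
  -- For `|∇u|² ≥ 2` the power is comparable with its truncation, which is `W · ∇u`.
  have hXle : X ≤ 2 ^ e₁ * V
      + 4 * ∑ i, ∫ x in Ω, Du x i * (truncPow (‖Du x‖ ^ 2) (σ x) * Du x i) := by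
    rw [← integral_finsetSum _ fun i _ => hWi i]
    have hsi : IntegrableOn (fun x => ∑ i, Du x i * (truncPow (‖Du x‖ ^ 2) (σ x) * Du x i)) Ω :=
      integrable_finsetSum _ fun i _ => hWi i
    have i1 : IntegrableOn (fun _ : EuclideanSpace ℝ (Fin N) => 2 ^ e₁ * (1 : ℝ)) Ω :=
      hone.const_mul _
    have i2 : IntegrableOn
        (fun x => 4 * ∑ i, Du x i * (truncPow (‖Du x‖ ^ 2) (σ x) * Du x i)) Ω := hsi.const_mul 4
    refine (setIntegral_mono_on hDe (i1.add i2) hΩm fun x hx => ?_).trans_eq ?_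
    · have hsx : ∑ i, Du x i * (truncPow (‖Du x‖ ^ 2) (σ x) * Du x i)
          = truncPow (‖Du x‖ ^ 2) (e x / 2) := by
        rw [show e x / 2 = σ x + 1 by simp only [hσ]; ring, ← mul_truncPow]
        nth_rewrite 2 [← sum_mul_self_eq]
        rw [Finset.sum_mul]
        exact Finset.sum_congr rfl fun i _ => by ring
      change _ ≤ (2 : ℝ) ^ e₁ * 1 + 4 * ∑ i, Du x i * (truncPow (‖Du x‖ ^ 2) (σ x) * Du x i)
      rw [hsx, mul_one, norm_rpow_eq]
      have h2e : (0 : ℝ) < 2 ^ e₁ := by positivity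
      have hnn := truncPow_nonneg (‖Du x‖ ^ 2) (e x / 2)
      rcases le_total 2 (‖Du x‖ ^ 2) with h2 | h2
      · have := rpow_le_truncPow h2 (e x / 2)
        linarith
      · have h3 := hee₀ x hx
        have h4 := hee₁ x hx
        have : (‖Du x‖ ^ 2) ^ (e x / 2) ≤ 2 ^ e₁ :=
          (Real.rpow_le_rpow (by positivity) h2 (by linarith)).trans
            (Real.rpow_le_rpow_of_exponent_le one_le_two (by linarith))
        linarith
    · rw [integral_add' i1 i2, integral_const_mul, integral_const_mul, hint1]
  have hGi : ∀ i, - ∫ x in Ω, u x * G i x ≤ δ' * Z + δ' * (X + Y) + P * V := by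
    intro i
    have i1 : IntegrableOn (fun x => δ' * Φ x) Ω := hΦi.const_mul _
    have i2 : IntegrableOn (fun x => ‖Du x‖ ^ e x + |u x| ^ (e x * ((N : ℝ) + 2) / N)) Ω :=
      hDe.add hum
    have i3 : IntegrableOn
        (fun x => δ' * (‖Du x‖ ^ e x + |u x| ^ (e x * ((N : ℝ) + 2) / N))) Ω := i2.const_mul _
    have i4 : IntegrableOn (fun _ : EuclideanSpace ℝ (Fin N) => P * (1 : ℝ)) Ω := hone.const_mul _
    have i13 : IntegrableOn (fun x => δ' * Φ x
        + δ' * (‖Du x‖ ^ e x + |u x| ^ (e x * ((N : ℝ) + 2) / N))) Ω := i1.add i3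
    have i134 : IntegrableOn (fun x => δ' * Φ x
        + δ' * (‖Du x‖ ^ e x + |u x| ^ (e x * ((N : ℝ) + 2) / N)) + P * 1) Ω := i13.add i4
    rw [← integral_neg]
    refine (setIntegral_mono_on (hH2.memLp.integrable_mul (hGL2 i)).neg i134 hΩm
      fun x hx => ?_).trans_eq ?_
    · refine (neg_le_abs _).trans ?_
      have hnn : 0 ≤ ‖Du x‖ ^ e x + |u x| ^ (e x * ((N : ℝ) + 2) / N) := by positivity
      have hΦx := hΦ0 x hx
      change |u x * G i x| ≤ _
      rcases le_total (‖Du x‖ ^ 2) 1 with h1 | h1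
      · rw [hG, fieldDeriv_of_le h1, mul_zero, abs_zero]; positivity
      rw [abs_mul]
      refine (mul_le_mul_of_nonneg_left (hGle i x hx h1) (abs_nonneg _)).trans ?_
      refine (hP (s x) (e x) |u x| (‖Du x‖ ^ 2) _ (hs x hx) (hs' x hx) rfl (abs_nonneg _) h1
        (Real.sqrt_nonneg _)).trans ?_
      rw [← norm_rpow_eq _ (e x), mul_one, Real.sq_sqrt (hessSq_nonneg _)]
      have := mul_le_mul_of_nonneg_left (hΦ x hx h1) hδ'0.le
      linarith
    · rw [integral_add i13 i4, integral_add i1 i3, integral_const_mul, integral_const_mul,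
        integral_const_mul, hint1, integral_add hDe hum]
  have hsumG : - ∑ i, ∫ x in Ω, u x * G i x ≤ N * (δ' * Z + δ' * (X + Y) + P * V) := by
    rw [← Finset.sum_neg_distrib]
    refine (Finset.sum_le_sum fun i _ => hGi i).trans_eq ?_
    rw [Finset.sum_const, Finset.card_univ, Fintype.card_fin, nsmul_eq_mul]
  have hmain : X ≤ 2 ^ e₁ * V + 4 * (N * (δ' * Z + δ' * (X + (E * X + E)) + P * V)) := by
    refine hXle.trans ?_
    rw [hIBP]
    refine add_le_add le_rfl (mul_le_mul_of_nonneg_left (hsumG.trans ?_) (by norm_num))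
    gcongr
  -- Absorption of `X` on the right-hand side, by the choice of `δ'`.
  have hd1 : 4 * N * δ' ≤ δ / 2 := by
    have : δ' ≤ δ / (8 * N) := min_le_left _ _
    rw [le_div_iff₀ (by positivity)] at this
    linarith
  have hd2 : 4 * N * δ' * (1 + E) ≤ 1 / 2 := by
    have : δ' ≤ 1 / (8 * N * (1 + E)) := min_le_right _ _
    rw [le_div_iff₀ (by positivity)] at this
    linarith
  have k1 : 4 * N * δ' * Z ≤ δ / 2 * Z := by gcongr
  have k2 : 4 * N * δ' * (1 + E) * X ≤ 1 / 2 * X := by gcongr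
  have h2V : 0 ≤ 2 ^ e₁ * V := by positivity
  nlinarith

end

/-! ### The boundary estimate -/

section

variable {N : ℕ} {Ω : Set (EuclideanSpace ℝ (Fin N))}

lemma aestronglyMeasurable_surfaceMeasure {f : EuclideanSpace ℝ (Fin N) → ℝ}
    (hf : ContinuousOn f (closure Ω)) : AEStronglyMeasurable f (surfaceMeasure Ω) :=
  (hf.mono frontier_subset_closure).aestronglyMeasurable isClosed_frontier.measurableSet

lemma exists_integral_surfaceMeasure_le (hΩ : IsOpen Ω) (hb : Bornology.IsBounded Ω)
    (hC2 : HasC2Boundary Ω) :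
    ∃ C : ℝ, 0 ≤ C ∧ ∀ (f : EuclideanSpace ℝ (Fin N) → ℝ)
      (g : Fin N → EuclideanSpace ℝ (Fin N) → ℝ), ContinuousOn f (closure Ω) → WeakDiff Ω f g →
      ∫ x, |f x| ∂(surfaceMeasure Ω) ≤ C * ((∫ x in Ω, |f x|) + ∑ j, ∫ x in Ω, |g j x|) := by
  obtain ⟨C, hC⟩ := exists_trace hΩ hb hC2
  refine ⟨C, C.2, fun f g hf hfg => ?_⟩
  have hfi := hfg.integrableOn hb.measure_lt_top.ne hΩ.measurableSet
  have e0 : ∫ x, |f x| ∂(surfaceMeasure Ω) = (∫⁻ x, ‖f x‖ₑ ∂(surfaceMeasure Ω)).toReal :=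
    integral_norm_eq_lintegral_enorm (aestronglyMeasurable_surfaceMeasure hf)
  have e1 : ∫ x in Ω, |f x| = (∫⁻ x in Ω, ‖f x‖ₑ).toReal :=
    integral_norm_eq_lintegral_enorm hfi.aestronglyMeasurable
  have e2 : ∀ j, ∫ x in Ω, |g j x| = (∫⁻ x in Ω, ‖g j x‖ₑ).toReal := fun j =>
    integral_norm_eq_lintegral_enorm (hfg.int j).aestronglyMeasurable
  have ht : ∀ j ∈ Finset.univ, ∫⁻ x in Ω, ‖g j x‖ₑ ≠ ⊤ := fun j _ => (hfg.int j).2.ne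
  have ht1 : ∫⁻ x in Ω, ‖f x‖ₑ ≠ ⊤ := hfi.2.ne
  simp only [e0, e1, e2]
  rw [← ENNReal.toReal_sum ht, ← ENNReal.toReal_add ht1 (ENNReal.sum_ne_top.2 ht),
    ← ENNReal.coe_toReal, ← ENNReal.toReal_mul]
  exact ENNReal.toReal_mono (ENNReal.mul_ne_top ENNReal.coe_ne_top
    (ENNReal.add_ne_top.2 ⟨ht1, ENNReal.sum_ne_top.2 ht⟩)) (hC f g hf hfg)

lemma isFiniteMeasure_surfaceMeasure (hΩ : IsOpen Ω) (hb : Bornology.IsBounded Ω)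
    (hC2 : HasC2Boundary Ω) : IsFiniteMeasure (surfaceMeasure Ω) := by
  obtain ⟨C, hC⟩ := exists_trace hΩ hb hC2
  have h1 : LipschitzWith 0 fun _ : EuclideanSpace ℝ (Fin N) => (1 : ℝ) := LipschitzWith.const 1
  have hw := weakDiff_of_lipschitzWith hΩ hb h1
  have h := hC _ _ continuousOn_const hw
  rw [isFiniteMeasure_iff]
  have e : ∫⁻ _, ‖(1 : ℝ)‖ₑ ∂(surfaceMeasure Ω) = surfaceMeasure Ω Set.univ := by simp
  rw [← e]
  refine h.trans_lt (ENNReal.mul_lt_top ENNReal.coe_lt_top (ENNReal.add_lt_top.2 ⟨?_, ?_⟩))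
  · exact (hw.integrableOn hb.measure_lt_top.ne hΩ.measurableSet).2
  · exact ENNReal.sum_lt_top.2 fun j _ => (hw.int j).2

lemma integrable_surfaceMeasure [IsFiniteMeasure (surfaceMeasure Ω)] (hb : Bornology.IsBounded Ω)
    {f : EuclideanSpace ℝ (Fin N) → ℝ} (hf : ContinuousOn f (closure Ω)) :
    Integrable f (surfaceMeasure Ω) := by
  obtain ⟨C, hC⟩ := hb.isCompact_closure.exists_bound_of_continuousOn hf
  exact Integrable.of_bound (aestronglyMeasurable_surfaceMeasure hf) C
    ((ae_restrict_iff' isClosed_frontier.measurableSet).2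
      (Eventually.of_forall fun x hx => hC x (frontier_subset_closure hx)))

end

lemma continuous_truncPow : Continuous fun z : ℝ × ℝ => truncPow z.1 z.2 :=
  continuous_iff_continuousAt.2 fun z => (hasFDerivAt_truncPow z.1 z.2).continuousAt

/-- Pointwise bound for a derivative of `a * truncPow t (p/2)`, where `t = |∇u|²`. The symbols `d`,
`da`, `dp`, `h` stand for derivatives of `t`, `a`, `p/2` and for `|u_xx|`. -/
lemma exists_weighted_gradient_bound {P A L η δ : ℝ} (hP : 0 ≤ P) (hA : 0 ≤ A) (hL : 0 ≤ L)
    (hη : 0 < η) (hδ : 0 < δ) :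
    ∃ C : ℝ, 0 ≤ C ∧ ∀ p e a t h d da dp : ℝ, 0 ≤ p → p ≤ P → 0 ≤ a → a ≤ A → 1 ≤ t →
      |d| ≤ 2 * t ^ (1 / 2 : ℝ) * h → |da| ≤ L → |dp| ≤ L → p + 2 * η ≤ e →
      |truncPow t (p / 2) * da + a * (truncPowT t (p / 2) * d + truncPowS t (p / 2) * dp)|
        ≤ δ * (a * t ^ ((p - 2) / 2) * h ^ 2) + C * t ^ (e / 2) := by
  set K : ℝ := 2 * (4 + P) with hK
  have hK0 : 0 ≤ K := by positivity
  refine ⟨L + A * (K ^ 2 / (4 * δ)) + A * L / η, by positivity, ?_⟩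
  intro p e a t h d da dp hp hpP ha haA ht hd hda hdp hpe
  have ht0 : 0 < t := by linarith
  have hh : 0 ≤ h := by
    have h1 := (abs_nonneg d).trans hd
    have h2 : 0 < 2 * t ^ (1 / 2 : ℝ) := by positivity
    exact nonneg_of_mul_nonneg_right h1 h2
  have hpabs : 2 * (2 + |p / 2 - 2|) ≤ K := by
    have : |p / 2 - 2| ≤ 2 + P := abs_le.2 ⟨by linarith, by linarith⟩
    linarith
  have hte : t ^ (p / 2) ≤ t ^ (e / 2) := Real.rpow_le_rpow_of_exponent_le ht (by linarith)
  have hte' : t ^ (p / 2 + η) ≤ t ^ (e / 2) := Real.rpow_le_rpow_of_exponent_le ht (by linarith)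
  have b1 : |truncPow t (p / 2) * da| ≤ L * t ^ (e / 2) := by
    rw [abs_mul, abs_of_nonneg (truncPow_nonneg _ _), mul_comm L]
    exact mul_le_mul ((truncPow_le ht _).trans hte) hda (abs_nonneg _) (by positivity)
  have b2 := abs_truncPow_deriv_le (σ := p / 2) ht hd hdp
  have b3 : 2 * (2 + |p / 2 - 2|) * t ^ (p / 2 - 1 / 2) * h
      ≤ δ * (t ^ ((p - 2) / 2) * h ^ 2) + K ^ 2 / (4 * δ) * t ^ (e / 2) := by
    set X := t ^ ((p - 2) / 2 / 2) with hX
    set Y := t ^ (p / 2 / 2) with hY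
    have hXX : t ^ ((p - 2) / 2) = X ^ 2 := by
      rw [hX, sq, ← Real.rpow_add ht0]; congr 1; ring
    have hYY : t ^ (p / 2) = Y ^ 2 := by
      rw [hY, sq, ← Real.rpow_add ht0]; congr 1; ring
    have hXY : t ^ (p / 2 - 1 / 2) = X * Y := by
      rw [hX, hY, ← Real.rpow_add ht0]; congr 1; ring
    have h1 : K ^ 2 / (4 * δ) * Y ^ 2 ≤ K ^ 2 / (4 * δ) * t ^ (e / 2) := by
      rw [← hYY]; gcongr
    have h2 : 2 * (2 + |p / 2 - 2|) * (X * Y) * h ≤ K * (X * Y) * h := by gcongr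
    have h3 : δ * (X ^ 2 * h ^ 2) + K ^ 2 / (4 * δ) * Y ^ 2 - K * (X * Y) * h
        = (2 * δ * (X * h) - K * Y) ^ 2 / (4 * δ) := by
      field_simp; ring
    have h4 : 0 ≤ (2 * δ * (X * h) - K * Y) ^ 2 / (4 * δ) := by positivity
    rw [hXX, hXY]
    linarith
  have b4 : L * t ^ (p / 2) * Real.log t ≤ L / η * t ^ (e / 2) := by
    have hlog := Real.log_le_rpow_div ht0.le hη
    calc L * t ^ (p / 2) * Real.log t ≤ L * t ^ (p / 2) * (t ^ η / η) := by gcongr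
      _ = L / η * t ^ (p / 2 + η) := by rw [Real.rpow_add ht0]; ring
      _ ≤ L / η * t ^ (e / 2) := by gcongr
  have b5 : |a * (truncPowT t (p / 2) * d + truncPowS t (p / 2) * dp)| ≤
      a * (δ * (t ^ ((p - 2) / 2) * h ^ 2))
        + A * (K ^ 2 / (4 * δ) * t ^ (e / 2) + L / η * t ^ (e / 2)) := by
    rw [abs_mul, abs_of_nonneg ha]
    calc a * |truncPowT t (p / 2) * d + truncPowS t (p / 2) * dp|
        ≤ a * (δ * (t ^ ((p - 2) / 2) * h ^ 2)
          + (K ^ 2 / (4 * δ) * t ^ (e / 2) + L / η * t ^ (e / 2))) := by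
          refine mul_le_mul_of_nonneg_left ?_ ha
          linarith
      _ = a * (δ * (t ^ ((p - 2) / 2) * h ^ 2))
          + a * (K ^ 2 / (4 * δ) * t ^ (e / 2) + L / η * t ^ (e / 2)) := by ring
      _ ≤ _ := by gcongr
  refine (abs_add_le _ _).trans ((add_le_add b1 b5).trans_eq ?_)
  ring

lemma rpow_le_two_mul_rpow_add {ε t p : ℝ} (hε : ε ∈ Set.Ioo (0 : ℝ) 1) (ht : 1 ≤ t) (hp : 0 ≤ p) :
    t ^ ((p - 2) / 2) ≤ 2 * (ε ^ 2 + t) ^ ((p - 2) / 2) := by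
  have ht0 : 0 < t := by linarith
  have hε1 : ε ^ 2 ≤ 1 := pow_le_one₀ hε.1.le hε.2.le
  have hε0 : 0 < ε ^ 2 := pow_pos hε.1 2
  rcases le_total 2 p with h2 | h2
  · have h1 : t ^ ((p - 2) / 2) ≤ (ε ^ 2 + t) ^ ((p - 2) / 2) :=
      Real.rpow_le_rpow ht0.le (by linarith) (by linarith)
    have h3 : 0 ≤ t ^ ((p - 2) / 2) := by positivity
    linarith
  · have h1 : (2 * t) ^ ((p - 2) / 2) ≤ (ε ^ 2 + t) ^ ((p - 2) / 2) :=
      Real.rpow_le_rpow_of_nonpos (by linarith) (by linarith) (by linarith)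
    have h3 : (2 : ℝ) ^ (-1 : ℝ) ≤ 2 ^ ((p - 2) / 2) :=
      Real.rpow_le_rpow_of_exponent_le one_le_two (by linarith)
    rw [Real.mul_rpow zero_le_two ht0.le] at h1
    rw [Real.rpow_neg_one] at h3
    have h4 : 0 ≤ t ^ ((p - 2) / 2) := by positivity
    nlinarith

lemma rpow_add_mul_le {ε t p P : ℝ} (hε : ε ∈ Set.Ioo (0 : ℝ) 1) (ht : 0 ≤ t) (hp : 0 ≤ p)
    (hP : p ≤ P) :
    (ε ^ 2 + t) ^ ((p - 2) / 2) * t ≤ 4 * 3 ^ P * (1 + truncPow t (p / 2)) := by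
  have hε1 : ε ^ 2 ≤ 1 := pow_le_one₀ hε.1.le hε.2.le
  have hε0 : 0 < ε ^ 2 := pow_pos hε.1 2
  have hβ : 0 < ε ^ 2 + t := by linarith
  have hT := truncPow_nonneg t (p / 2)
  have h1 : (ε ^ 2 + t) ^ ((p - 2) / 2) * t ≤ (ε ^ 2 + t) ^ (p / 2) := by
    rw [show p / 2 = (p - 2) / 2 + 1 by ring, Real.rpow_add_one hβ.ne']
    gcongr
    linarith
  have h3 : (3 : ℝ) ^ (p / 2) ≤ 3 ^ P :=
    Real.rpow_le_rpow_of_exponent_le (by norm_num) (by linarith)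
  have h3P : (0 : ℝ) < 3 ^ P := by positivity
  rcases le_total 2 t with h2 | h2
  · calc (ε ^ 2 + t) ^ ((p - 2) / 2) * t ≤ (ε ^ 2 + t) ^ (p / 2) := h1
      _ ≤ (3 * t) ^ (p / 2) := by gcongr; linarith
      _ = 3 ^ (p / 2) * t ^ (p / 2) := Real.mul_rpow (by norm_num) ht
      _ ≤ 3 ^ P * (4 * truncPow t (p / 2)) :=
          mul_le_mul h3 (rpow_le_truncPow h2 _) (by positivity) h3P.le
      _ ≤ _ := by nlinarith
  · calc (ε ^ 2 + t) ^ ((p - 2) / 2) * t ≤ (ε ^ 2 + t) ^ (p / 2) := h1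
      _ ≤ 3 ^ (p / 2) := by gcongr; linarith
      _ ≤ 3 ^ P := h3
      _ ≤ _ := by nlinarith [mul_nonneg h3P.le hT]

section

variable {N : ℕ} {Ω : Set (EuclideanSpace ℝ (Fin N))} {sm sp α ap bp ε : ℝ} {L : ℝ≥0}
  {p q a b : EuclideanSpace ℝ (Fin N) → ℝ} {x ξ : EuclideanSpace ℝ (Fin N)}

lemma Data.F_nonneg (hD : Data Ω sm sp L α ap bp p q a b) (hx : x ∈ closure Ω) :
    0 ≤ F p q a b ε x ξ := by
  have := hD.a_nonneg x hx
  have := hD.b_nonneg x hx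
  unfold F
  positivity

lemma Data.nonneg_left (hD : Data Ω sm sp L α ap bp p q a b) (hsm : 0 ≤ sm) (hx : x ∈ closure Ω) :
    0 ≤ p x := hsm.trans ((hD.lower x hx).trans (min_le_left _ _))

lemma Data.nonneg_right (hD : Data Ω sm sp L α ap bp p q a b) (hsm : 0 ≤ sm)
    (hx : x ∈ closure Ω) : 0 ≤ q x := hsm.trans ((hD.lower x hx).trans (min_le_right _ _))

lemma Data.left_le (hD : Data Ω sm sp L α ap bp p q a b) (hx : x ∈ closure Ω) :
    p x ≤ min (p x) (q x) + 2 / ((N : ℝ) + 2) := by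
  have h := abs_lt.1 (hD.gap x hx)
  rcases min_cases (p x) (q x) with ⟨h1, -⟩ | ⟨h1, -⟩
  · have : (0 : ℝ) < 2 / ((N : ℝ) + 2) := by positivity
    linarith
  · linarith [h.2]

lemma Data.right_le (hD : Data Ω sm sp L α ap bp p q a b) (hx : x ∈ closure Ω) :
    q x ≤ min (p x) (q x) + 2 / ((N : ℝ) + 2) := by
  have h := abs_lt.1 (hD.gap x hx)
  rcases min_cases (p x) (q x) with ⟨h1, -⟩ | ⟨h1, -⟩
  · linarith [h.1]
  · have : (0 : ℝ) < 2 / ((N : ℝ) + 2) := by positivity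
    linarith

/-- `F_ε` is bounded below by half of its value for `ε = 0`, as long as `|ξ| ≥ 1`. -/
lemma Data.le_two_mul_F (hD : Data Ω sm sp L α ap bp p q a b) (hsm : 0 ≤ sm) (hx : x ∈ closure Ω)
    (hε : ε ∈ Set.Ioo (0 : ℝ) 1) (hξ : 1 ≤ ‖ξ‖ ^ 2) :
    a x * (‖ξ‖ ^ 2) ^ ((p x - 2) / 2) + b x * (‖ξ‖ ^ 2) ^ ((q x - 2) / 2)
      ≤ 2 * F p q a b ε x ξ := by
  have h1 := mul_le_mul_of_nonneg_left
    (rpow_le_two_mul_rpow_add hε hξ (hD.nonneg_left hsm hx)) (hD.a_nonneg x hx)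
  have h2 := mul_le_mul_of_nonneg_left
    (rpow_le_two_mul_rpow_add hε hξ (hD.nonneg_right hsm hx)) (hD.b_nonneg x hx)
  unfold F
  linarith

lemma Data.rpow_min_le (hD : Data Ω sm sp L α ap bp p q a b) (hsm : 0 ≤ sm) (hx : x ∈ closure Ω)
    (hε : ε ∈ Set.Ioo (0 : ℝ) 1) (hξ : 1 ≤ ‖ξ‖ ^ 2) :
    α * (‖ξ‖ ^ 2) ^ ((min (p x) (q x) - 2) / 2) ≤ 2 * F p q a b ε x ξ := by
  refine le_trans ?_ (hD.le_two_mul_F hsm hx hε hξ)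
  have ha := hD.a_nonneg x hx
  have hb := hD.b_nonneg x hx
  have h1 : (‖ξ‖ ^ 2) ^ ((min (p x) (q x) - 2) / 2) ≤ (‖ξ‖ ^ 2) ^ ((p x - 2) / 2) :=
    Real.rpow_le_rpow_of_exponent_le hξ (by have := min_le_left (p x) (q x); linarith)
  have h2 : (‖ξ‖ ^ 2) ^ ((min (p x) (q x) - 2) / 2) ≤ (‖ξ‖ ^ 2) ^ ((q x - 2) / 2) :=
    Real.rpow_le_rpow_of_exponent_le hξ (by have := min_le_right (p x) (q x); linarith)
  calc α * (‖ξ‖ ^ 2) ^ ((min (p x) (q x) - 2) / 2)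
      ≤ (a x + b x) * (‖ξ‖ ^ 2) ^ ((min (p x) (q x) - 2) / 2) := by
        gcongr
        exact hD.nondegenerate x hx
    _ = a x * (‖ξ‖ ^ 2) ^ ((min (p x) (q x) - 2) / 2)
        + b x * (‖ξ‖ ^ 2) ^ ((min (p x) (q x) - 2) / 2) := add_mul _ _ _
    _ ≤ _ := by gcongr

lemma Data.F_mul_sq_le (hD : Data Ω sm sp L α ap bp p q a b) (hsm : 0 ≤ sm) (hx : x ∈ closure Ω)
    (hε : ε ∈ Set.Ioo (0 : ℝ) 1) {P : ℝ} (hp : p x ≤ P) (hq : q x ≤ P) :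
    F p q a b ε x ξ * ‖ξ‖ ^ 2 ≤ 4 * 3 ^ P * (ap + bp)
      + 4 * 3 ^ P * (a x * truncPow (‖ξ‖ ^ 2) (p x / 2) + b x * truncPow (‖ξ‖ ^ 2) (q x / 2)) := by
  have ha := hD.a_nonneg x hx
  have hb := hD.b_nonneg x hx
  have h1 := mul_le_mul_of_nonneg_left
    (rpow_add_mul_le hε (sq_nonneg ‖ξ‖) (hD.nonneg_left hsm hx) hp) ha
  have h2 := mul_le_mul_of_nonneg_left
    (rpow_add_mul_le hε (sq_nonneg ‖ξ‖) (hD.nonneg_right hsm hx) hq) hb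
  have h3 : 4 * 3 ^ P * (a x + b x) ≤ 4 * 3 ^ P * (ap + bp) := by
    have := hD.a_le x hx
    have := hD.b_le x hx
    gcongr
  unfold F
  linarith

lemma Data.continuousOn_F (hD : Data Ω sm sp L α ap bp p q a b) (hε : ε ∈ Set.Ioo (0 : ℝ) 1)
    {Du : EuclideanSpace ℝ (Fin N) → EuclideanSpace ℝ (Fin N)}
    (hDu : ContinuousOn Du (closure Ω)) :
    ContinuousOn (fun x => F p q a b ε x (Du x)) (closure Ω) := by
  have hε0 : 0 < ε ^ 2 := pow_pos hε.1 2
  have hβ : ContinuousOn (fun x => ε ^ 2 + ‖Du x‖ ^ 2) (closure Ω) :=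
    continuousOn_const.add (hDu.norm.pow 2)
  have hne : ∀ x ∈ closure Ω, ε ^ 2 + ‖Du x‖ ^ 2 ≠ 0 := fun x _ => by positivity
  have hp : ContinuousOn (fun x => (p x - 2) / 2) (closure Ω) :=
    (hD.lipschitz_p.continuousOn.sub continuousOn_const).div_const 2
  have hq : ContinuousOn (fun x => (q x - 2) / 2) (closure Ω) :=
    (hD.lipschitz_q.continuousOn.sub continuousOn_const).div_const 2
  exact (hD.lipschitz_a.continuousOn.mul (hβ.rpow hp fun x hx => Or.inl (hne x hx))).add
    (hD.lipschitz_b.continuousOn.mul (hβ.rpow hq fun x hx => Or.inl (hne x hx)))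

end

section

variable {N : ℕ} {Ω : Set (EuclideanSpace ℝ (Fin N))} {sm sp α ap bp ε : ℝ} {L : ℝ≥0}
  {p q a b u : EuclideanSpace ℝ (Fin N) → ℝ}
  {Du : EuclideanSpace ℝ (Fin N) → EuclideanSpace ℝ (Fin N)}
  {D2u : Fin N → Fin N → EuclideanSpace ℝ (Fin N) → ℝ}

lemma Data.integrableOn_F_mul_hessSq (hD : Data Ω sm sp L α ap bp p q a b) (hΩ : IsOpen Ω)
    (hb : Bornology.IsBounded Ω) (hε : ε ∈ Set.Ioo (0 : ℝ) 1) (hu : IsC1Closure Ω u Du)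
    (hu2 : IsH2 Ω u Du D2u) :
    IntegrableOn (fun x => F p q a b ε x (Du x) * hessSq D2u x) Ω := by
  have hF := hD.continuousOn_F hε hu.continuousOn_grad
  obtain ⟨C, hC⟩ := hb.isCompact_closure.exists_bound_of_continuousOn hF
  exact Integrable.bdd_mul (c := C) hu2.integrableOn_hessSq
    ((hF.mono subset_closure).aestronglyMeasurable hΩ.measurableSet)
    ((ae_restrict_iff' hΩ.measurableSet).2
      (Eventually.of_forall fun x hx => hC x (subset_closure hx)))

/-- The weakly differentiable function to which the trace inequality is applied: a truncation of
`a |∇u|^p + b |∇u|^q`. The gap condition enters through `|∇u|^p, |∇u|^q ≤ |∇u|^e / |∇u|^(1/(N+2))`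
for `e = min p q + 3/(N+2)` and `|∇u| ≥ 1`, which leaves room for a logarithm. -/
lemma exists_weakDiff_truncation (hΩ : IsOpen Ω) (hb : Bornology.IsBounded Ω) (hsm : 0 ≤ sm)
    {P A δ : ℝ} (hP : 0 ≤ P) (hA : 0 ≤ A) (hap : ap ≤ A) (hbp : bp ≤ A) (hδ : 0 < δ) :
    ∃ C : ℝ, 0 ≤ C ∧ ∀ {p q a b : EuclideanSpace ℝ (Fin N) → ℝ} {ε : ℝ}
      {u : EuclideanSpace ℝ (Fin N) → ℝ}
      {Du : EuclideanSpace ℝ (Fin N) → EuclideanSpace ℝ (Fin N)}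
      {D2u : Fin N → Fin N → EuclideanSpace ℝ (Fin N) → ℝ},
      LipschitzWith L p → LipschitzWith L q → LipschitzWith L a → LipschitzWith L b →
      Data Ω sm sp L α ap bp p q a b → (∀ x ∈ Ω, p x ≤ P) → (∀ x ∈ Ω, q x ≤ P) →
      ε ∈ Set.Ioo (0 : ℝ) 1 → IsC1Closure Ω u Du → IsH2 Ω u Du D2u →
      ∃ g, WeakDiff Ω (fun x => a x * truncPow (‖Du x‖ ^ 2) (p x / 2)
          + b x * truncPow (‖Du x‖ ^ 2) (q x / 2)) g ∧
        ∀ j, ∀ x ∈ Ω, |g j x| ≤ δ * (F p q a b ε x (Du x) * hessSq D2u x)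
          + C * ‖Du x‖ ^ (min (p x) (q x) + 3 / ((N : ℝ) + 2)) := by
  have hfin : volume Ω ≠ ⊤ := hb.measure_lt_top.ne
  have hη : (0 : ℝ) < 1 / (2 * ((N : ℝ) + 2)) := by positivity
  obtain ⟨C, hC0, hC⟩ := exists_weighted_gradient_bound hP hA L.2 hη (half_pos hδ)
  refine ⟨2 * C, by positivity, fun {p q a b ε u Du D2u} hLp hLq hLa hLb hD hpP hqP hε hu hu2 => ?_⟩
  have half : ∀ {f : EuclideanSpace ℝ (Fin N) → ℝ}, LipschitzWith L f →
      LipschitzWith L fun x => f x / 2 := fun {f} hf => LipschitzWith.of_dist_le_mul fun x y => by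
    have h1 := hf.dist_le_mul x y
    rw [Real.dist_eq] at h1 ⊢
    rw [← sub_div, abs_div, abs_two]
    have := abs_nonneg (f x - f y)
    linarith
  have ht := hu2.weakDiff_normSq hu hΩ hb
  have hw : ∀ {f c : EuclideanSpace ℝ (Fin N) → ℝ}, LipschitzWith L f → LipschitzWith L c →
      WeakDiff Ω (fun x => c x * truncPow (‖Du x‖ ^ 2) (f x / 2)) _ := fun hf hc =>
    (weakDiff_of_lipschitzWith hΩ hb hc).mul hΩ hfin
      (ht.truncPow hΩ hfin (weakDiff_of_lipschitzWith hΩ hb (half hf)))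
  refine ⟨_, (hw hLp hLa).add hΩ hfin (hw hLq hLb), fun j x hx => ?_⟩
  have hxc := subset_closure hx
  have hH := hessSq_nonneg (D2u := D2u) x
  rcases le_total (‖Du x‖ ^ 2) 1 with h1 | h1
  · simp only [truncPow_of_le h1, truncPowT_of_le h1, truncPowS_of_le h1]
    have h2 := hD.F_nonneg (ε := ε) (ξ := Du x) hxc
    simp only [zero_mul, mul_zero, add_zero, abs_zero]
    positivity
  have hd := abs_deriv_normSq_le (D2u := D2u) (Du x) x j
  rw [norm_eq_sq_rpow (Du x)] at hd
  have hgap : 2 / ((N : ℝ) + 2) + 2 * (1 / (2 * ((N : ℝ) + 2))) = 3 / ((N : ℝ) + 2) := by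
    field_simp; norm_num
  have ha := hC (p x) (min (p x) (q x) + 3 / ((N : ℝ) + 2)) (a x) _ _ _ _ _
    (hD.nonneg_left hsm hxc) (hpP x hx) (hD.a_nonneg x hxc) ((hD.a_le x hxc).trans hap) h1 hd
    (abs_lineDeriv_le hLa x j) (abs_lineDeriv_le (half hLp) x j)
    (by linarith [hD.left_le hxc])
  have hb := hC (q x) (min (p x) (q x) + 3 / ((N : ℝ) + 2)) (b x) _ _ _ _ _
    (hD.nonneg_right hsm hxc) (hqP x hx) (hD.b_nonneg x hxc) ((hD.b_le x hxc).trans hbp) h1 hd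
    (abs_lineDeriv_le hLb x j) (abs_lineDeriv_le (half hLq) x j)
    (by linarith [hD.right_le hxc])
  rw [← norm_rpow_eq _ (min (p x) (q x) + 3 / ((N : ℝ) + 2)), Real.sq_sqrt hH] at ha hb
  refine (abs_add_le _ _).trans ((add_le_add ha hb).trans ?_)
  have hF := mul_le_mul_of_nonneg_left (mul_le_mul_of_nonneg_right
    (hD.le_two_mul_F hsm hxc hε h1) hH) (half_pos hδ).le
  linarith

lemma Data.truncation_le (hD : Data Ω sm sp L α ap bp p q a b) {x ξ : EuclideanSpace ℝ (Fin N)}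
    (hx : x ∈ closure Ω) :
    |a x * truncPow (‖ξ‖ ^ 2) (p x / 2) + b x * truncPow (‖ξ‖ ^ 2) (q x / 2)|
      ≤ (ap + bp) * ‖ξ‖ ^ (min (p x) (q x) + 3 / ((N : ℝ) + 2)) := by
  have ha := hD.a_nonneg x hx
  have hb := hD.b_nonneg x hx
  have hap := hD.a_le x hx
  have hbp := hD.b_le x hx
  have h0 : 0 ≤ ap + bp := by linarith
  rw [abs_of_nonneg (add_nonneg (mul_nonneg ha (truncPow_nonneg _ _))
    (mul_nonneg hb (truncPow_nonneg _ _)))]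
  rcases le_total (‖ξ‖ ^ 2) 1 with h1 | h1
  · rw [truncPow_of_le h1, truncPow_of_le h1]
    simp only [mul_zero, add_zero]
    positivity
  have h23 : 2 / ((N : ℝ) + 2) ≤ 3 / ((N : ℝ) + 2) := by gcongr; norm_num
  have key : ∀ r, r ≤ min (p x) (q x) + 2 / ((N : ℝ) + 2) → truncPow (‖ξ‖ ^ 2) (r / 2)
      ≤ ‖ξ‖ ^ (min (p x) (q x) + 3 / ((N : ℝ) + 2)) := fun r hr => by
    rw [norm_rpow_eq]
    exact (truncPow_le h1 _).trans (Real.rpow_le_rpow_of_exponent_le h1 (by linarith))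
  rw [add_mul]
  exact add_le_add (mul_le_mul hap (key _ (hD.left_le hx)) (truncPow_nonneg _ _) (ha.trans hap))
    (mul_le_mul hbp (key _ (hD.right_le hx)) (truncPow_nonneg _ _) (hb.trans hbp))

set_option maxHeartbeats 600000 in
/-- The boundary estimate for data that are Lipschitz continuous on the whole space. -/
lemma exists_boundary_estimate (hN : 2 ≤ N) (hΩ : IsOpen Ω) (hb : Bornology.IsBounded Ω)
    (hC2 : HasC2Boundary Ω) (hsm : 2 * (N : ℝ) / ((N : ℝ) + 2) < sm) (sp : ℝ) (L : ℝ≥0)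
    (hα : 0 < α) (ap bp M : ℝ) {lam : ℝ} (hlam : 0 < lam) :
    ∃ C : ℝ, ∀ {p q a b : EuclideanSpace ℝ (Fin N) → ℝ} {ε : ℝ}
      {u : EuclideanSpace ℝ (Fin N) → ℝ}
      {Du : EuclideanSpace ℝ (Fin N) → EuclideanSpace ℝ (Fin N)}
      {D2u : Fin N → Fin N → EuclideanSpace ℝ (Fin N) → ℝ},
      LipschitzWith L p → LipschitzWith L q → LipschitzWith L a → LipschitzWith L b →
      Data Ω sm sp L α ap bp p q a b → ε ∈ Set.Ioo (0 : ℝ) 1 → IsC1Closure Ω u Du →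
      IsH2 Ω u Du D2u → IsH10 Ω u Du → eLpNorm u 2 (volume.restrict Ω) ≤ ENNReal.ofReal M →
      ∫ x, F p q a b ε x (Du x) * ‖Du x‖ ^ 2 ∂(surfaceMeasure Ω)
        ≤ lam * (∫ x in Ω, F p q a b ε x (Du x) * hessSq D2u x) + C := by
  have hΩm := hΩ.measurableSet
  have hfin : volume Ω ≠ ⊤ := hb.measure_lt_top.ne
  have := isFiniteMeasure_surfaceMeasure hΩ hb hC2
  have hsm0 : 0 ≤ sm := le_trans (by positivity) hsm.le
  set s₁ : ℝ := max sm sp with hs₁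
  set P : ℝ := s₁ + 1 with hP
  have hs₁0 : 0 ≤ s₁ := hsm0.trans (le_max_left _ _)
  have hP0 : 0 ≤ P := by linarith
  set A : ℝ := max (max ap bp) 0
  have hA0 : 0 ≤ A := le_max_right _ _
  have hapA : ap ≤ A := (le_max_left _ _).trans (le_max_left _ _)
  have hbpA : bp ≤ A := (le_max_right _ _).trans (le_max_left _ _)
  obtain ⟨T, hT0, hT⟩ := exists_integral_surfaceMeasure_le hΩ hb hC2
  set K : ℝ := 4 * 3 ^ P with hK
  have hK0 : 0 < K := by positivity
  set S : ℝ := (surfaceMeasure Ω).real Set.univ with hS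
  have hS0 : 0 ≤ S := measureReal_nonneg
  set δ₁ : ℝ := lam / (2 * (K * T * N + 1)) with hδ₁
  have hδ₁0 : 0 < δ₁ := by positivity
  obtain ⟨C₁, hC₁0, hC₁⟩ := exists_weakDiff_truncation (sm := sm) (sp := sp) (α := α) (ap := ap)
    (bp := bp) (L := L) hΩ hb hsm0 hP0 hA0 hapA hbpA hδ₁0
  set D : ℝ := K * T * (2 * A + N * C₁) with hD
  have hD0 : 0 ≤ D := by positivity
  set δ₂ : ℝ := lam * α / (4 * (D + 1)) with hδ₂
  have hδ₂0 : 0 < δ₂ := by positivity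
  obtain ⟨C₂, hC₂0, hC₂⟩ := exists_interpolation (s₁ := s₁) hN hΩ hb hsm (le_max_left _ _) L M hδ₂0
  refine ⟨K * (2 * A) * S + D * C₂, ?_⟩
  intro p q a b ε u Du D2u hLp hLq hLa hLb hdata hε hu hu2 h0 huM
  set s : EuclideanSpace ℝ (Fin N) → ℝ := fun x => min (p x) (q x) with hs
  have hLs : LipschitzWith L s := by simpa using hLp.min hLq
  have hss₀ : ∀ x ∈ Ω, sm ≤ s x := fun x hx => hdata.lower x (subset_closure hx)
  have hss₁ : ∀ x ∈ closure Ω, s x ≤ s₁ := fun x hx =>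
    (hdata.upper x hx).trans (le_max_right _ _)
  have h2N : 2 / ((N : ℝ) + 2) ≤ 1 := by
    rw [div_le_one (by positivity)]
    have : (0 : ℝ) ≤ N := Nat.cast_nonneg N
    linarith
  have hpP : ∀ x ∈ closure Ω, p x ≤ P := fun x hx => by
    have h1 := hdata.left_le hx
    have h2 := hss₁ x hx
    simp only [hs] at h2
    linarith
  have hqP : ∀ x ∈ closure Ω, q x ≤ P := fun x hx => by
    have h1 := hdata.right_le hx
    have h2 := hss₁ x hx
    simp only [hs] at h2
    linarith
  have hFH := hdata.integrableOn_F_mul_hessSq hΩ hb hε hu hu2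
  have hFH0 : ∀ x ∈ Ω, 0 ≤ F p q a b ε x (Du x) * hessSq D2u x := fun x hx =>
    mul_nonneg (hdata.F_nonneg (subset_closure hx)) (hessSq_nonneg x)
  set Z := ∫ x in Ω, F p q a b ε x (Du x) * hessSq D2u x with hZ
  have hZ0 : 0 ≤ Z := setIntegral_nonneg hΩm hFH0
  have hX := hC₂ (Φ := fun x => 2 / α * (F p q a b ε x (Du x) * hessSq D2u x)) hLs hss₀
    (fun x hx => hss₁ x (subset_closure hx)) hu hu2 h0 huM (hFH.const_mul _)
    (fun x hx => mul_nonneg (by positivity) (hFH0 x hx)) (fun x hx h1 => by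
      have h := mul_le_mul_of_nonneg_right (hdata.rpow_min_le hsm0 (subset_closure hx) hε h1)
        (hessSq_nonneg (D2u := D2u) x)
      rw [div_mul_eq_mul_div, le_div_iff₀ hα]
      linarith)
  rw [integral_const_mul, ← hZ] at hX
  set X := ∫ x in Ω, ‖Du x‖ ^ (s x + 3 / ((N : ℝ) + 2)) with hXdef
  obtain ⟨g, hg, hgle⟩ := hC₁ hLp hLq hLa hLb hdata (fun x hx => hpP x (subset_closure hx))
    (fun x hx => hqP x (subset_closure hx)) hε hu hu2
  set v : EuclideanSpace ℝ (Fin N) → ℝ := fun x =>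
    a x * truncPow (‖Du x‖ ^ 2) (p x / 2) + b x * truncPow (‖Du x‖ ^ 2) (q x / 2) with hv
  have htrunc : ∀ {f : EuclideanSpace ℝ (Fin N) → ℝ}, LipschitzWith L f →
      ContinuousOn (fun x => truncPow (‖Du x‖ ^ 2) (f x / 2)) (closure Ω) := fun hf =>
    continuous_truncPow.comp_continuousOn
      ((hu.continuousOn_grad.norm.pow 2).prodMk (hf.continuous.continuousOn.div_const 2))
  have hvc : ContinuousOn v (closure Ω) := (hLa.continuous.continuousOn.mul (htrunc hLp)).add
    (hLb.continuous.continuousOn.mul (htrunc hLq))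
  have hFc : ContinuousOn (fun x => F p q a b ε x (Du x) * ‖Du x‖ ^ 2) (closure Ω) :=
    (hdata.continuousOn_F hε hu.continuousOn_grad).mul (hu.continuousOn_grad.norm.pow 2)
  have hDe : IntegrableOn (fun x => ‖Du x‖ ^ (s x + 3 / ((N : ℝ) + 2))) Ω := by
    obtain ⟨R, -, hR⟩ := hu.exists_bound hb
    refine integrableOn_rpow (C := R) (S := s₁ + 3 / ((N : ℝ) + 2)) hΩm hfin
      ((hu.continuousOn_grad.norm.mono subset_closure).aestronglyMeasurable hΩm)
      (hLs.continuous.aestronglyMeasurable.add aestronglyMeasurable_const)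
      (fun x _ => norm_nonneg _) (fun x hx => hR x (subset_closure hx)) (fun x hx => ?_)
      fun x hx => ?_
    · have := hss₀ x hx
      have : 0 ≤ s x := by linarith
      positivity
    · have := hss₁ x (subset_closure hx)
      linarith
  -- Passage to the truncation on the boundary, and the trace inequality.
  have k1 : ∫ x, F p q a b ε x (Du x) * ‖Du x‖ ^ 2 ∂(surfaceMeasure Ω)
      ≤ K * (2 * A) * S + K * ∫ x, |v x| ∂(surfaceMeasure Ω) := by
    have iv : Integrable (fun x => K * |v x|) (surfaceMeasure Ω) :=
      (integrable_surfaceMeasure hb hvc).abs.const_mul K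
    have ic : Integrable (fun _ => K * (2 * A)) (surfaceMeasure Ω) := integrable_const _
    have h1 : ∫ x, F p q a b ε x (Du x) * ‖Du x‖ ^ 2 ∂(surfaceMeasure Ω)
        ≤ ∫ x, (K * (2 * A) + K * |v x|) ∂(surfaceMeasure Ω) := by
      refine integral_mono_ae (integrable_surfaceMeasure hb hFc) (ic.add iv)
        ((ae_restrict_iff' isClosed_frontier.measurableSet).2 (Eventually.of_forall fun x hx => ?_))
      have hxc := frontier_subset_closure hx
      refine (hdata.F_mul_sq_le hsm0 hxc hε (hpP x hxc) (hqP x hxc)).trans ?_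
      have h2 := le_abs_self (v x)
      have h3 : K * (ap + bp) ≤ K * (2 * A) := by gcongr; linarith
      have h4 : K * v x ≤ K * |v x| := by gcongr
      exact add_le_add h3 h4
    rw [integral_add ic iv, integral_const, smul_eq_mul, integral_const_mul, ← hS] at h1
    linarith
  have k2 : ∫ x in Ω, |v x| ≤ 2 * A * X := by
    rw [hXdef, ← integral_const_mul]
    refine setIntegral_mono_on (hg.integrableOn hfin hΩm).abs (hDe.const_mul _) hΩm fun x hx => ?_
    refine (hdata.truncation_le (subset_closure hx)).trans ?_
    gcongr
    linarith
  have k3 : ∀ j, ∫ x in Ω, |g j x| ≤ δ₁ * Z + C₁ * X := fun j => by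
    have i1 : IntegrableOn (fun x => δ₁ * (F p q a b ε x (Du x) * hessSq D2u x)) Ω :=
      hFH.const_mul _
    have i2 : IntegrableOn (fun x => C₁ * ‖Du x‖ ^ (s x + 3 / ((N : ℝ) + 2))) Ω :=
      hDe.const_mul _
    rw [hXdef, hZ, ← integral_const_mul, ← integral_const_mul, ← integral_add i1 i2]
    exact setIntegral_mono_on (hg.int j).abs (i1.add i2) hΩm fun x hx => hgle j x hx
  have k4 : ∫ x, |v x| ∂(surfaceMeasure Ω) ≤ T * (2 * A * X + N * (δ₁ * Z + C₁ * X)) := by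
    refine (hT v g hvc hg).trans (mul_le_mul_of_nonneg_left (add_le_add k2 ?_) hT0)
    refine (Finset.sum_le_sum fun j _ => k3 j).trans_eq ?_
    rw [Finset.sum_const, Finset.card_univ, Fintype.card_fin, nsmul_eq_mul]
  -- The choice of `δ₁` and `δ₂`.
  have k5 : K * T * N * δ₁ ≤ lam / 2 := by
    rw [hδ₁, mul_div_assoc', div_le_iff₀ (by positivity)]
    have : 0 ≤ K * T * N := by positivity
    nlinarith
  have k6 : D * (δ₂ * (2 / α)) ≤ lam / 2 := by
    have : D * (δ₂ * (2 / α)) = D / (D + 1) * (lam / 2) := by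
      rw [hδ₂]; field_simp; ring
    rw [this]
    exact mul_le_of_le_one_left (by positivity) ((div_le_one (by positivity)).2 (by linarith))
  have k7 : K * T * N * δ₁ * Z ≤ lam / 2 * Z := by gcongr
  have k8 : D * (δ₂ * (2 / α)) * Z ≤ lam / 2 * Z := by gcongr
  have k9 := mul_le_mul_of_nonneg_left hX hD0
  have k10 := mul_le_mul_of_nonneg_left k4 hK0.le
  have k11 : K * (T * (2 * A * X + N * (δ₁ * Z + C₁ * X))) = K * T * N * δ₁ * Z + D * X := by
    rw [hD]; ring
  linarith

/-- The functions in the data can be extended from `closure Ω` to Lipschitz functions. -/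
lemma Data.exists_extension (hD : Data Ω sm sp L α ap bp p q a b) :
    ∃ p' q' a' b' : EuclideanSpace ℝ (Fin N) → ℝ, LipschitzWith L p' ∧ LipschitzWith L q' ∧
      LipschitzWith L a' ∧ LipschitzWith L b' ∧ Data Ω sm sp L α ap bp p' q' a' b' ∧
      ∀ ε, ∀ x ∈ closure Ω, ∀ ξ, F p q a b ε x ξ = F p' q' a' b' ε x ξ := by
  obtain ⟨p', hp', hpe⟩ := hD.lipschitz_p.extend_real
  obtain ⟨q', hq', hqe⟩ := hD.lipschitz_q.extend_real
  obtain ⟨a', ha', hae⟩ := hD.lipschitz_a.extend_real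
  obtain ⟨b', hb', hbe⟩ := hD.lipschitz_b.extend_real
  refine ⟨p', q', a', b', hp', hq', ha', hb', ⟨?_, ?_, ?_, hp'.lipschitzOnWith,
    hq'.lipschitzOnWith, ha'.lipschitzOnWith, hb'.lipschitzOnWith, ?_, ?_, ?_, ?_, ?_⟩,
    fun ε x hx ξ => ?_⟩
  · exact fun x hx => by rw [← hpe hx, ← hqe hx]; exact hD.lower x hx
  · exact fun x hx => by rw [← hpe hx, ← hqe hx]; exact hD.upper x hx
  · exact fun x hx => by rw [← hpe hx, ← hqe hx]; exact hD.gap x hx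
  · exact fun x hx => by rw [← hae hx]; exact hD.a_nonneg x hx
  · exact fun x hx => by rw [← hbe hx]; exact hD.b_nonneg x hx
  · exact fun x hx => by rw [← hae hx]; exact hD.a_le x hx
  · exact fun x hx => by rw [← hbe hx]; exact hD.b_le x hx
  · exact fun x hx => by rw [← hae hx, ← hbe hx]; exact hD.nondegenerate x hx
  · rw [F, F, hpe hx, hqe hx, hae hx, hbe hx]

end

end DoublePhase

theorem theorem4p2 (N : ℕ) (hN : 2 ≤ N) (Ω : Set (EuclideanSpace ℝ (Fin N)))
    (hΩo : IsOpen Ω) (hΩc : IsConnected Ω) (hΩb : Bornology.IsBounded Ω)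
    (hΩ : DoublePhase.HasC2Boundary Ω)
    (sm sp : ℝ) (hsm : 2 * (N : ℝ) / ((N : ℝ) + 2) < sm)
    (L : ℝ≥0) (α : ℝ) (hα : 0 < α) (ap bp M : ℝ)
    (lam : ℝ) (hlam : lam ∈ Set.Ioo (0 : ℝ) 1) :
    ∃ C : ℝ, ∀ p q a b : EuclideanSpace ℝ (Fin N) → ℝ,
      DoublePhase.Data Ω sm sp L α ap bp p q a b →
      ∀ ε ∈ Set.Ioo (0 : ℝ) 1,
      ∀ (u : EuclideanSpace ℝ (Fin N) → ℝ)
        (Du : EuclideanSpace ℝ (Fin N) → EuclideanSpace ℝ (Fin N))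
        (D2u : Fin N → Fin N → EuclideanSpace ℝ (Fin N) → ℝ),
        DoublePhase.IsC1Closure Ω u Du →
        DoublePhase.IsH2 Ω u Du D2u →
        DoublePhase.IsH10 Ω u Du →
        eLpNorm u 2 (volume.restrict Ω) ≤ ENNReal.ofReal M →
        Integrable (fun x => DoublePhase.F p q a b ε x (Du x) * ‖Du x‖ ^ 2)
            (DoublePhase.surfaceMeasure Ω) ∧
        IntegrableOn (fun x => DoublePhase.F p q a b ε x (Du x) * DoublePhase.hessSq D2u x) Ω ∧
        ∫ x, DoublePhase.F p q a b ε x (Du x) * ‖Du x‖ ^ 2 ∂(DoublePhase.surfaceMeasure Ω)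
          ≤ lam * (∫ x in Ω, DoublePhase.F p q a b ε x (Du x) * DoublePhase.hessSq D2u x) + C := by
  have := DoublePhase.isFiniteMeasure_surfaceMeasure hΩo hΩb hΩ
  obtain ⟨C, hC⟩ := DoublePhase.exists_boundary_estimate hN hΩo hΩb hΩ hsm sp L hα ap bp M hlam.1
  refine ⟨C, fun p q a b hD ε hε u Du D2u hu hu2 h0 huM => ?_⟩
  have hF := hD.continuousOn_F hε hu.continuousOn_grad
  refine ⟨DoublePhase.integrable_surfaceMeasure hΩb (hF.mul (hu.continuousOn_grad.norm.pow 2)),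
    hD.integrableOn_F_mul_hessSq hΩo hΩb hε hu hu2, ?_⟩
  obtain ⟨p', q', a', b', hp, hq, ha, hb, hD', hFF⟩ := hD.exists_extension
  have e1 : ∫ x, DoublePhase.F p q a b ε x (Du x) * ‖Du x‖ ^ 2 ∂(DoublePhase.surfaceMeasure Ω)
      = ∫ x, DoublePhase.F p' q' a' b' ε x (Du x) * ‖Du x‖ ^ 2 ∂(DoublePhase.surfaceMeasure Ω) :=
    setIntegral_congr_fun isClosed_frontier.measurableSet fun x hx => by
      simp only [hFF ε x (frontier_subset_closure hx)]
  have e2 : ∫ x in Ω, DoublePhase.F p q a b ε x (Du x) * DoublePhase.hessSq D2u x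
      = ∫ x in Ω, DoublePhase.F p' q' a' b' ε x (Du x) * DoublePhase.hessSq D2u x :=
    setIntegral_congr_fun hΩo.measurableSet fun x hx => by
      simp only [hFF ε x (subset_closure hx)]
  rw [e1, e2]
  exact hC hp hq ha hb hD' hε hu hu2 h0 huM
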